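/- **Setting.** Let $T$ be a finite tree with vertex set $V$ and let $(X_v)_{v\in V}$ be a jointly Gaussian vector with zero means and unit variances that forms a Markov chain on $T$: for disjoint $I,J\subseteq V$ and a vertex $v$ lying on every path from $I$ to $J$, $(X_i)_{i\in I}$ and $(X_j)_{j\in J}$ are conditionally independent given $X_v$. Put $\rho_{u,v}=\mathbb E[X_uX_v]$. For a vertex $r\in V$, root $T$ at $r$, write $\mathrm{parent}(u)$ for the parent of $u\ne r$, and let $V^*$ be the set of vertices that remain after deleting all leaves of the rooted tree (the root is kept); its root is $r$. For a full-rank lattice $\Lambda\subset\mathbb R^n$ let $Q_\Lambda$ map each point to a closest lattice point (ties being resolved by a fixed rule), $[x]\bmod\Lambda=x-Q_\Lambda(x)$, $\mathcal V(\Lambda)=\{x: Q_\Lambda(x)=0\}$, $\mathrm{vol}(\Lambda)=\mathrm{vol}(\mathcal V(\Lambda))$, and $\sigma^2(\Lambda)=\frac1{n\,\mathrm{vol}(\Lambda)}\int_{\mathcal V(\Lambda)}\|x\|^2dx$. A sequence of lattices (one in each dimension $n$) is *good for covering* if the ratio of its covering radius (the radius of the smallest closed ball centred at $0$ containing $\mathcal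 V(\Lambda)$) to its effective radius (the radius of a ball of volume $\mathrm{vol}(\Lambda)$) tends to $1$ as $n\to\infty$. It is *good for AWGN channel coding* if for every $\mu\ge 2\pi e$, a white Gaussian vector $Z\in\mathbb R^n$ with zero mean and variance $\mathrm{vol}(\Lambda)^{2/n}/\mu$ per dimension satisfies $\Pr[Z\notin\mathcal V(\Lambda)]\le e^{-n(E_U(\mu)-o_n(1))}$, where $E_U(\mu)$ equals $\frac{\mu}{16\pi e}$ for $\mu\ge8\pi e$, $\frac12\ln\frac{\mu}{8\pi}$ for $4\pi e\le\mu\le8\pi e$, and $\frac{\mu}{4\pi e}-\frac12\ln\frac{\mu}{2\pi}$ for $2\pi e\le\mu\le4\pi e$. Fix $\delta_0>0$ and reals $R_v$ ($v\in V$). For every $v\in V$ and every dimension $n$ let $\Lambda_v'\subseteq\Lambda_v$ be nested lattices in $\mathbb R^n$ such that $\frac1n\log_2\frac{\mathrm{vol}(\Lambda_v')}{\mathrm{vol}(\Lambda_v)}\to R_v$ as $n\to\infty$, $\ \frac{\mathrm{vol}(\Lambda_v')^{2/n}}{2\pi e}=(1+\sigma^2(\Lambda_v))(1+\delta_0)$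 for all $n\geq 1$, the sequence $\Lambda_v$ is good for covering, and the sequence $\Lambda_v'$ is good for AWGN channel coding. Let $N=nN_{\mathrm{out}}$, and take $N$ iid copies of $(X_v)_{v\in V}$; let $x_v^{(i)}\in\mathbb R^n$ be the $i$-th block of $n$ consecutive samples of terminal $v$, $1\le i\le N_{\mathrm{out}}$. Let the dithers $d_v^{(i)}$ be uniformly distributed over $\mathcal V(\Lambda_v)$, independent of each other and of the source, and put $$y_v^{(i)}=\big[Q_{\Lambda_v}(x_v^{(i)}+d_v^{(i)})-d_v^{(i)}\big]\bmod\Lambda_v',\qquad D_i=(d_v^{(i)}:v\in V^*).$$ **Lemma.** For every $\delta>0$ and all sufficiently large $n$ we have, for every $N_{\mathrm{out}}$ and every $1\le i\le N_{\mathrm{out}}$, with entropy measured in bits, $$\frac1nH\big(y_v^{(i)}:v\in V^*\,\big|\,D_i\big)\ \ge\ \frac12\log_2\Big(1+\frac1{\sigma^2(\Lambda_r)}\Big)+\sum_{u\in V^*\setminus\{r\}}\frac12\log_2\Big(1+\frac{1-\rho_{u,\mathrm{parent}(u)}^2}{\sigma^2(\Lambda_u)}\Big)-\delta .$$ -/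

import Mathlib

open MeasureTheory ProbabilityTheory Filter Topology
open scoped ENNReal

noncomputable section

namespace TreeKey

/-! ### Lattices in Euclidean space -/

/-- A full-rank lattice `Λ` in `ℝⁿ` together with a lattice quantizer `Q`: a map sending every
point to a closest lattice point (Euclidean distance), with an arbitrary fixed rule for ties. -/
structure QLattice (n : ℕ) where
  /-- the lattice -/
  Λ : Submodule ℤ (EuclideanSpace ℝ (Fin n))
  discrete : DiscreteTopology Λ
  fullRank : IsZLattice ℝ Λ
  /-- the lattice quantizer -/
  Q : EuclideanSpace ℝ (Fin n) → EuclideanSpace ℝ (Fin n)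
  Q_mem : ∀ x, Q x ∈ Λ
  Q_closest : ∀ x, ∀ y ∈ Λ, dist x (Q x) ≤ dist x y

namespace QLattice

variable {n : ℕ} (L : QLattice n)

/-- The reduction `[x] mod Λ = x - Q x`. -/
def modL (x : EuclideanSpace ℝ (Fin n)) : EuclideanSpace ℝ (Fin n) := x - L.Q x

/-- The fundamental Voronoi region. -/
def voronoi : Set (EuclideanSpace ℝ (Fin n)) := {x | L.Q x = 0}

/-- The volume of the fundamental Voronoi region. -/
def vol : ℝ := volume.real L.voronoi

/-- The second moment per dimension `σ²(Λ)`. -/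
def secondMoment : ℝ := 1 / (n * L.vol) * ∫ x in L.voronoi, ‖x‖ ^ 2

/-- The covering radius: the radius of the smallest closed ball centred at `0` that contains
the fundamental Voronoi region. -/
def covRadius : ℝ := sInf {R : ℝ | 0 ≤ R ∧ L.voronoi ⊆ Metric.closedBall 0 R}

/-- The effective radius: the radius of a ball in `ℝⁿ` whose volume is `vol Λ`. -/
def effRadius : ℝ :=
  (L.vol / volume.real (Metric.ball (0 : EuclideanSpace ℝ (Fin n)) 1)) ^ (1 / (n : ℝ))

end QLattice

/-- A sequence of lattices (indexed by dimension) is good for covering. -/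
def GoodForCovering (L : ∀ n, QLattice n) : Prop :=
  Tendsto (fun n => (L n).covRadius / (L n).effRadius) atTop (𝓝 1)

/-- The Poltyrev exponent (used for arguments at least `2πe`). -/
def poltyrevExponent (m : ℝ) : ℝ :=
  if 8 * Real.pi * Real.exp 1 ≤ m then m / (16 * Real.pi * Real.exp 1)
  else if 4 * Real.pi * Real.exp 1 ≤ m then 1 / 2 * Real.log (m / (8 * Real.pi))
  else m / (4 * Real.pi * Real.exp 1) - 1 / 2 * Real.log (m / (2 * Real.pi))

/-- A sequence of lattices is good for AWGN channel coding: for every volume-to-noise ratio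
`m ≥ 2πe`, a white Gaussian vector with variance `s` per dimension, where
`vol(Λ)^(2/n) / s = m`, leaves the Voronoi region with probability at most
`exp (-n (E_U(m) - o_n(1)))`. -/
def GoodForAWGN (L : ∀ n, QLattice n) : Prop :=
  ∀ m : ℝ, 2 * Real.pi * Real.exp 1 ≤ m →
    ∃ o : ℕ → ℝ, Tendsto o atTop (𝓝 0) ∧
      ∀ n : ℕ, 0 < n → ∀ s : ℝ, 0 < s → (L n).vol ^ (2 / (n : ℝ)) / s = m →
        (stdGaussian (EuclideanSpace ℝ (Fin n))).real {z | √s • z ∉ (L n).voronoi}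
          ≤ Real.exp (-(n * (poltyrevExponent m - o n)))

/-! ### Rooted trees -/

section Tree

variable {V : Type*} (T : SimpleGraph V) (r : V)

/-- `u` is the parent of `v` in `T` rooted at `r`: it lies on a shortest path from `r` to `v`
and is at distance `1` from `v`. -/
def IsParent (u v : V) : Prop :=
  (∃ p : T.Walk r v, p.length = T.dist r v ∧ u ∈ p.support) ∧ T.dist u v = 1

open Classical in
/-- The parent of `v` (for the root, which has no parent, the value is the root itself). -/
def parent (v : V) : V := if h : ∃ u, IsParent T r u v then h.choose else v

open Classical in
/-- The vertices of the tree obtained from `T` rooted at `r` by deleting all leaves,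
that is, all vertices other than the root that are not the parent of any vertex. -/
def coreVertices [Fintype V] : Finset V := {v | v = r ∨ ∃ u, IsParent T r v u}

end Tree

/-! ### Gaussian Markov tree sources -/

section Source

variable {V : Type*} [Fintype V]

/-- The coordinate process of a law `P` on `ℝ^V` is a Markov chain on the tree `T`: whenever every
path between the disjoint sets `I` and `J` passes through `v`, the families `(X_i)_{i ∈ I}` and
`(X_j)_{j ∈ J}` are conditionally independent given `X_v`. -/
def IsMarkovOnTree (T : SimpleGraph V) (P : Measure (V → ℝ)) [IsFiniteMeasure P] : Prop :=
  ∀ (I J : Set V) (v : V), Disjoint I J →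
    (∀ i ∈ I, ∀ j ∈ J, ∀ p : T.Walk i j, p.IsPath → v ∈ p.support) →
    CondIndepFun (MeasurableSpace.comap (fun x : V → ℝ => x v) inferInstance)
      (measurable_pi_apply v).comap_le
      (fun (x : V → ℝ) (i : I) => x i) (fun (x : V → ℝ) (j : J) => x j) P

/-- `P` is the law of a jointly Gaussian vector `(X_v)_{v ∈ V}` with zero means and unit variances
that forms a Markov chain on the tree `T`. -/
structure IsGaussianMarkovTreeSource (T : SimpleGraph V) (P : Measure (V → ℝ))
    [IsFiniteMeasure P] : Prop where
  isTree : T.IsTree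
  gaussian : IsGaussian P
  mean_zero : ∀ v, ∫ x, x v ∂P = 0
  unit_variance : ∀ v, ∫ x, x v ^ 2 ∂P = 1
  markov : IsMarkovOnTree T P

/-- The correlation coefficient `ρ_{uv} = E[X_u X_v]`. -/
def corr (P : Measure (V → ℝ)) (u v : V) : ℝ := ∫ x, x u * x v ∂P

end Source

/-! ### Conditional entropy -/

/-- The Shannon entropy, in bits, of a discrete probability measure. -/
def entropyBits {S : Type*} [MeasurableSpace S] (ν : Measure S) : ℝ≥0∞ :=
  ∑' s, ENNReal.ofReal (-(ν.real {s} * Real.logb 2 (ν.real {s})))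

/-- The conditional entropy `H(Y | D)`, in bits, of a random variable `Y` that is discrete given
`D`: the entropy of the regular conditional distribution of `Y` given `D = d`, averaged over the
law of `D`. -/
def condEntropyBits {Ω S U : Type*} [MeasurableSpace Ω] [MeasurableSpace S]
    [StandardBorelSpace S] [Nonempty S] [MeasurableSpace U]
    (μ : Measure Ω) [IsFiniteMeasure μ] (Y : Ω → S) (D : Ω → U) : ℝ≥0∞ :=
  ∫⁻ d, entropyBits (condDistrib Y D μ d) ∂(μ.map D)

/-! ### The quantization scheme -/

section Scheme

variable {V Ω : Type*} {n Nout : ℕ}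

/-- The `i`th block, of length `n`, of the sample sequence `X(0), X(1), …, X(Nout * n - 1)`;
its `j`th entry is `X(n * i + j)`. -/
def block (X : Fin (Nout * n) → Ω → ℝ) (i : Fin Nout) (ω : Ω) : EuclideanSpace ℝ (Fin n) :=
  WithLp.toLp 2 fun j => X (finProdFinEquiv (i, j)) ω

/-- The dithered nested-lattice quantizer `[Q_Λ(x + d) - d] mod Λ'`. -/
def quantize (L L' : QLattice n) (x d : EuclideanSpace ℝ (Fin n)) : EuclideanSpace ℝ (Fin n) :=
  L'.modL (L.Q (x + d) - d)

/-- The random variables of the scheme with `Nout` blocks of length `n`. The samples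
`(X_v(t))_{v ∈ V}`, `t = 0, …, Nout * n - 1`, are iid with law `P`; the dithers `d_v^(i)` are
uniformly distributed over the Voronoi regions of the lattices `L v`, independent of each other
and of the source. -/
structure IsSourceWithDithers [MeasurableSpace Ω] (μ : Measure Ω) (P : Measure (V → ℝ))
    (L : V → QLattice n) (X : V → Fin (Nout * n) → Ω → ℝ)
    (d : V → Fin Nout → Ω → EuclideanSpace ℝ (Fin n)) : Prop where
  source_law : ∀ t, HasLaw (fun ω v => X v t ω) P μ
  source_indep : iIndepFun (fun t ω v => X v t ω) μ
  dither_law : ∀ v i, HasLaw (d v i) (ProbabilityTheory.cond volume (L v).voronoi) μ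
  dither_indep : iIndepFun (fun (p : V × Fin Nout) => d p.1 p.2) μ
  dither_indep_source : IndepFun (fun ω v i => d v i ω) (fun ω v t => X v t ω) μ

end Scheme

/-- The nested lattice pairs `Λ_v' ⊆ Λ_v` (one pair for every vertex and every dimension) have
asymptotic nesting rates `R v`, satisfy the volume constraint with parameter `δ₀`, and have the
required goodness properties. -/
structure IsGoodNestedFamily {V : Type*} (δ₀ : ℝ) (R : V → ℝ) (L L' : V → ∀ n, QLattice n) :
    Prop where
  nested : ∀ v n, (L' v n).Λ ≤ (L v n).Λ
  rate : ∀ v, Tendsto (fun n : ℕ => 1 / (n : ℝ) * Real.logb 2 ((L' v n).vol / (L v n).vol))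
    atTop (𝓝 (R v))
  volume_coarse : ∀ v, ∀ n : ℕ, 0 < n →
    (L' v n).vol ^ (2 / (n : ℝ)) / (2 * Real.pi * Real.exp 1)
      = (1 + (L v n).secondMoment) * (1 + δ₀)
  covering : ∀ v, GoodForCovering (L v)
  awgn : ∀ v, GoodForAWGN (L' v)

end TreeKey

end

/-! Fix the dithers. The output of a vertex u is then a discrete function of its block x_u = ρ ξ +
w, where ξ is the block of the parent and w is white Gaussian with variance a = 1 - ρ² (at the root,
ρ is replaced by 0). The parent separates u from all vertices that are at most as deep, so w is
uncorrelated with them and, by joint Gaussianity, independent of them. Removing a deepest vertex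
again and again bounds the joint entropy below by the sum of the entropies of y_u given ξ and the
dither (`sum_predEntropy_le`).

For one vertex, let s be the squared covering radius of Λ divided by n. The quantization error z =
[x + d] mod Λ has norm at most √(ns); over a random dither it is uniform on the cell and independent
of x (`measurePreserving_noise`). Without overload y = ρ ξ + w - z, so a given value of y confines w
to a ball of radius √(ns) about y - ρ ξ. A Chernoff bound gives this event probability at most
exp(-(n/2)(log(1 + a/s) - 1) - ‖y - ρ ξ‖²/(2(a + s))) (`measureReal_quantize_le`). Since E‖w - z‖² =
n(a + σ²), the mean of minus the exponent is (n/2) log(1 + a/s) up to the error n(s - σ²)/(2(a +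
s)), and goodness for covering makes σ²/s tend to 1.

It remains to control overload. Goodness for covering also bounds the law of z by exp(o(n)) times a
white Gaussian law of variance s. So overload is at most exp(o(n)) times as likely as white noise of
variance 1 + s leaving the cell of Λ' (`measureReal_overload_le`); the slack δ₀ puts this noise
below the critical variance, and the probability decays exponentially
(`GoodForAWGN.exists_eventually_le`). The rate condition keeps s away from 0, which makes all losses
o(n) (`exists_eventually_covRadius_ge`).

The quantizers need not be measurable. The dither makes ties a null event, so they may be replaced
by measurable quantizers of the same lattices (`ae_quantize_eq`). -/

noncomputable section

namespace TreeKey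

/-! ### Voronoi cells, independently of the rule for ties -/

namespace QLattice

variable {n : ℕ} (L : QLattice n)

instance : DiscreteTopology L.Λ := L.discrete

instance : IsZLattice ℝ L.Λ := L.fullRank

instance : Countable L.Λ :=
  TopologicalSpace.separableSpace_iff_countable.1 inferInstance

instance : Countable L.Λ.toAddSubgroup := inferInstanceAs (Countable L.Λ)

/-- The closed Voronoi cell of the lattice. -/
def closedCell : Set (EuclideanSpace ℝ (Fin n)) := {x | ∀ y ∈ L.Λ, ‖x‖ ≤ ‖x - y‖}

/-- The open Voronoi cell of the lattice. -/
def openCell : Set (EuclideanSpace ℝ (Fin n)) := {x | ∀ y ∈ L.Λ, y ≠ 0 → ‖x‖ < ‖x - y‖}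

lemma modL_mem_closedCell (x : EuclideanSpace ℝ (Fin n)) : L.modL x ∈ L.closedCell := by
  intro y hy
  have h := L.Q_closest x (L.Q x + y) (L.Λ.add_mem (L.Q_mem x) hy)
  rw [dist_eq_norm, dist_eq_norm] at h
  simpa [modL, sub_sub] using h

lemma voronoi_subset_closedCell : L.voronoi ⊆ L.closedCell := by
  intro x hx
  have h := L.modL_mem_closedCell x
  rwa [modL, show L.Q x = 0 from hx, sub_zero] at h

/-- Strict inequalities leave no tie, so every quantizer of the lattice agrees here. This is how the
tie rule is eliminated throughout. -/
lemma Q_eq_of_sub_mem_openCell {x y : EuclideanSpace ℝ (Fin n)} (hy : y ∈ L.Λ)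
    (h : x - y ∈ L.openCell) : L.Q x = y := by
  by_contra hne
  have h1 := h (L.Q x - y) (L.Λ.sub_mem (L.Q_mem x) hy) (sub_ne_zero.2 hne)
  have h2 := L.Q_closest x y hy
  rw [dist_eq_norm, dist_eq_norm] at h2
  rw [sub_sub_sub_cancel_right] at h1
  linarith

lemma openCell_subset_voronoi : L.openCell ⊆ L.voronoi := by
  intro x hx
  exact L.Q_eq_of_sub_mem_openCell L.Λ.zero_mem (by simpa using hx)

lemma norm_le_norm_sub_iff (x y : EuclideanSpace ℝ (Fin n)) :
    ‖x‖ ≤ ‖x - y‖ ↔ 2 * inner ℝ x y ≤ ‖y‖ ^ 2 := by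
  rw [← sq_le_sq₀ (norm_nonneg _) (norm_nonneg _), norm_sub_sq_real]
  constructor <;> intro h <;> linarith

lemma norm_lt_norm_sub_iff (x y : EuclideanSpace ℝ (Fin n)) :
    ‖x‖ < ‖x - y‖ ↔ 2 * inner ℝ x y < ‖y‖ ^ 2 := by
  rw [← sq_lt_sq₀ (norm_nonneg _) (norm_nonneg _), norm_sub_sq_real]
  constructor <;> intro h <;> linarith

/-- The cell is cut out by 2⟨x, y⟩ ≤ ‖y‖², and a factor t < 1 on the left makes each of these
strict. -/
lemma smul_mem_openCell {x : EuclideanSpace ℝ (Fin n)} (hx : x ∈ L.closedCell) {t : ℝ}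
    (h0 : 0 ≤ t) (h1 : t < 1) : t • x ∈ L.openCell := by
  intro y hy hne
  have h := hx y hy
  rw [norm_le_norm_sub_iff] at h
  rw [norm_lt_norm_sub_iff, real_inner_smul_left]
  have hp : 0 < ‖y‖ ^ 2 := by positivity
  nlinarith

lemma isClosed_closedCell : IsClosed L.closedCell := by
  have : L.closedCell = ⋂ y ∈ L.Λ, {x | ‖x‖ ≤ ‖x - y‖} := by ext; simp [closedCell]
  rw [this]
  exact isClosed_biInter fun y _ => isClosed_le (by fun_prop) (by fun_prop)

lemma measurableSet_openCell : MeasurableSet L.openCell := by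
  have : L.openCell = ⋂ y : L.Λ,
      {x : EuclideanSpace ℝ (Fin n) | (y : EuclideanSpace ℝ (Fin n)) ≠ 0 → ‖x‖ < ‖x - y‖} := by
    ext; simp [openCell]
  rw [this]
  refine MeasurableSet.iInter fun y => ?_
  by_cases h : (y : EuclideanSpace ℝ (Fin n)) = 0
  · simp [h]
  · simpa [h] using measurableSet_lt (by fun_prop) (by fun_prop)

lemma volume_hyperplane {y : EuclideanSpace ℝ (Fin n)} (hy : y ≠ 0) (c : ℝ) :
    volume {x : EuclideanSpace ℝ (Fin n) | 2 * inner ℝ x y = c} = 0 := by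
  let A : AffineSubspace ℝ (EuclideanSpace ℝ (Fin n)) :=
    { carrier := {x | 2 * inner ℝ x y = c}
      smul_vsub_vadd_mem' := by
        intro t p q r hp hq hr
        simp only [Set.mem_ofPred_eq, vsub_eq_sub, vadd_eq_add, inner_add_left,
          real_inner_smul_left, inner_sub_left] at *
        linear_combination t * hp - t * hq + hr }
  -- If the hyperplane were the whole space, 0 would give c = 0 and y would give 2‖y‖² = c.
  refine Measure.addHaar_affineSubspace volume A fun h => ?_
  have h0 : (0 : EuclideanSpace ℝ (Fin n)) ∈ A := h ▸ AffineSubspace.mem_top _ _ _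
  have h1 : y ∈ A := h ▸ AffineSubspace.mem_top _ _ _
  change 2 * inner ℝ (0 : EuclideanSpace ℝ (Fin n)) y = c at h0
  change 2 * inner ℝ y y = c at h1
  rw [inner_zero_left] at h0
  rw [real_inner_self_eq_norm_sq] at h1
  have : 0 < ‖y‖ ^ 2 := by positivity
  linarith

/-- The difference lies on the bisecting hyperplanes of 0 and the nonzero lattice points, which are
countably many. -/
lemma volume_closedCell_diff_openCell : volume (L.closedCell \ L.openCell) = 0 := by
  refine measure_mono_null (t := ⋃ y : {y : L.Λ // (y : EuclideanSpace ℝ (Fin n)) ≠ 0},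
    {x | 2 * inner ℝ x (y.1 : EuclideanSpace ℝ (Fin n)) =
      ‖(y.1 : EuclideanSpace ℝ (Fin n))‖ ^ 2}) ?_
    (measure_iUnion_null fun y => volume_hyperplane y.2 _)
  rintro x ⟨hx, hx'⟩
  simp only [openCell, Set.mem_ofPred_eq, not_forall] at hx'
  obtain ⟨y, hy, hne, h⟩ := hx'
  rw [norm_lt_norm_sub_iff, not_lt] at h
  have h2 := hx y hy
  rw [norm_le_norm_sub_iff] at h2
  exact Set.mem_iUnion.2 ⟨⟨⟨y, hy⟩, hne⟩, le_antisymm h2 h⟩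

/-- The Voronoi region depends on the tie rule and may fail to be measurable; it is squeezed between
two measurable cells that differ by a null set. -/
lemma voronoi_ae_eq_openCell : L.voronoi =ᵐ[volume] L.openCell := by
  refine (ae_le_set.2 (measure_mono_null ?_ L.volume_closedCell_diff_openCell)).antisymm
    L.openCell_subset_voronoi.eventuallyLE
  exact Set.sdiff_subset_sdiff_left L.voronoi_subset_closedCell

/-- Almost every point is strictly closer to one lattice point than to all others. -/
lemma ae_modL_mem_openCell : ∀ᵐ x, L.modL x ∈ L.openCell := by
  refine measure_mono_null (t := ⋃ y : L.Λ,
    (fun x => x - (y : EuclideanSpace ℝ (Fin n))) ⁻¹' (L.closedCell \ L.openCell)) ?_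
    (measure_iUnion_null fun y => ?_)
  · intro x hx
    exact Set.mem_iUnion.2 ⟨⟨L.Q x, L.Q_mem x⟩, L.modL_mem_closedCell x, hx⟩
  · rw [(measurePreserving_sub_right volume (y : EuclideanSpace ℝ (Fin n))).measure_preimage]
    · exact L.volume_closedCell_diff_openCell
    · exact (L.isClosed_closedCell.measurableSet.diff L.measurableSet_openCell).nullMeasurableSet

lemma exists_closedCell_subset_closedBall : ∃ R, 0 ≤ R ∧ L.closedCell ⊆ Metric.closedBall 0 R := by
  let b := Module.Free.chooseBasis ℤ L.Λ
  let b' := b.ofZLatticeBasis ℝ L.Λ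
  refine ⟨∑ i, ‖b' i‖, Finset.sum_nonneg fun _ _ => norm_nonneg _, fun x hx => ?_⟩
  rw [mem_closedBall_zero_iff]
  -- Compare x with the lattice point obtained by rounding down its coordinates: the remainder lies
  -- in a fundamental parallelepiped.
  have hmem : ((ZSpan.floor b' x : Submodule.span ℤ (Set.range b')) :
      EuclideanSpace ℝ (Fin n)) ∈ L.Λ := by
    exact (b.ofZLatticeBasis_span ℝ L.Λ).le (ZSpan.floor b' x).2
  exact (hx _ hmem).trans (ZSpan.norm_fract_le b' x)

lemma covRadius_nonneg : 0 ≤ L.covRadius := Real.sInf_nonneg fun _ h => h.1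

lemma voronoi_subset_closedBall : L.voronoi ⊆ Metric.closedBall 0 L.covRadius := by
  intro x hx
  rw [mem_closedBall_zero_iff]
  obtain ⟨R, hR, h⟩ := L.exists_closedCell_subset_closedBall
  refine le_csInf ⟨R, hR, L.voronoi_subset_closedCell.trans h⟩ fun R hR => ?_
  simpa using hR.2 hx

/-- The covering radius only sees the Voronoi region, which may miss boundary points. Shrinking a
boundary point slightly moves it into the open cell, and the factor can be taken arbitrarily close
to 1. -/
lemma closedCell_subset_closedBall : L.closedCell ⊆ Metric.closedBall 0 L.covRadius := by
  intro x hx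
  rw [mem_closedBall_zero_iff]
  refine le_of_forall_lt_imp_le_of_dense fun r hr => ?_
  rcases lt_or_ge r 0 with h0 | h0
  · exact h0.le.trans L.covRadius_nonneg
  have hx0 : 0 < ‖x‖ := h0.trans_lt hr
  have h := L.voronoi_subset_closedBall (L.openCell_subset_voronoi
    (L.smul_mem_openCell hx (t := r / ‖x‖) (by positivity) ((div_lt_one hx0).2 hr)))
  rw [mem_closedBall_zero_iff, norm_smul, Real.norm_of_nonneg (by positivity),
    div_mul_cancel₀ _ hx0.ne'] at h
  exact h

lemma eq_zero_of_sub_mem_openCell {x y : EuclideanSpace ℝ (Fin n)} (hx : x ∈ L.openCell)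
    (hy : y ∈ L.Λ) (h : x - y ∈ L.openCell) : y = 0 :=
  (L.Q_eq_of_sub_mem_openCell hy h).symm.trans
    (L.Q_eq_of_sub_mem_openCell L.Λ.zero_mem (by simpa using hx))

lemma isAddFundamentalDomain_openCell :
    IsAddFundamentalDomain L.Λ.toAddSubgroup L.openCell volume where
  nullMeasurableSet := L.measurableSet_openCell.nullMeasurableSet
  ae_covers := by
    filter_upwards [L.ae_modL_mem_openCell] with x hx
    refine ⟨-⟨L.Q x, L.Q_mem x⟩, ?_⟩
    change -(L.Q x) + x ∈ L.openCell
    rwa [neg_add_eq_sub]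
  aedisjoint := by
    intro a b hab
    refine Disjoint.aedisjoint (Set.disjoint_left.2 fun x hxa hxb => hab ?_)
    rw [Set.mem_vadd_set_iff_neg_vadd_mem] at hxa hxb
    change -(a : EuclideanSpace ℝ (Fin n)) + x ∈ L.openCell at hxa
    change -(b : EuclideanSpace ℝ (Fin n)) + x ∈ L.openCell at hxb
    have h := L.eq_zero_of_sub_mem_openCell hxa
      (L.Λ.sub_mem b.2 a.2) (by convert hxb using 1; abel)
    exact Subtype.ext (sub_eq_zero.1 h).symm

lemma volume_voronoi_ne_zero : volume L.voronoi ≠ 0 := by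
  rw [measure_congr L.voronoi_ae_eq_openCell]
  exact L.isAddFundamentalDomain_openCell.measure_ne_zero (NeZero.ne _)

lemma volume_voronoi_ne_top : volume L.voronoi ≠ ∞ :=
  ((measure_mono L.voronoi_subset_closedBall).trans_lt measure_closedBall_lt_top).ne

lemma vol_pos : 0 < L.vol :=
  ENNReal.toReal_pos L.volume_voronoi_ne_zero L.volume_voronoi_ne_top

/-! ### The uniform dither and measurable quantizers -/

/-- The uniform distribution over the Voronoi region. -/
def unif : Measure (EuclideanSpace ℝ (Fin n)) := ProbabilityTheory.cond volume L.voronoi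

instance : IsProbabilityMeasure L.unif :=
  cond_isProbabilityMeasure_of_finite L.volume_voronoi_ne_zero L.volume_voronoi_ne_top

lemma unif_eq : L.unif = (ENNReal.ofReal L.vol)⁻¹ • volume.restrict L.openCell := by
  rw [unif, ProbabilityTheory.cond, Measure.restrict_congr_set L.voronoi_ae_eq_openCell, vol,
    Measure.real, ENNReal.ofReal_toReal L.volume_voronoi_ne_top]

lemma unif_absolutelyContinuous : L.unif ≪ volume := cond_absolutelyContinuous

lemma ae_unif_mem_openCell : ∀ᵐ z ∂L.unif, z ∈ L.openCell := by
  rw [unif_eq]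
  exact Measure.ae_smul_measure (ae_restrict_mem L.measurableSet_openCell) _

/-- If `d` is uniform over the Voronoi region, then so is `[x + d] mod Λ` for every `x`. -/
lemma map_modL_add_unif (hQ : Measurable L.Q) (x : EuclideanSpace ℝ (Fin n)) :
    L.unif.map (fun d => L.modL (x + d)) = L.unif := by
  have hm : Measurable fun d => L.modL (x + d) := by unfold modL; fun_prop
  ext A hA
  rw [Measure.map_apply hm hA, unif_eq, Measure.smul_apply, Measure.smul_apply,
    Measure.restrict_apply (hm hA), Measure.restrict_apply hA]
  congr 1
  -- The periodic extension of A. Both the open cell and its translate by x are fundamental domains,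
  -- hence carry the same measure of this invariant set.
  set A' : Set (EuclideanSpace ℝ (Fin n)) :=
    ⋃ y : L.Λ, (fun z => z - (y : EuclideanSpace ℝ (Fin n))) ⁻¹' (L.openCell ∩ A) with hA'
  have hA'm : MeasurableSet A' := MeasurableSet.iUnion fun y =>
    (measurable_id.sub_const _) (L.measurableSet_openCell.inter hA)
  have hinv : ∀ g : L.Λ.toAddSubgroup, (fun z => g +ᵥ z) ⁻¹' A' = A' := by
    intro g
    ext z
    simp only [hA', Set.mem_preimage, Set.mem_iUnion]
    constructor
    · rintro ⟨y, hy⟩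
      refine ⟨⟨y - g, L.Λ.sub_mem y.2 g.2⟩, ?_⟩
      convert hy using 1
      change z - (y - g) = (g : EuclideanSpace ℝ (Fin n)) + z - y
      abel
    · rintro ⟨y, hy⟩
      refine ⟨⟨g + y, L.Λ.add_mem g.2 y.2⟩, ?_⟩
      convert hy using 1
      change (g : EuclideanSpace ℝ (Fin n)) + z - (g + y) = z - y
      abel
  have h1 := L.isAddFundamentalDomain_openCell.measure_set_eq
    (L.isAddFundamentalDomain_openCell.vadd_of_comm x) hA'm hinv
  have h2 : A' ∩ L.openCell = A ∩ L.openCell := by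
    ext z
    simp only [hA', Set.mem_inter_iff, Set.mem_iUnion, Set.mem_preimage]
    constructor
    · rintro ⟨⟨y, hy, hyA⟩, hz⟩
      rw [L.eq_zero_of_sub_mem_openCell hz y.2 hy, sub_zero] at hyA
      exact ⟨hyA, hz⟩
    · rintro ⟨hzA, hz⟩
      exact ⟨⟨0, by simpa using hz, by simpa using hzA⟩, hz⟩
  rw [← h2, h1, ← measure_preimage_add volume x (A' ∩ _)]
  refine measure_congr ?_
  have hae : ∀ᵐ d, L.modL (x + d) ∈ L.openCell :=
    (measurePreserving_add_left volume x).quasiMeasurePreserving.ae L.ae_modL_mem_openCell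
  filter_upwards [hae] with d hd
  refine propext ⟨?_, ?_⟩
  · rintro ⟨hdA, hdc⟩
    exact ⟨Set.mem_iUnion.2 ⟨⟨_, L.Q_mem (x + d)⟩, hd, hdA⟩, ⟨d, hdc, rfl⟩⟩
  · rintro ⟨hdA, ⟨d', hd', hdd⟩⟩
    obtain ⟨y, hy, hyA⟩ := Set.mem_iUnion.1 hdA
    have hdd' : d' = d := add_left_cancel (a := x) hdd
    refine ⟨?_, hdd' ▸ hd'⟩
    change x + d - L.Q (x + d) ∈ A
    rw [L.Q_eq_of_sub_mem_openCell y.2 hy]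
    exact hyA

/-- Every lattice has a quantizer with a measurable rule for ties. -/
lemma exists_measurable_Q : ∃ M : QLattice n, M.Λ = L.Λ ∧ Measurable M.Q := by
  classical
  obtain ⟨e, he⟩ := exists_surjective_nat L.Λ
  have hex : ∀ x : EuclideanSpace ℝ (Fin n),
      ∃ k, ∀ y ∈ L.Λ, dist x (e k : EuclideanSpace ℝ (Fin n)) ≤ dist x y := by
    intro x
    obtain ⟨k, hk⟩ := he ⟨L.Q x, L.Q_mem x⟩
    exact ⟨k, by rw [hk]; exact L.Q_closest x⟩
  -- Among the closest lattice points, take the first in a fixed enumeration; the sets on which a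
  -- given point is closest are closed.
  refine ⟨⟨L.Λ, L.discrete, L.fullRank, fun x => e (Nat.find (hex x)), fun x => (e _).2,
    fun x => Nat.find_spec (hex x)⟩, rfl, ?_⟩
  refine (measurable_from_nat (f := fun k => (e k : EuclideanSpace ℝ (Fin n)))).comp
    (measurable_find hex fun k => ?_)
  have : {x : EuclideanSpace ℝ (Fin n) |
      ∀ y ∈ L.Λ, dist x (e k : EuclideanSpace ℝ (Fin n)) ≤ dist x y} =
      ⋂ y ∈ L.Λ, {x : EuclideanSpace ℝ (Fin n) |
        dist x (e k : EuclideanSpace ℝ (Fin n)) ≤ dist x y} := by ext; simp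
  rw [this]
  exact (isClosed_biInter fun y _ => isClosed_le (by fun_prop) (by fun_prop)).measurableSet

end QLattice

/-! ### Shannon entropy -/

/-- The Shannon entropy, in nats, of a discrete probability measure. -/
def natEntropy {S : Type*} [MeasurableSpace S] (ν : Measure S) : ℝ≥0∞ :=
  ∑' s, ENNReal.ofReal (Real.negMulLog (ν.real {s}))

lemma entropyBits_eq {S : Type*} [MeasurableSpace S] (ν : Measure S) :
    entropyBits ν = natEntropy ν * ENNReal.ofReal (Real.log 2)⁻¹ := by
  rw [entropyBits, natEntropy, ← ENNReal.tsum_mul_right]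
  refine tsum_congr fun s => ?_
  rw [← ENNReal.ofReal_mul' (by positivity), Real.negMulLog, Real.logb]
  congr 1
  ring

lemma natEntropy_map_injective {S S' : Type*} [MeasurableSpace S] [MeasurableSpace S']
    [MeasurableSingletonClass S'] (ν : Measure S) {e : S → S'} (he : Measurable e)
    (hi : Function.Injective e) : natEntropy (ν.map e) = natEntropy ν := by
  rw [natEntropy, natEntropy, ← hi.tsum_eq]
  · refine tsum_congr fun s => ?_
    rw [map_measureReal_apply he (measurableSet_singleton _)]
    congr 3
    ext t
    simp [hi.eq_iff]
  · intro s hs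
    by_contra h
    refine hs ?_
    have : e ⁻¹' {s} = ∅ := by
      ext t
      simp only [Set.mem_preimage, Set.mem_singleton_iff, Set.mem_empty_iff_false, iff_false]
      exact fun ht => h ⟨t, ht⟩
    change ENNReal.ofReal (Real.negMulLog ((ν.map e).real {s})) = 0
    rw [map_measureReal_apply he (measurableSet_singleton _), this]
    simp

lemma natEntropy_eq_tsum_of_countable {S W : Type*} [MeasurableSpace S]
    [MeasurableSingletonClass S] [MeasurableSpace W] (ν : Measure W) {f : W → S}
    (hf : Measurable f) {T : Set S} (hT : ∀ w, f w ∈ T) :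
    natEntropy (ν.map f) =
      ∑' s : T, ENNReal.ofReal (Real.negMulLog (ν.real (f ⁻¹' {(s : S)}))) := by
  rw [natEntropy]
  simp_rw [map_measureReal_apply hf (measurableSet_singleton _)]
  refine (tsum_subtype_eq_of_support_subset
    (f := fun s => ENNReal.ofReal (Real.negMulLog (ν.real (f ⁻¹' {s})))) fun s hs => ?_).symm
  by_contra h
  refine hs ?_
  have : f ⁻¹' {s} = ∅ := by
    ext t
    simp only [Set.mem_preimage, Set.mem_singleton_iff, Set.mem_empty_iff_false, iff_false]
    exact fun ht => h (ht ▸ hT t)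
  simp [this]

/-- Jensen's inequality for `-p log p` on a part of a product space. -/
lemma negMulLog_setIntegral_ge {G : Type*} [MeasurableSpace G] (μ : Measure G)
    [IsProbabilityMeasure μ] {s : Set G} (h0 : μ s ≠ 0) {κ : G → ℝ}
    (hκ : Measurable κ) (hκ0 : ∀ x, 0 ≤ κ x) (hκ1 : ∀ x, κ x ≤ 1) :
    Real.negMulLog (μ.real s) * ((∫ x in s, κ x ∂μ) / μ.real s) +
      ∫ x in s, Real.negMulLog (κ x) ∂μ ≤ Real.negMulLog (∫ x in s, κ x ∂μ) := by
  have hp : 0 < μ.real s := ENNReal.toReal_pos h0 (measure_ne_top _ _)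
  have hi : Integrable κ (μ.restrict s) :=
    Integrable.of_bound hκ.aestronglyMeasurable 1 (ae_of_all _ fun x => by
      rw [Real.norm_of_nonneg (hκ0 x)]; exact hκ1 x)
  have hi2 : Integrable (Real.negMulLog ∘ κ) (μ.restrict s) := by
    refine Integrable.of_bound
      (Real.continuous_negMulLog.measurable.comp hκ).aestronglyMeasurable 1 (ae_of_all _ fun x => ?_)
    rw [Function.comp, Real.norm_of_nonneg (Real.negMulLog_nonneg (hκ0 x) (hκ1 x))]
    have := Real.negMulLog_le_one_sub_self (hκ0 x)
    linarith [hκ0 x]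
  have hJ := Real.concaveOn_negMulLog.le_map_set_average Real.continuous_negMulLog.continuousOn
    isClosed_Ici h0 (measure_ne_top _ _) (ae_of_all _ hκ0) hi hi2
  rw [setAverage_eq, setAverage_eq, smul_eq_mul, smul_eq_mul] at hJ
  have hm : ∫ x in s, κ x ∂μ = μ.real s * ((μ.real s)⁻¹ * ∫ x in s, κ x ∂μ) := by
    field_simp
  -- With p = μ(s) and mean value m of κ on s, -pm log(pm) = m(-p log p) + p(-m log m); Jensen
  -- bounds the last term below.
  conv_rhs => rw [hm, Real.negMulLog_mul]
  have h2 := mul_le_mul_of_nonneg_left hJ hp.le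
  rw [← mul_assoc, mul_inv_cancel₀ hp.ne', one_mul] at h2
  have h3 : (∫ x in s, κ x ∂μ) / μ.real s = (μ.real s)⁻¹ * ∫ x in s, κ x ∂μ := by
    rw [div_eq_inv_mul]
  rw [h3]
  linarith

/-- If `x` and `w` are independent, then `H(f(x), g(x, w)) ≥ H(f(x)) + H(g(x, w) | x)`. -/
lemma natEntropy_add_lintegral_le {G W A B : Type*} [MeasurableSpace G] [MeasurableSpace W]
    [MeasurableSpace A] [MeasurableSpace B] [MeasurableSingletonClass A]
    [MeasurableSingletonClass B] (μ : Measure G) (ν : Measure W) [IsProbabilityMeasure μ]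
    [IsProbabilityMeasure ν] {f : G → A} (hf : Measurable f) {g : G × W → B} (hg : Measurable g)
    {TA : Set A} (hTA : TA.Countable) (hfT : ∀ x, f x ∈ TA)
    {TB : Set B} (hTB : TB.Countable) (hgT : ∀ x, g x ∈ TB) :
    natEntropy (μ.map f) + ∫⁻ x, natEntropy (ν.map (fun w => g (x, w))) ∂μ ≤
      natEntropy ((μ.prod ν).map (fun p => (f p.1, g p))) := by
  have : Countable TA := hTA.to_subtype
  have : Countable TB := hTB.to_subtype
  have hfg : Measurable fun p : G × W => (f p.1, g p) := (hf.comp measurable_fst).prodMk hg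
  -- The conditional probability that g = b given x. Its integral over {f = a} is the joint
  -- probability of (a, b).
  set κ : B → G → ℝ := fun b x => ν.real {w | g (x, w) = b} with hκ
  have hgb : ∀ b, MeasurableSet {p | g p = b} := fun b => hg (measurableSet_singleton b)
  have hκm : ∀ b, Measurable (κ b) := fun b =>
    (measurable_measure_prodMk_left (hgb b)).ennreal_toReal
  have hκ0 : ∀ b x, 0 ≤ κ b x := fun b x => measureReal_nonneg
  have hκ1 : ∀ b x, κ b x ≤ 1 := fun b x => measureReal_le_one
  have hfa : ∀ a, MeasurableSet (f ⁻¹' {a}) := fun a => hf (measurableSet_singleton a)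
  have hjoint : ∀ a b, (μ.prod ν) ((fun p : G × W => (f p.1, g p)) ⁻¹' {(a, b)}) =
      ENNReal.ofReal (∫ x in f ⁻¹' {a}, κ b x ∂μ) := by
    intro a b
    rw [Measure.prod_apply (hfg (measurableSet_singleton _)),
      ofReal_integral_eq_lintegral_ofReal, ← lintegral_indicator (hfa a)]
    · refine lintegral_congr fun x => ?_
      by_cases hx : f x = a
      · rw [Set.indicator_of_mem (by exact hx)]
        simp only [hκ, Measure.real]
        rw [ENNReal.ofReal_toReal (measure_ne_top _ _)]
        congr 1
        ext w
        simp [hx]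
      · rw [Set.indicator_of_notMem (by exact hx)]
        convert measure_empty (μ := ν)
        ext w
        simp [hx]
    · refine Integrable.of_bound (hκm b).aestronglyMeasurable 1 (ae_of_all _ fun x => ?_)
      rw [Real.norm_of_nonneg (hκ0 b x)]; exact hκ1 b x
    · exact ae_of_all _ (hκ0 b)
  have hjoint' : ∀ a b, (μ.prod ν).real ((fun p : G × W => (f p.1, g p)) ⁻¹' {(a, b)}) =
      ∫ x in f ⁻¹' {a}, κ b x ∂μ := by
    intro a b
    rw [Measure.real, hjoint, ENNReal.toReal_ofReal (integral_nonneg (hκ0 b))]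
  have hsum : ∀ a, ∑' b : TB, ENNReal.ofReal (∫ x in f ⁻¹' {a}, κ b x ∂μ) = μ (f ⁻¹' {a}) := by
    intro a
    simp_rw [← hjoint]
    rw [← measure_iUnion]
    · have : (⋃ b : TB, (fun p : G × W => (f p.1, g p)) ⁻¹' {(a, (b : B))}) =
          (f ⁻¹' {a}) ×ˢ Set.univ := by
        ext p
        simp only [Set.mem_iUnion, Set.mem_preimage, Set.mem_singleton_iff, Prod.mk.injEq,
          Set.mem_prod, Set.mem_univ, and_true]
        exact ⟨fun ⟨_, h⟩ => h.1, fun h => ⟨⟨g p, hgT p⟩, h, rfl⟩⟩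
      rw [this, Measure.prod_prod, measure_univ, mul_one]
    · intro b b' hbb
      refine Set.disjoint_left.2 fun p hp hp' => hbb (Subtype.ext ?_)
      simp only [Set.mem_preimage, Set.mem_singleton_iff, Prod.mk.injEq] at hp hp'
      exact hp.2.symm.trans hp'.2
    · exact fun b => hfg (measurableSet_singleton _)
  have hφm : ∀ b, Measurable fun x => ENNReal.ofReal (Real.negMulLog (κ b x)) := fun b =>
    (Real.continuous_negMulLog.measurable.comp (hκm b)).ennreal_ofReal
  have hcond : ∫⁻ x, natEntropy (ν.map (fun w => g (x, w))) ∂μ =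
      ∑' a : TA, ∑' b : TB, ∫⁻ x in f ⁻¹' {(a : A)}, ENNReal.ofReal (Real.negMulLog (κ b x)) ∂μ := by
    have huniv : (⋃ a : TA, f ⁻¹' {(a : A)}) = Set.univ := by
      ext x
      simp only [Set.mem_iUnion, Set.mem_preimage, Set.mem_singleton_iff, Set.mem_univ, iff_true]
      exact ⟨⟨f x, hfT x⟩, rfl⟩
    rw [← setLIntegral_univ, ← huniv, lintegral_iUnion (fun a : TA => hfa a)]
    · refine tsum_congr fun a => ?_
      rw [← lintegral_tsum fun b : TB => (hφm b).aemeasurable]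
      refine lintegral_congr fun x => ?_
      rw [natEntropy_eq_tsum_of_countable ν (f := fun w => g (x, w)) (hg.comp measurable_prodMk_left)
        (fun w => hgT (x, w))]
      rfl
    · intro a a' haa
      refine Set.disjoint_left.2 fun x hx hx' => haa (Subtype.ext ?_)
      exact (Set.mem_singleton_iff.1 hx).symm.trans hx'
  rw [hcond, natEntropy_eq_tsum_of_countable μ hf hfT, ← ENNReal.tsum_add, natEntropy,
    ENNReal.tsum_prod']
  simp_rw [map_measureReal_apply hfg (measurableSet_singleton _)]
  refine le_trans (ENNReal.tsum_le_tsum fun a => ?_)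
    (ENNReal.tsum_comp_le_tsum_of_injective (f := ((↑) : TA → A)) Subtype.val_injective _)
  refine le_trans ?_
    (ENNReal.tsum_comp_le_tsum_of_injective (f := ((↑) : TB → B)) Subtype.val_injective _)
  simp_rw [hjoint']
  by_cases h0 : μ (f ⁻¹' {(a : A)}) = 0
  · simp [Measure.real, Measure.restrict_eq_zero.2 h0, h0]
  have hp : 0 < μ.real (f ⁻¹' {(a : A)}) := ENNReal.toReal_pos h0 (measure_ne_top _ _)
  have hφp : 0 ≤ Real.negMulLog (μ.real (f ⁻¹' {(a : A)})) :=
    Real.negMulLog_nonneg hp.le measureReal_le_one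
  -- Distribute the term of a over the values b, with the conditional probabilities of b given f = a
  -- as weights; the claim then holds term by term in (a, b).
  have hone : ENNReal.ofReal (Real.negMulLog (μ.real (f ⁻¹' {(a : A)}))) =
      ∑' b : TB, ENNReal.ofReal (Real.negMulLog (μ.real (f ⁻¹' {(a : A)})) *
        ((∫ x in f ⁻¹' {(a : A)}, κ b x ∂μ) / μ.real (f ⁻¹' {(a : A)}))) := by
    simp_rw [ENNReal.ofReal_mul hφp, ENNReal.ofReal_div_of_pos hp, div_eq_mul_inv]
    rw [ENNReal.tsum_mul_left, ENNReal.tsum_mul_right, hsum, Measure.real,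
      ENNReal.ofReal_toReal (measure_ne_top _ _), ENNReal.mul_inv_cancel h0 (measure_ne_top _ _),
      mul_one]
  rw [hone, ← ENNReal.tsum_add]
  refine ENNReal.tsum_le_tsum fun b => ?_
  have hint : ∫⁻ x in f ⁻¹' {(a : A)}, ENNReal.ofReal (Real.negMulLog (κ b x)) ∂μ =
      ENNReal.ofReal (∫ x in f ⁻¹' {(a : A)}, Real.negMulLog (κ b x) ∂μ) := by
    rw [ofReal_integral_eq_lintegral_ofReal]
    · refine Integrable.of_bound
        (Real.continuous_negMulLog.measurable.comp (hκm b)).aestronglyMeasurable 1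
        (ae_of_all _ fun x => ?_)
      rw [Real.norm_of_nonneg (Real.negMulLog_nonneg (hκ0 b x) (hκ1 b x))]
      linarith [Real.negMulLog_le_one_sub_self (hκ0 b x), hκ0 b x]
    · exact ae_of_all _ fun x => Real.negMulLog_nonneg (hκ0 b x) (hκ1 b x)
  rw [hint, ← ENNReal.ofReal_add]
  · exact ENNReal.ofReal_le_ofReal
      (negMulLog_setIntegral_ge μ h0 (hκm b) (hκ0 b) (hκ1 b))
  · exact mul_nonneg hφp (div_nonneg (integral_nonneg (hκ0 b)) hp.le)
  · exact integral_nonneg fun x => Real.negMulLog_nonneg (hκ0 b x) (hκ1 b x)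

/-- Since log((a + b)/a) ≤ b/a, replacing log a by log(a + b) costs at most b; the remaining term -b
log(a + b) is nonnegative. Here b will be the probability of one output value together with
overload. -/
lemma negMulLog_sub_le_negMulLog_add {a b : ℝ} (ha : 0 ≤ a) (hb : 0 ≤ b) (hab : a + b ≤ 1) :
    Real.negMulLog a - b ≤ Real.negMulLog (a + b) := by
  rcases ha.eq_or_lt with rfl | ha
  · have := Real.negMulLog_nonneg (x := 0 + b) (by linarith) hab
    rw [Real.negMulLog_zero]
    linarith
  have h1 : Real.log ((a + b) / a) ≤ (a + b) / a - 1 := Real.log_le_sub_one_of_pos (by positivity)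
  rw [Real.log_div (by positivity) ha.ne'] at h1
  have h2 : a * (Real.log (a + b) - Real.log a) ≤ b := by
    calc _ ≤ a * ((a + b) / a - 1) := mul_le_mul_of_nonneg_left h1 ha.le
      _ = b := by field_simp; ring
  have h3 : Real.log (a + b) ≤ 0 := Real.log_nonpos (by linarith) hab
  unfold Real.negMulLog
  nlinarith

/-- Allows integrands of both signs, which is needed because the information density may be
negative. -/
lemma ofReal_integral_le_lintegral_ofReal {G : Type*} [MeasurableSpace G] {μ : Measure G}
    {f : G → ℝ} (hf : Integrable f μ) :
    ENNReal.ofReal (∫ x, f x ∂μ) ≤ ∫⁻ x, ENNReal.ofReal (f x) ∂μ := by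
  calc ENNReal.ofReal (∫ x, f x ∂μ) ≤ ENNReal.ofReal (∫ x, max (f x) 0 ∂μ) :=
        ENNReal.ofReal_le_ofReal (integral_mono hf hf.pos_part fun x => le_max_left _ _)
    _ = ∫⁻ x, ENNReal.ofReal (max (f x) 0) ∂μ :=
        ofReal_integral_eq_lintegral_ofReal hf.pos_part (ae_of_all _ fun x => le_max_right _ _)
    _ = _ := by simp

/-- A lower bound for the entropy of `Y` when `Y` agrees on the event `S` with `Z`, and the
probability that `Z = z` is at most `exp (-h z)`. -/
lemma ofReal_integral_le_natEntropy {W B : Type*} [MeasurableSpace W] [MeasurableSpace B]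
    [MeasurableSingletonClass B] (ν : Measure W) [IsProbabilityMeasure ν] {Y : W → B}
    (hY : Measurable Y) {T : Set B} (hT : T.Countable) (hYT : ∀ w, Y w ∈ T) {S : Set W}
    (hS : MeasurableSet S) {h : B → ℝ}
    (hp : ∀ y, ν.real (S ∩ Y ⁻¹' {y}) ≤ Real.exp (-h y))
    (hi : Integrable (fun w => S.indicator (fun w => h (Y w)) w - Sᶜ.indicator 1 w) ν) :
    ENNReal.ofReal (∫ w, (S.indicator (fun w => h (Y w)) w - Sᶜ.indicator 1 w) ∂ν) ≤
      natEntropy (ν.map Y) := by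
  have : Countable T := hT.to_subtype
  rw [natEntropy_eq_tsum_of_countable ν hY hYT]
  have hYm : ∀ y, MeasurableSet (Y ⁻¹' {y}) := fun y => hY (measurableSet_singleton y)
  have huniv : (⋃ y : T, Y ⁻¹' {(y : B)}) = Set.univ := by
    ext x
    simp only [Set.mem_iUnion, Set.mem_preimage, Set.mem_singleton_iff, Set.mem_univ, iff_true]
    exact ⟨⟨Y x, hYT x⟩, rfl⟩
  have hhs := hasSum_integral_iUnion (fun y : T => hYm y) (μ := ν)
    (fun y y' hyy => Set.disjoint_left.2 fun x hx hx' => hyy (Subtype.ext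
      ((Set.mem_singleton_iff.1 hx).symm.trans hx'))) (hi.integrableOn)
  rw [huniv, setIntegral_univ] at hhs
  rw [← hhs.tsum_eq]
  -- Compare on each fibre of Y: the part in S is bounded through h, the part outside S costs at
  -- most its own probability.
  have hle : ∀ y : T, ∫ w in Y ⁻¹' {(y : B)},
      (S.indicator (fun w => h (Y w)) w - Sᶜ.indicator 1 w) ∂ν ≤
        Real.negMulLog (ν.real (Y ⁻¹' {(y : B)})) := by
    intro y
    have h1 : ∫ w in Y ⁻¹' {(y : B)}, (S.indicator (fun w => h (Y w)) w - Sᶜ.indicator 1 w) ∂ν =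
        ν.real (S ∩ Y ⁻¹' {(y : B)}) * h y - ν.real (Sᶜ ∩ Y ⁻¹' {(y : B)}) := by
      have h2 : ∀ w ∈ Y ⁻¹' {(y : B)},
          S.indicator (fun w => h (Y w)) w - Sᶜ.indicator 1 w =
            S.indicator (fun _ => h y) w - Sᶜ.indicator (fun _ => (1 : ℝ)) w := by
        intro w hw
        have hw' : Y w = y := hw
        by_cases hwS : w ∈ S <;> simp [hwS, hw']
      rw [setIntegral_congr_fun (hYm y) h2, integral_sub, integral_indicator_const _ hS,
        integral_indicator_const _ hS.compl, measureReal_restrict_apply hS,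
        measureReal_restrict_apply hS.compl]
      · simp
      · exact (integrable_const _).indicator hS
      · exact (integrable_const _).indicator hS.compl
    have h3 : ν.real (Y ⁻¹' {(y : B)}) =
        ν.real (S ∩ Y ⁻¹' {(y : B)}) + ν.real (Sᶜ ∩ Y ⁻¹' {(y : B)}) := by
      rw [Set.inter_comm S, Set.inter_comm Sᶜ, ← Set.sdiff_eq,
        measureReal_inter_add_sdiff hS]
    rw [h1, h3]
    refine le_trans ?_ (negMulLog_sub_le_negMulLog_add measureReal_nonneg measureReal_nonneg
      (h3 ▸ measureReal_le_one))
    refine sub_le_sub_right ?_ _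
    rcases (measureReal_nonneg (μ := ν) (s := S ∩ Y ⁻¹' {(y : B)})).eq_or_lt with h0 | h0
    · rw [← h0]; simp
    · have h4 := Real.log_le_log h0 (hp y)
      rw [Real.log_exp] at h4
      unfold Real.negMulLog
      nlinarith
  have hnn : ∀ y : T, 0 ≤ Real.negMulLog (ν.real (Y ⁻¹' {(y : B)})) := fun y =>
    Real.negMulLog_nonneg measureReal_nonneg measureReal_le_one
  by_cases htop : ∑' s : T, ENNReal.ofReal (Real.negMulLog (ν.real (Y ⁻¹' {(s : B)}))) = ∞
  · rw [htop]; exact le_top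
  have hsm : Summable fun y : T => Real.negMulLog (ν.real (Y ⁻¹' {(y : B)})) := by
    have := ENNReal.summable_toReal htop
    simpa [ENNReal.toReal_ofReal (hnn _)] using this
  rw [← ENNReal.ofReal_tsum_of_nonneg hnn hsm]
  exact ENNReal.ofReal_le_ofReal (hhs.summable.tsum_le_tsum hle hsm)

/-! ### White Gaussian vectors -/

/-- The law of a white Gaussian vector in `ℝⁿ` with mean zero and variance `a` per dimension. -/
def whiteGaussian (n : ℕ) (a : NNReal) : Measure (EuclideanSpace ℝ (Fin n)) :=
  (Measure.pi fun _ : Fin n => gaussianReal 0 a).map (WithLp.toLp 2)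

instance (n : ℕ) (a : NNReal) : IsProbabilityMeasure (whiteGaussian n a) :=
  Measure.isProbabilityMeasure_map (by fun_prop)

variable {n : ℕ}

lemma charFun_whiteGaussian (a : NNReal) (t : EuclideanSpace ℝ (Fin n)) :
    charFun (whiteGaussian n a) t = Complex.exp (-(a * ‖t‖ ^ 2) / 2) := by
  rw [whiteGaussian, charFun_pi]
  simp_rw [charFun_gaussianReal, ← Complex.exp_sum, ← Complex.ofReal_pow,
    EuclideanSpace.real_norm_sq_eq]
  congr 1
  push_cast
  simp [Finset.sum_div, neg_div, Finset.mul_sum]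

lemma whiteGaussian_map_smul (a b : NNReal) (c : ℝ) (h : c ^ 2 * a = (b : ℝ)) :
    (whiteGaussian n a).map (fun x => c • x) = whiteGaussian n b := by
  apply Measure.ext_of_charFun
  ext t
  rw [charFun_map_smul, charFun_whiteGaussian, charFun_whiteGaussian, norm_smul]
  congr 2
  rw [← Complex.ofReal_pow, ← Complex.ofReal_pow, mul_pow, Real.norm_eq_abs, sq_abs]
  norm_cast
  rw [← h]
  ring

lemma whiteGaussian_prod_map_add (a b : NNReal) :
    ((whiteGaussian n a).prod (whiteGaussian n b)).map (fun p => p.1 + p.2) =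
      whiteGaussian n (a + b) := by
  change whiteGaussian n a ∗ whiteGaussian n b = _
  apply Measure.ext_of_charFun
  ext t
  rw [charFun_conv, charFun_whiteGaussian, charFun_whiteGaussian, charFun_whiteGaussian,
    ← Complex.exp_add]
  congr 1
  push_cast
  ring

lemma whiteGaussian_prod_map_smul_add (a b v : NNReal) (c : ℝ) (h : c ^ 2 * a + b = (v : ℝ)) :
    ((whiteGaussian n a).prod (whiteGaussian n b)).map (fun p => c • p.1 + p.2) =
      whiteGaussian n v := by
  have hc : 0 ≤ c ^ 2 * (a : ℝ) := by positivity
  have h1 := whiteGaussian_map_smul (n := n) a (NNReal.mk (c ^ 2 * a) hc) c rfl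
  have hv : NNReal.mk (c ^ 2 * a) hc + b = v := NNReal.eq h
  rw [← hv, ← whiteGaussian_prod_map_add, ← h1]
  conv_rhs => rw [← Measure.map_id (μ := whiteGaussian n b)]
  rw [Measure.map_prod_map _ _ (by fun_prop) measurable_id, Measure.map_map (by fun_prop)
    (by fun_prop)]
  rfl

lemma whiteGaussian_prod_map_sub (a b : NNReal) :
    ((whiteGaussian n a).prod (whiteGaussian n b)).map (fun p => p.1 - p.2) =
      whiteGaussian n (a + b) := by
  rw [← whiteGaussian_prod_map_add]
  conv_rhs => rw [← Measure.map_id (μ := whiteGaussian n a),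
    ← whiteGaussian_map_smul (n := n) b b (-1) (by simp)]
  rw [Measure.map_prod_map _ _ measurable_id (by fun_prop), Measure.map_map (by fun_prop)
    (by fun_prop)]
  congr 1
  ext p
  simp [sub_eq_add_neg]

lemma stdGaussian_eq_whiteGaussian :
    stdGaussian (EuclideanSpace ℝ (Fin n)) = whiteGaussian n 1 := by
  rw [whiteGaussian, map_pi_eq_stdGaussian]

lemma integral_exp_gaussianReal (a : NNReal) {s : ℝ} (hs : 0 < s) (u : ℝ) :
    ∫ x, Real.exp (-(x - u) ^ 2 / (2 * s)) ∂(gaussianReal 0 a) =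
      Real.exp (-(1 / 2 * Real.log (1 + a / s)) - u ^ 2 / (2 * (a + s))) := by
  by_cases ha : a = 0
  · subst ha
    simp [neg_div]
  have ha' : 0 < (a : ℝ) := lt_of_le_of_ne a.2 (fun h => ha (NNReal.eq h.symm))
  rw [integral_gaussianReal_eq_integral_smul ha]
  -- Complete the square: the product is Gaussian about u a/(a + s) with variance a s/(a + s).
  have hx : ∀ x : ℝ, gaussianPDFReal 0 a x • Real.exp (-(x - u) ^ 2 / (2 * s)) =
      ((√(2 * Real.pi * a))⁻¹ * Real.exp (-(u ^ 2 / (2 * (a + s))))) *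
        Real.exp (-((a + s) / (2 * a * s)) * (x - u * a / (a + s)) ^ 2) := by
    intro x
    rw [gaussianPDFReal, smul_eq_mul, mul_assoc (√(2 * Real.pi * a))⁻¹,
      mul_assoc (√(2 * Real.pi * a))⁻¹, ← Real.exp_add, ← Real.exp_add]
    congr 2
    field_simp
    ring
  simp_rw [hx]
  rw [integral_const_mul, integral_sub_right_eq_self
    (fun x => Real.exp (-((a + s) / (2 * a * s)) * x ^ 2)), integral_gaussian, sub_eq_add_neg,
    Real.exp_add]
  have h1 : Real.exp (-(1 / 2 * Real.log (1 + a / s))) = √(s / (a + s)) := by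
    rw [← Real.exp_log (x := √(s / (a + s))) (by positivity), Real.log_sqrt (by positivity),
      show s / (a + s) = (1 + a / s)⁻¹ by field_simp; ring, Real.log_inv]
    congr 1
    ring
  have h2 : (√(2 * Real.pi * a))⁻¹ * √(Real.pi / ((a + s) / (2 * a * s))) = √(s / (a + s)) := by
    rw [← Real.sqrt_inv, ← Real.sqrt_mul (by positivity)]
    congr 1
    field_simp
  rw [h1, ← h2]
  ring

lemma integral_exp_whiteGaussian (a : NNReal) {s : ℝ} (hs : 0 < s)
    (u : EuclideanSpace ℝ (Fin n)) :
    ∫ x, Real.exp (-‖x - u‖ ^ 2 / (2 * s)) ∂(whiteGaussian n a) =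
      Real.exp (-(n / 2 * Real.log (1 + a / s)) - ‖u‖ ^ 2 / (2 * (a + s))) := by
  rw [whiteGaussian, integral_map (by fun_prop) (by fun_prop)]
  have hx : ∀ x : Fin n → ℝ, Real.exp (-‖WithLp.toLp 2 x - u‖ ^ 2 / (2 * s)) =
      ∏ i, Real.exp (-(x i - u i) ^ 2 / (2 * s)) := by
    intro x
    rw [← Real.exp_sum, EuclideanSpace.real_norm_sq_eq, ← Finset.sum_div, Finset.sum_neg_distrib]
    rfl
  simp_rw [hx]
  rw [integral_fintype_prod_eq_prod (fun (i : Fin n) (y : ℝ) =>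
    Real.exp (-(y - u i) ^ 2 / (2 * s)))]
  simp_rw [integral_exp_gaussianReal a hs]
  rw [← Real.exp_sum, EuclideanSpace.real_norm_sq_eq, Finset.sum_sub_distrib, ← Finset.sum_div]
  congr 2
  simp
  ring

/-- The density of the white Gaussian vector with variance `s` per dimension. -/
lemma whiteGaussian_eq_withDensity {s : NNReal} (hs : 0 < s) :
    whiteGaussian n s = volume.withDensity (fun x : EuclideanSpace ℝ (Fin n) =>
      ENNReal.ofReal ((2 * Real.pi * s) ^ (-(n : ℝ) / 2) * Real.exp (-‖x‖ ^ 2 / (2 * s)))) := by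
  have hs' : 0 < (s : ℝ) := hs
  set f : EuclideanSpace ℝ (Fin n) → ℝ :=
    fun x => (2 * Real.pi * s) ^ (-(n : ℝ) / 2) * Real.exp (-‖x‖ ^ 2 / (2 * s)) with hf
  change _ = volume.withDensity fun x => ENNReal.ofReal (f x)
  have hf0 : ∀ x, 0 ≤ f x := fun x => by simp only [hf]; positivity
  have hfm : Measurable f := by fun_prop
  have hexp : ∀ x : EuclideanSpace ℝ (Fin n), Real.exp (-‖x‖ ^ 2 / (2 * s)) =
      Real.exp (-(1 / (2 * s : ℝ)) * ‖x‖ ^ 2) := fun x => by congr 1; ring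
  have hpi : Real.pi / (1 / (2 * s : ℝ)) = 2 * Real.pi * s := by field_simp
  have hint : ∫ x, f x = 1 := by
    simp only [hf]
    simp_rw [hexp]
    rw [integral_const_mul, GaussianFourier.integral_rexp_neg_mul_sq_norm (by positivity), hpi,
      ← Real.rpow_add (by positivity)]
    simp [neg_div]
  -- A function that is not integrable has integral 0 by convention, so the value 1 already forces
  -- integrability.
  have hfi : Integrable f := by
    by_contra h
    rw [integral_undef h] at hint
    exact zero_ne_one hint
  have : IsProbabilityMeasure (volume.withDensity fun x => ENNReal.ofReal (f x)) := by
    refine ⟨?_⟩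
    rw [withDensity_apply _ MeasurableSet.univ, Measure.restrict_univ,
      ← ofReal_integral_eq_lintegral_ofReal hfi (ae_of_all _ hf0), hint, ENNReal.ofReal_one]
  apply Measure.ext_of_charFun
  ext t
  rw [charFun_whiteGaussian, charFun_apply,
    integral_withDensity_eq_integral_toReal_smul (by fun_prop) (ae_of_all _ fun _ => by simp)]
  have hx : ∀ x : EuclideanSpace ℝ (Fin n), (ENNReal.ofReal (f x)).toReal •
      Complex.exp (inner ℝ x t * Complex.I) =
      ((2 * Real.pi * s) ^ (-(n : ℝ) / 2) : ℝ) * Complex.exp (-((1 / (2 * s : ℝ) : ℝ) : ℂ) *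
        ‖x‖ ^ 2 + Complex.I * inner ℝ t x) := by
    intro x
    rw [ENNReal.toReal_ofReal (hf0 x), Complex.exp_add]
    simp only [hf, hexp, Complex.real_smul]
    rw [real_inner_comm]
    push_cast
    ring_nf
  simp_rw [hx]
  rw [integral_const_mul, GaussianFourier.integral_cexp_neg_mul_sq_norm_add
    (by rw [Complex.ofReal_re]; positivity)]
  have hpi' : (Real.pi : ℂ) / ((1 / (2 * s : ℝ) : ℝ) : ℂ) = ((2 * Real.pi * s : ℝ) : ℂ) := by
    rw [← hpi]; push_cast; ring
  rw [hpi', show ((Module.finrank ℝ (EuclideanSpace ℝ (Fin n)) : ℂ) / 2) = (((n : ℝ) / 2 : ℝ) : ℂ) by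
    simp, ← Complex.ofReal_cpow (by positivity), ← mul_assoc, ← Complex.ofReal_mul,
    ← Real.rpow_add (by positivity), show -(n : ℝ) / 2 + n / 2 = 0 by ring, Real.rpow_zero,
    Complex.ofReal_one, one_mul, Complex.I_sq]
  congr 1
  have hsc : (s : ℂ) ≠ 0 := by exact_mod_cast hs'.ne'
  push_cast
  field_simp
  ring

/-- The fourth moment of a real Gaussian variable with variance at most one. -/
def fourthMoment : ℝ := ∫ x, x ^ 4 ∂(gaussianReal 0 1)

lemma fourthMoment_nonneg : 0 ≤ fourthMoment := integral_nonneg fun x => by positivity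

lemma integrable_pow_gaussianReal (a : NNReal) (k : ℕ) :
    Integrable (fun x : ℝ => x ^ k) (gaussianReal 0 a) := by
  have h : MemLp id (k : ℕ) (gaussianReal 0 a) := IsGaussian.memLp_id _ _ (by simp)
  have := h.integrable_norm_pow'
  refine this.mono (by fun_prop) (ae_of_all _ fun x => by simp)

lemma integral_pow_four_gaussianReal_le {a : NNReal} (ha : a ≤ 1) :
    ∫ x, x ^ 4 ∂(gaussianReal 0 a) ≤ fourthMoment := by
  -- Write the variable as √a times a standard one, which multiplies the fourth moment by a² ≤ 1.
  have h := gaussianReal_map_const_mul (μ := 0) (v := 1) (√a)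
  have h2 : gaussianReal (√a * 0) (NNReal.mk (√a ^ 2) (sq_nonneg _) * 1) = gaussianReal 0 a := by
    congr 1
    · simp
    · apply NNReal.eq
      simp
  rw [h2] at h
  rw [← h, integral_map (by fun_prop) (by fun_prop)]
  simp_rw [mul_pow]
  rw [integral_const_mul]
  have h3 : √(a : ℝ) ^ 4 ≤ 1 :=
    pow_le_one₀ (by positivity) (Real.sqrt_le_one.2 (by exact_mod_cast ha))
  exact mul_le_of_le_one_left fourthMoment_nonneg h3

lemma integral_sq_gaussianReal (a : NNReal) : ∫ x, x ^ 2 ∂(gaussianReal 0 a) = a := by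
  have h := variance_fun_id_gaussianReal (μ := 0) (v := a)
  rwa [variance_of_integral_eq_zero (by fun_prop) (by simp)] at h

lemma whiteGaussian_map_eval (a : NNReal) (j : Fin n) :
    (whiteGaussian n a).map (fun x => x j) = gaussianReal 0 a := by
  rw [whiteGaussian, Measure.map_map (by fun_prop) (by fun_prop)]
  exact (measurePreserving_eval (fun _ : Fin n => gaussianReal 0 a) j).map_eq

lemma integrable_pow_whiteGaussian (a : NNReal) (j : Fin n) (k : ℕ) :
    Integrable (fun x : EuclideanSpace ℝ (Fin n) => x j ^ k) (whiteGaussian n a) := by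
  have h := integrable_pow_gaussianReal a k
  rw [← whiteGaussian_map_eval (n := n) a j] at h
  exact h.comp_measurable (by fun_prop)

lemma integral_pow_whiteGaussian (a : NNReal) (j : Fin n) (k : ℕ) :
    ∫ x, x j ^ k ∂(whiteGaussian n a) = ∫ x, x ^ k ∂(gaussianReal 0 a) := by
  rw [← whiteGaussian_map_eval (n := n) a j, integral_map (by fun_prop) (by fun_prop)]

lemma integrable_norm_sq_whiteGaussian (a : NNReal) :
    Integrable (fun x : EuclideanSpace ℝ (Fin n) => ‖x‖ ^ 2) (whiteGaussian n a) := by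
  simp_rw [EuclideanSpace.real_norm_sq_eq]
  exact integrable_finsetSum _ fun j _ => integrable_pow_whiteGaussian a j 2

lemma integral_norm_sq_whiteGaussian (a : NNReal) :
    ∫ x, ‖x‖ ^ 2 ∂(whiteGaussian n a) = n * a := by
  simp_rw [EuclideanSpace.real_norm_sq_eq]
  rw [integral_finsetSum _ fun j _ => integrable_pow_whiteGaussian a j 2]
  simp [integral_pow_whiteGaussian, integral_sq_gaussianReal]

lemma integral_inner_whiteGaussian (a : NNReal) (z : EuclideanSpace ℝ (Fin n)) :
    ∫ x, inner ℝ x z ∂(whiteGaussian n a) = 0 := by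
  have : ∀ x : EuclideanSpace ℝ (Fin n), inner ℝ x z = ∑ j, z j * x j ^ 1 := by
    intro x; simp [PiLp.inner_apply]
  simp_rw [this]
  rw [integral_finsetSum _ fun j _ => (integrable_pow_whiteGaussian a j 1).const_mul _]
  simp_rw [integral_const_mul, integral_pow_whiteGaussian]
  simp

/-! ### Second moments and Gaussian domination of the dither -/

namespace QLattice

variable {n : ℕ} (L L' : QLattice n)

lemma mul_secondMoment (hn : 0 < n) : n * L.secondMoment = ∫ z, ‖z‖ ^ 2 ∂L.unif := by
  have hn' : (n : ℝ) ≠ 0 := by positivity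
  rw [unif, ProbabilityTheory.cond, integral_smul_measure, ENNReal.toReal_inv, secondMoment,
    smul_eq_mul]
  change _ = L.vol⁻¹ * _
  have := L.vol_pos.ne'
  field_simp

lemma integrable_norm_sq_unif : Integrable (fun z => ‖z‖ ^ 2) L.unif := by
  obtain ⟨R, hR0, hR⟩ := L.exists_closedCell_subset_closedBall
  refine Integrable.of_bound (by fun_prop) (R ^ 2) ?_
  filter_upwards [L.ae_unif_mem_openCell] with z hz
  have h := hR (L.voronoi_subset_closedCell (L.openCell_subset_voronoi hz))
  rw [mem_closedBall_zero_iff] at h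
  rw [Real.norm_of_nonneg (by positivity)]
  gcongr

/-- The uniform distribution over a Voronoi region contained in a ball is dominated by a
multiple of a white Gaussian distribution. -/
lemma unif_le_smul_whiteGaussian {s : NNReal} (hs : 0 < s)
    (hL : L.closedCell ⊆ Metric.closedBall 0 √(n * s)) :
    L.unif ≤ ENNReal.ofReal ((2 * Real.pi * Real.exp 1 * s) ^ ((n : ℝ) / 2) / L.vol) •
      whiteGaussian n s := by
  have hs' : 0 < (s : ℝ) := hs
  have hv := L.vol_pos
  rw [unif_eq, whiteGaussian_eq_withDensity hs]
  refine Measure.le_iff.2 fun A hA => ?_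
  rw [Measure.smul_apply, Measure.smul_apply, withDensity_apply _ hA, smul_eq_mul, smul_eq_mul,
    ← lintegral_const_mul _ (by fun_prop), Measure.restrict_apply hA, ← ENNReal.ofReal_inv_of_pos hv,
    ← setLIntegral_const]
  refine le_trans ?_ (lintegral_mono_set (s := A ∩ L.openCell) Set.inter_subset_left)
  refine setLIntegral_mono (by fun_prop) fun z hz => ?_
  rw [← ENNReal.ofReal_mul (by positivity)]
  refine ENNReal.ofReal_le_ofReal ?_
  have h := hL (L.voronoi_subset_closedCell (L.openCell_subset_voronoi hz.2))
  rw [mem_closedBall_zero_iff, Real.le_sqrt (norm_nonneg _) (by positivity)] at h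
  rw [mul_comm (2 * Real.pi) (Real.exp 1), mul_assoc (Real.exp 1),
    Real.mul_rpow (by positivity) (by positivity), ← Real.exp_mul, one_mul, neg_div,
    Real.rpow_neg (by positivity)]
  -- On the cell ‖z‖² ≤ ns, so the Gaussian exponent loses at most n/2; this is the source of the
  -- factor e in the constant.
  have h1 : 1 ≤ Real.exp ((n : ℝ) / 2) * Real.exp (-‖z‖ ^ 2 / (2 * s)) := by
    rw [← Real.exp_add]
    refine Real.one_le_exp ?_
    rw [neg_div, ← sub_eq_add_neg, sub_nonneg, div_le_div_iff₀ (by positivity) (by positivity)]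
    linarith
  have h2 : 0 < (2 * Real.pi * s : ℝ) ^ ((n : ℝ) / 2) := by positivity
  calc L.vol⁻¹ = L.vol⁻¹ * 1 := (mul_one _).symm
    _ ≤ L.vol⁻¹ * (Real.exp ((n : ℝ) / 2) * Real.exp (-‖z‖ ^ 2 / (2 * s))) := by gcongr
    _ = _ := by field_simp

/-- Compare total masses. Read as vol Λ ≤ (2πes)^(n/2), this later bounds the covering radius from
below. -/
lemma one_le_gaussian_constant {s : NNReal} (hs : 0 < s)
    (hL : L.closedCell ⊆ Metric.closedBall 0 √(n * s)) :
    1 ≤ (2 * Real.pi * Real.exp 1 * s) ^ ((n : ℝ) / 2) / L.vol := by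
  have h := Measure.le_iff.1 (L.unif_le_smul_whiteGaussian hs hL) Set.univ MeasurableSet.univ
  rw [measure_univ, Measure.smul_apply, measure_univ, smul_eq_mul, mul_one] at h
  exact ENNReal.one_le_ofReal.1 h

/-! ### Entropy of one quantized source -/

/-- Minus the log-likelihood bound for the output `c ξ + w - z` of the quantizer. -/
def infoDensity (s a c : ℝ) (p : (EuclideanSpace ℝ (Fin n) × EuclideanSpace ℝ (Fin n)) ×
    EuclideanSpace ℝ (Fin n)) : ℝ :=
  {q : (EuclideanSpace ℝ (Fin n) × EuclideanSpace ℝ (Fin n)) × EuclideanSpace ℝ (Fin n) |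
      c • q.1.1 + q.1.2 - q.2 ∈ L'.openCell}.indicator
    (fun q => n / 2 * (Real.log (1 + a / s) - 1) + ‖q.1.2 - q.2‖ ^ 2 / (2 * (a + s))) p -
  {q : (EuclideanSpace ℝ (Fin n) × EuclideanSpace ℝ (Fin n)) × EuclideanSpace ℝ (Fin n) |
      c • q.1.1 + q.1.2 - q.2 ∈ L'.openCell}ᶜ.indicator 1 p

/-- The event that the output of the quantizer leaves the open Voronoi cell of `L'`. -/
def overload (c : ℝ) : Set ((EuclideanSpace ℝ (Fin n) × EuclideanSpace ℝ (Fin n)) ×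
    EuclideanSpace ℝ (Fin n)) :=
  {q | c • q.1.1 + q.1.2 - q.2 ∈ L'.openCell}ᶜ

lemma measurableSet_good (c : ℝ) : MeasurableSet {q : (EuclideanSpace ℝ (Fin n) ×
    EuclideanSpace ℝ (Fin n)) × EuclideanSpace ℝ (Fin n) |
      c • q.1.1 + q.1.2 - q.2 ∈ L'.openCell} := by
  have : Measurable fun q : (EuclideanSpace ℝ (Fin n) × EuclideanSpace ℝ (Fin n)) ×
    EuclideanSpace ℝ (Fin n) => c • q.1.1 + q.1.2 - q.2 := by fun_prop
  exact this L'.measurableSet_openCell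

lemma measurable_infoDensity (s a c : ℝ) : Measurable (L'.infoDensity s a c) :=
  (Measurable.indicator (by fun_prop) (L'.measurableSet_good c)).sub
    (measurable_const.indicator (L'.measurableSet_good c).compl)

lemma norm_infoDensity_le {s a c : ℝ} (hs : 0 < s) (ha : 0 ≤ a)
    (ξ w z : EuclideanSpace ℝ (Fin n)) :
    ‖L'.infoDensity s a c ((ξ, w), z)‖ ≤ |n / 2 * (Real.log (1 + a / s) - 1)| + 1 +
      (‖w‖ ^ 2 + ‖z‖ ^ 2) / s := by
  have h1 : ‖w - z‖ ^ 2 / (2 * (a + s)) ≤ (‖w‖ ^ 2 + ‖z‖ ^ 2) / s := by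
    rw [div_le_div_iff₀ (by positivity) hs]
    have h2 : ‖w - z‖ ^ 2 ≤ 2 * (‖w‖ ^ 2 + ‖z‖ ^ 2) := by
      have := norm_sub_le w z
      nlinarith [norm_nonneg (w - z), sq_nonneg (‖w‖ - ‖z‖)]
    have h3 : 0 ≤ ‖w‖ ^ 2 + ‖z‖ ^ 2 := by positivity
    nlinarith
  have h3 : 0 ≤ ‖w - z‖ ^ 2 / (2 * (a + s)) := by positivity
  have h4 := abs_nonneg (n / 2 * (Real.log (1 + a / s) - 1))
  unfold infoDensity
  by_cases h : c • ξ + w - z ∈ L'.openCell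
  · simp only [Set.indicator, Set.mem_compl_iff, Set.mem_ofPred_eq, h, if_true, not_true,
      if_false, sub_zero]
    refine (norm_add_le _ _).trans ?_
    rw [Real.norm_eq_abs, Real.norm_of_nonneg h3]
    linarith
  · simp only [Set.indicator, Set.mem_compl_iff, Set.mem_ofPred_eq, h, if_false, not_false_iff,
      if_true, zero_sub, norm_neg, Pi.one_apply, norm_one]
    linarith

variable {L L'}

/-- Without overload the value y determines the remainder w - (y - x), which lies in the closed cell
and so has squared norm at most ns. Markov's inequality for exp(-‖w - (y - x)‖²/(2s)), which is at
least exp(-n/2) there, and the Gaussian integral give the bound. -/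
lemma measureReal_quantize_le {s a : NNReal} (hs : 0 < s)
    (hL : L.closedCell ⊆ Metric.closedBall 0 √(n * s))
    (x d y : EuclideanSpace ℝ (Fin n)) :
    (whiteGaussian n a).real ({w | L.Q (x + w + d) - d ∈ L'.openCell} ∩
        (fun w => quantize L L' (x + w) d) ⁻¹' {y}) ≤
      Real.exp (-(n / 2 * (Real.log (1 + a / s) - 1) + ‖y - x‖ ^ 2 / (2 * (a + s)))) := by
  have hs' : 0 < (s : ℝ) := hs
  have h1 : ({w | L.Q (x + w + d) - d ∈ L'.openCell} ∩
      (fun w => quantize L L' (x + w) d) ⁻¹' {y}) ⊆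
      {w | Real.exp (-((n : ℝ) / 2)) ≤ Real.exp (-‖w - (y - x)‖ ^ 2 / (2 * s))} := by
    rintro w ⟨hw, hy⟩
    have hy1 : quantize L L' (x + w) d = y := hy
    have hy' : L.Q (x + w + d) - d = y := by
      rw [← hy1, quantize, modL, show L'.Q _ = 0 from
        L'.openCell_subset_voronoi hw, sub_zero]
    have h := hL (L.modL_mem_closedCell (x + w + d))
    rw [mem_closedBall_zero_iff, Real.le_sqrt (norm_nonneg _) (by positivity), modL] at h
    have he : x + w + d - L.Q (x + w + d) = w - (y - x) := by rw [← hy']; abel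
    rw [he] at h
    refine Real.exp_le_exp.2 ?_
    rw [neg_div, neg_le_neg_iff, div_le_div_iff₀ (by positivity) (by positivity)]
    linarith
  have hi : Integrable (fun w => Real.exp (-‖w - (y - x)‖ ^ 2 / (2 * s))) (whiteGaussian n a) := by
    refine Integrable.of_bound (by fun_prop) 1 (ae_of_all _ fun w => ?_)
    rw [Real.norm_of_nonneg (by positivity)]
    refine Real.exp_le_one_iff.2 ?_
    rw [neg_div]
    exact neg_nonpos.2 (by positivity)
  have h2 := mul_meas_ge_le_integral_of_nonneg (ae_of_all _ fun w => by positivity) hi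
    (Real.exp (-((n : ℝ) / 2)))
  rw [integral_exp_whiteGaussian a hs'] at h2
  refine (measureReal_mono h1).trans ?_
  refine le_of_mul_le_mul_left (h2.trans (le_of_eq ?_)) (Real.exp_pos (-((n : ℝ) / 2)))
  rw [← Real.exp_add]
  congr 1
  ring

lemma measurable_quantize (hQ : Measurable L.Q) (hQ' : Measurable L'.Q) :
    Measurable fun p : EuclideanSpace ℝ (Fin n) × EuclideanSpace ℝ (Fin n) =>
      quantize L L' p.1 p.2 := by
  unfold quantize modL
  fun_prop

lemma countable_range_quantize (d : EuclideanSpace ℝ (Fin n)) :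
    ∃ T : Set (EuclideanSpace ℝ (Fin n)), T.Countable ∧ ∀ x, quantize L L' x d ∈ T := by
  refine ⟨Set.range fun y : L.Λ => L'.modL (y - d), Set.countable_range _, fun x => ?_⟩
  exact ⟨⟨L.Q (x + d), L.Q_mem _⟩, rfl⟩

lemma integrable_infoDensity_modL (hQ : Measurable L.Q) {s a : NNReal} (hs : 0 < s)
    (hL : L.closedCell ⊆ Metric.closedBall 0 √(n * s)) (c : ℝ)
    (ξ d : EuclideanSpace ℝ (Fin n)) :
    Integrable (fun w => L'.infoDensity s a c ((ξ, w), L.modL (c • ξ + w + d)))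
      (whiteGaussian n a) := by
  have hm : Measurable L.modL := by unfold modL; fun_prop
  refine Integrable.mono' ((integrable_const (|n / 2 * (Real.log (1 + a / s) - 1)| + 1)).add
    (((integrable_norm_sq_whiteGaussian a).add (integrable_const ((n : ℝ) * s))).div_const (s : ℝ)))
    ?_ (ae_of_all _ fun w => ?_)
  · exact ((L'.measurable_infoDensity s a c).comp (by fun_prop)).aestronglyMeasurable
  · refine (L'.norm_infoDensity_le hs a.2 _ _ _).trans ?_
    have h := hL (L.modL_mem_closedCell (c • ξ + w + d))
    rw [mem_closedBall_zero_iff, Real.le_sqrt (norm_nonneg _) (by positivity)] at h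
    exact add_le_add le_rfl (div_le_div_of_nonneg_right (add_le_add le_rfl h) s.2)

/-- Connects two descriptions: as a function of the noise z the density can be averaged easily, as a
function of the quantizer output it bounds entropy. -/
lemma infoDensity_modL (s a c : ℝ) (ξ d w : EuclideanSpace ℝ (Fin n)) :
    L'.infoDensity s a c ((ξ, w), L.modL (c • ξ + w + d)) =
      {w | L.Q (c • ξ + w + d) - d ∈ L'.openCell}.indicator (fun w =>
        n / 2 * (Real.log (1 + a / s) - 1) +
          ‖quantize L L' (c • ξ + w) d - c • ξ‖ ^ 2 / (2 * (a + s))) w -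
      {w | L.Q (c • ξ + w + d) - d ∈ L'.openCell}ᶜ.indicator 1 w := by
  have h1 : c • ξ + w - L.modL (c • ξ + w + d) = L.Q (c • ξ + w + d) - d := by
    rw [modL]; abel
  unfold infoDensity
  by_cases h : L.Q (c • ξ + w + d) - d ∈ L'.openCell
  · have h2 : quantize L L' (c • ξ + w) d = L.Q (c • ξ + w + d) - d := by
      rw [quantize, modL, show L'.Q _ = 0 from L'.openCell_subset_voronoi h, sub_zero]
    have h3 : w - L.modL (c • ξ + w + d) = quantize L L' (c • ξ + w) d - c • ξ := by
      rw [h2, ← h1]; abel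
    simp only [Set.indicator, Set.mem_compl_iff, Set.mem_ofPred_eq, h1, h, if_true, not_true,
      if_false, sub_zero, h3]
  · simp only [Set.indicator, Set.mem_compl_iff, Set.mem_ofPred_eq, h1, h, if_false,
      not_false_iff, if_true]
    rfl

/-- The entropy of the quantizer output for a fixed dither and a fixed mean of the input. -/
lemma ofReal_integral_infoDensity_le (hQ : Measurable L.Q) (hQ' : Measurable L'.Q)
    {s a : NNReal} (hs : 0 < s) (hL : L.closedCell ⊆ Metric.closedBall 0 √(n * s)) (c : ℝ)
    (ξ d : EuclideanSpace ℝ (Fin n)) :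
    ENNReal.ofReal (∫ w, L'.infoDensity s a c ((ξ, w), L.modL (c • ξ + w + d))
        ∂(whiteGaussian n a)) ≤
      natEntropy ((whiteGaussian n a).map fun w => quantize L L' (c • ξ + w) d) := by
  obtain ⟨T, hT, hT'⟩ := countable_range_quantize (L := L) (L' := L') d
  have hqm : Measurable fun w => quantize L L' (c • ξ + w) d :=
    (measurable_quantize hQ hQ').comp
      (f := fun w => (c • ξ + w, d)) (by fun_prop)
  have hSm : MeasurableSet {w | L.Q (c • ξ + w + d) - d ∈ L'.openCell} := by
    have : Measurable fun w => L.Q (c • ξ + w + d) - d := by fun_prop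
    exact this L'.measurableSet_openCell
  have hi := integrable_infoDensity_modL (L' := L') (a := a) hQ hs hL c ξ d
  simp only [infoDensity_modL] at hi ⊢
  exact ofReal_integral_le_natEntropy (whiteGaussian n a) hqm hT (fun w => hT' _) hSm
    (h := fun y => n / 2 * (Real.log (1 + a / s) - 1) + ‖y - c • ξ‖ ^ 2 / (2 * (a + s)))
    (fun y => measureReal_quantize_le hs hL (c • ξ) d y) hi

/-- The joint law of the mean `ξ`, the innovation `w` and the quantization noise `z`. -/
def noiseLaw (L : QLattice n) (a : NNReal) : Measure ((EuclideanSpace ℝ (Fin n) ×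
    EuclideanSpace ℝ (Fin n)) × EuclideanSpace ℝ (Fin n)) :=
  ((whiteGaussian n 1).prod (whiteGaussian n a)).prod L.unif

instance (L : QLattice n) (a : NNReal) : IsProbabilityMeasure (noiseLaw L a) := by
  unfold noiseLaw; infer_instance

/-- The crypto lemma as a change of variables: for each fixed input the error is uniform over the
dither, hence independent of the input. -/
lemma measurePreserving_noise (hQ : Measurable L.Q) (a : NNReal) (c : ℝ) :
    MeasurePreserving (fun p : EuclideanSpace ℝ (Fin n) ×
        (EuclideanSpace ℝ (Fin n) × EuclideanSpace ℝ (Fin n)) =>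
        (p.2, L.modL (c • p.2.1 + p.2.2 + p.1)))
      (L.unif.prod ((whiteGaussian n 1).prod (whiteGaussian n a))) (noiseLaw L a) := by
  have hm : Measurable L.modL := by unfold modL; fun_prop
  have hg : Measurable (Function.uncurry fun (q : EuclideanSpace ℝ (Fin n) ×
      EuclideanSpace ℝ (Fin n)) (d : EuclideanSpace ℝ (Fin n)) =>
        L.modL (c • q.1 + q.2 + d)) := by
    unfold Function.uncurry
    exact hm.comp (by fun_prop)
  have h := MeasurePreserving.skew_product
    (MeasurePreserving.id ((whiteGaussian n 1).prod (whiteGaussian n a))) hg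
    (ae_of_all _ fun q => L.map_modL_add_unif hQ (c • q.1 + q.2))
  exact h.comp Measure.measurePreserving_swap

lemma integrable_norm_sq_noise (a : NNReal) :
    Integrable (fun p => ‖p.1.2‖ ^ 2 + ‖p.2‖ ^ 2) (noiseLaw L a) :=
  (((integrable_norm_sq_whiteGaussian a).comp_snd _).comp_fst _).add
    (L.integrable_norm_sq_unif.comp_snd _)

lemma integrable_infoDensity {s a : NNReal} (hs : 0 < s) (c : ℝ) :
    Integrable (L'.infoDensity s a c) (noiseLaw L a) := by
  refine Integrable.mono' ((integrable_const (|n / 2 * (Real.log (1 + a / s) - 1)| + 1)).add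
    ((integrable_norm_sq_noise a).div_const (s : ℝ)))
    (L'.measurable_infoDensity s a c).aestronglyMeasurable
    (ae_of_all _ fun p => ?_)
  exact L'.norm_infoDensity_le hs a.2 _ _ _

/-- The conditional entropy of the quantizer output given the dither and the mean of the input. -/
lemma ofReal_integral_infoDensity_noise_le (hQ : Measurable L.Q) (hQ' : Measurable L'.Q)
    {s a : NNReal} (hs : 0 < s) (hL : L.closedCell ⊆ Metric.closedBall 0 √(n * s)) (c : ℝ) :
    ENNReal.ofReal (∫ p, L'.infoDensity s a c p ∂(noiseLaw L a)) ≤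
      ∫⁻ d, ∫⁻ ξ, natEntropy ((whiteGaussian n a).map fun w => quantize L L' (c • ξ + w) d)
        ∂(whiteGaussian n 1) ∂L.unif := by
  have hmp := measurePreserving_noise hQ a c
  have hi : Integrable (fun p => L'.infoDensity s a c (p.2, L.modL (c • p.2.1 + p.2.2 + p.1)))
      (L.unif.prod ((whiteGaussian n 1).prod (whiteGaussian n a))) :=
    (hmp.integrable_comp (L'.measurable_infoDensity s a c).aestronglyMeasurable).2
      (integrable_infoDensity hs c)
  have he : ∫ p, L'.infoDensity s a c p ∂(noiseLaw L a) =
      ∫ p, L'.infoDensity s a c (p.2, L.modL (c • p.2.1 + p.2.2 + p.1))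
        ∂(L.unif.prod ((whiteGaussian n 1).prod (whiteGaussian n a))) := by
    rw [← hmp.map_eq, integral_map hmp.measurable.aemeasurable
      (L'.measurable_infoDensity s a c).aestronglyMeasurable]
  rw [he, integral_prod _ hi]
  -- The positive part is taken one integral at a time, so the pointwise entropy bound applies for
  -- fixed dither and mean, and the entropies need not be measurable in them.
  refine (ofReal_integral_le_lintegral_ofReal hi.integral_prod_left).trans (lintegral_mono_ae ?_)
  filter_upwards [hi.prod_right_ae] with d hd
  rw [integral_prod _ hd]
  refine (ofReal_integral_le_lintegral_ofReal hd.integral_prod_left).trans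
    (lintegral_mono fun ξ => ?_)
  exact ofReal_integral_infoDensity_le hQ hQ' hs hL c ξ d

/-! ### Overload probability and mean information density -/

lemma measurableSet_overload (L' : QLattice n) (c : ℝ) : MeasurableSet (L'.overload c) :=
  (L'.measurableSet_good c).compl

/-- Replacing the uniform z by a dominating Gaussian of variance s turns the output into white noise
of variance c² + a + s = 1 + s. -/
lemma measureReal_overload_le {s a : NNReal} (hs : 0 < s)
    (hL : L.closedCell ⊆ Metric.closedBall 0 √(n * s)) {c : ℝ} (hc : c ^ 2 + a = 1) :
    (noiseLaw L a).real (L'.overload c) ≤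
      (2 * Real.pi * Real.exp 1 * s) ^ ((n : ℝ) / 2) / L.vol *
        (whiteGaussian n (1 + s)).real L'.openCellᶜ := by
  have h0 : 0 ≤ (2 * Real.pi * Real.exp 1 * s) ^ ((n : ℝ) / 2) / L.vol :=
    zero_le_one.trans (L.one_le_gaussian_constant hs hL)
  have h1 : noiseLaw L a (L'.overload c) ≤
      ENNReal.ofReal ((2 * Real.pi * Real.exp 1 * s) ^ ((n : ℝ) / 2) / L.vol) *
        (((whiteGaussian n 1).prod (whiteGaussian n a)).prod (whiteGaussian n s))
          (L'.overload c) := by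
    rw [noiseLaw, Measure.prod_apply (L'.measurableSet_overload c),
      Measure.prod_apply (L'.measurableSet_overload c), ← lintegral_const_mul _
        (measurable_measure_prodMk_left (L'.measurableSet_overload c))]
    exact lintegral_mono fun q => L.unif_le_smul_whiteGaussian hs hL _
  have h2 : (((whiteGaussian n 1).prod (whiteGaussian n a)).prod (whiteGaussian n s))
      (L'.overload c) = whiteGaussian n (1 + s) L'.openCellᶜ := by
    have h := whiteGaussian_prod_map_smul_add (n := n) 1 a 1 c (by simpa using hc)
    have h' : (((whiteGaussian n 1).prod (whiteGaussian n a)).prod (whiteGaussian n s)).map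
        (Prod.map (fun p => c • p.1 + p.2) id) = (whiteGaussian n 1).prod (whiteGaussian n s) := by
      rw [← Measure.map_prod_map _ _ (by fun_prop) measurable_id, Measure.map_id, h]
    rw [← whiteGaussian_prod_map_sub 1 s, ← h', Measure.map_map (by fun_prop) (by fun_prop),
      Measure.map_apply (by fun_prop) L'.measurableSet_openCell.compl]
    rfl
  rw [h2] at h1
  have h3 := ENNReal.toReal_mono (by finiteness) h1
  rwa [ENNReal.toReal_mul, ENNReal.toReal_ofReal h0] at h3

/-- Coordinatewise arithmetic-geometric mean. On the overload event it replaces the Cauchy-Schwarz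
inequality: the fourth moments are weighted by a small η, while the constant is multiplied by the
overload probability. -/
lemma norm_sq_le_sum_pow_four {η : ℝ} (hη : 0 < η) (w : EuclideanSpace ℝ (Fin n)) :
    ‖w‖ ^ 2 ≤ η * ∑ j, w j ^ 4 + n / (4 * η) := by
  rw [EuclideanSpace.real_norm_sq_eq, Finset.mul_sum,
    show (n : ℝ) / (4 * η) = ∑ _j : Fin n, 1 / (4 * η) by simp; ring, ← Finset.sum_add_distrib]
  refine Finset.sum_le_sum fun j _ => ?_
  have h : 0 ≤ (2 * η * w j ^ 2 - 1) ^ 2 / (4 * η) := by positivity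
  have h2 : (2 * η * w j ^ 2 - 1) ^ 2 / (4 * η) = η * w j ^ 4 + 1 / (4 * η) - w j ^ 2 := by
    field_simp
    ring
  linarith

/-- The cross term vanishes because w is centred and independent of z. -/
lemma integral_norm_sub_sq_noise (hn : 0 < n) (a : NNReal) :
    ∫ p, ‖p.1.2 - p.2‖ ^ 2 ∂(noiseLaw L a) = n * (a + L.secondMoment) := by
  have hin : Integrable (fun p : (EuclideanSpace ℝ (Fin n) × EuclideanSpace ℝ (Fin n)) ×
      EuclideanSpace ℝ (Fin n) => inner ℝ p.1.2 p.2) (noiseLaw L a) := by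
    refine (integrable_norm_sq_noise a).mono' (by fun_prop) (ae_of_all _ fun p => ?_)
    refine (norm_inner_le_norm _ _).trans ?_
    nlinarith [sq_nonneg (‖p.1.2‖ - ‖p.2‖), sq_nonneg ‖p.1.2‖, sq_nonneg ‖p.2‖]
  have hz : ∫ p, inner ℝ p.1.2 p.2 ∂(noiseLaw L a) = 0 := by
    rw [noiseLaw, integral_prod_symm _ hin]
    refine integral_eq_zero_of_ae (ae_of_all _ fun z => ?_)
    change ∫ q : EuclideanSpace ℝ (Fin n) × EuclideanSpace ℝ (Fin n), inner ℝ q.2 z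
      ∂((whiteGaussian n 1).prod (whiteGaussian n a)) = 0
    rw [integral_fun_snd (fun w => inner ℝ w z), integral_inner_whiteGaussian, smul_zero]
  simp_rw [norm_sub_sq_real]
  have hw : Integrable (fun p : (EuclideanSpace ℝ (Fin n) × EuclideanSpace ℝ (Fin n)) ×
      EuclideanSpace ℝ (Fin n) => ‖p.1.2‖ ^ 2) (noiseLaw L a) :=
    ((integrable_norm_sq_whiteGaussian a).comp_snd _).comp_fst _
  have hz2 : Integrable (fun p : (EuclideanSpace ℝ (Fin n) × EuclideanSpace ℝ (Fin n)) ×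
      EuclideanSpace ℝ (Fin n) => ‖p.2‖ ^ 2) (noiseLaw L a) :=
    L.integrable_norm_sq_unif.comp_snd _
  have hd : Integrable (fun p : (EuclideanSpace ℝ (Fin n) × EuclideanSpace ℝ (Fin n)) ×
      EuclideanSpace ℝ (Fin n) => ‖p.1.2‖ ^ 2 - 2 * inner ℝ p.1.2 p.2) (noiseLaw L a) :=
    hw.sub (hin.const_mul 2)
  rw [integral_add hd hz2, integral_sub hw (hin.const_mul 2),
    integral_const_mul, hz, noiseLaw, integral_fun_snd (fun z => ‖z‖ ^ 2),
    integral_fun_fst (fun q : EuclideanSpace ℝ (Fin n) × EuclideanSpace ℝ (Fin n) => ‖q.2‖ ^ 2),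
    integral_fun_snd (fun w => ‖w‖ ^ 2), integral_norm_sq_whiteGaussian, ← L.mul_secondMoment hn]
  simp
  ring

/-- A lower bound for the mean information density in terms of the overload probability. -/
lemma integral_infoDensity_ge (hn : 0 < n) {s a : NNReal} (hs : 0 < s) (ha : a ≤ 1)
    (hL : L.closedCell ⊆ Metric.closedBall 0 √(n * s)) (c : ℝ) {η : ℝ} (hη : 0 < η) :
    n / 2 * (Real.log (1 + a / s) - 1) + n * (a + L.secondMoment) / (2 * (a + s)) -
      (noiseLaw L a).real (L'.overload c) *
        (|n / 2 * (Real.log (1 + a / s) - 1)| + 1 + n + n / (4 * η) / s) -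
      n * η * fourthMoment / s ≤
      ∫ p, L'.infoDensity s a c p ∂(noiseLaw L a) := by
  have hs' : 0 < (s : ℝ) := hs
  have ha0 : 0 ≤ (a : ℝ) := a.2
  set K : ℝ := n / 2 * (Real.log (1 + a / s) - 1) with hK
  have h4 : ∀ j, Integrable (fun p : (EuclideanSpace ℝ (Fin n) × EuclideanSpace ℝ (Fin n)) ×
      EuclideanSpace ℝ (Fin n) => p.1.2 j ^ 4) (noiseLaw L a) := fun j =>
    ((integrable_pow_whiteGaussian a j 4).comp_snd _).comp_fst _
  have h4i : ∀ j, ∫ p, p.1.2 j ^ 4 ∂(noiseLaw L a) ≤ fourthMoment := by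
    intro j
    rw [noiseLaw, integral_fun_fst (fun q : EuclideanSpace ℝ (Fin n) ×
      EuclideanSpace ℝ (Fin n) => q.2 j ^ 4), integral_fun_snd
      (fun w : EuclideanSpace ℝ (Fin n) => w j ^ 4), integral_pow_whiteGaussian]
    simpa using integral_pow_four_gaussianReal_le ha
  have hB := L'.measurableSet_overload c
  have hsq : Integrable (fun p : (EuclideanSpace ℝ (Fin n) × EuclideanSpace ℝ (Fin n)) ×
      EuclideanSpace ℝ (Fin n) => ‖p.1.2 - p.2‖ ^ 2) (noiseLaw L a) := by
    by_contra h
    have h1 := integral_norm_sub_sq_noise (L := L) hn a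
    refine h (((integrable_norm_sq_noise a).const_mul 2).mono' (by fun_prop)
      (ae_of_all _ fun p => ?_))
    rw [Real.norm_of_nonneg (by positivity)]
    have := norm_sub_le p.1.2 p.2
    nlinarith [norm_nonneg (p.1.2 - p.2), sq_nonneg (‖p.1.2‖ - ‖p.2‖)]
  have hK1 : Integrable (fun p : (EuclideanSpace ℝ (Fin n) × EuclideanSpace ℝ (Fin n)) ×
      EuclideanSpace ℝ (Fin n) => K + ‖p.1.2 - p.2‖ ^ 2 / (2 * (a + s))) (noiseLaw L a) :=
    (integrable_const K).add (hsq.div_const _)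
  have hK2 : Integrable (fun p => K + ‖p.1.2 - p.2‖ ^ 2 / (2 * (a + s)) -
      (L'.overload c).indicator (fun _ => |K| + 1 + n + n / (4 * η) / s) p) (noiseLaw L a) :=
    hK1.sub ((integrable_const _).indicator hB)
  have hK3 : Integrable (fun p : (EuclideanSpace ℝ (Fin n) × EuclideanSpace ℝ (Fin n)) ×
      EuclideanSpace ℝ (Fin n) => (∑ j, p.1.2 j ^ 4) * (η / s)) (noiseLaw L a) :=
    (integrable_finsetSum _ fun j _ => h4 j).mul_const _
  -- The minorant: the main term everywhere, minus a constant on overload, minus a fourth-moment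
  -- term that absorbs the unbounded part of ‖w‖².
  have hlow : Integrable (fun p => K + ‖p.1.2 - p.2‖ ^ 2 / (2 * (a + s)) -
      (L'.overload c).indicator (fun _ => |K| + 1 + n + n / (4 * η) / s) p -
      (∑ j, p.1.2 j ^ 4) * (η / s)) (noiseLaw L a) :=
    hK2.sub hK3
  refine le_trans ?_ (integral_mono_ae hlow (integrable_infoDensity hs c) ?_)
  · rw [integral_sub hK2 hK3, integral_sub hK1 ((integrable_const _).indicator hB),
      integral_add (integrable_const _) (hsq.div_const _), integral_div,
      integral_mul_const (η / (s : ℝ)),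
      integral_finsetSum _ fun j _ => h4 j, integral_norm_sub_sq_noise hn,
      integral_indicator_const _ hB, integral_const, probReal_univ, smul_eq_mul,
      smul_eq_mul, one_mul]
    refine sub_le_sub_left ?_ _
    calc (∑ j, ∫ p, p.1.2 j ^ 4 ∂(noiseLaw L a)) * (η / s)
        ≤ (∑ _j : Fin n, fourthMoment) * (η / s) := by
          gcongr with j
          exact h4i j
      _ = n * η * fourthMoment / s := by simp; ring
  · have hz : ∀ᵐ p ∂(noiseLaw L a), p.2 ∈ L.openCell :=
      Measure.quasiMeasurePreserving_snd.ae L.ae_unif_mem_openCell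
    filter_upwards [hz] with p hp
    have hzn := hL (L.voronoi_subset_closedCell (L.openCell_subset_voronoi hp))
    rw [mem_closedBall_zero_iff, Real.le_sqrt (norm_nonneg _) (by positivity)] at hzn
    have hsum : 0 ≤ (∑ j, p.1.2 j ^ 4) * (η / s) := by
      refine mul_nonneg (Finset.sum_nonneg fun j _ => by positivity) (by positivity)
    -- On overload the density is -1, so the correction must outweigh the main term by 1; the
    -- summand n comes from ‖z‖²/s ≤ n.
    by_cases h : p ∈ L'.overload c
    · have h' : ¬ (c • p.1.1 + p.1.2 - p.2 ∈ L'.openCell) := h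
      have h1 : L'.infoDensity s a c p = -1 := by
        unfold infoDensity
        simp only [Set.indicator, Set.mem_compl_iff, Set.mem_ofPred_eq, h', if_false,
          not_false_iff, if_true, zero_sub, Pi.one_apply]
      rw [h1, Set.indicator_of_mem h]
      have h2 : ‖p.1.2 - p.2‖ ^ 2 / (2 * (a + s)) ≤ (‖p.1.2‖ ^ 2 + ‖p.2‖ ^ 2) / s := by
        rw [div_le_div_iff₀ (by positivity) hs']
        have h2 : ‖p.1.2 - p.2‖ ^ 2 ≤ 2 * (‖p.1.2‖ ^ 2 + ‖p.2‖ ^ 2) := by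
          have := norm_sub_le p.1.2 p.2
          nlinarith [norm_nonneg (p.1.2 - p.2), sq_nonneg (‖p.1.2‖ - ‖p.2‖)]
        have h3 : 0 ≤ ‖p.1.2‖ ^ 2 + ‖p.2‖ ^ 2 := by positivity
        nlinarith
      have h3 : (‖p.1.2‖ ^ 2 + ‖p.2‖ ^ 2) / s ≤
          (∑ j, p.1.2 j ^ 4) * (η / s) + n / (4 * η) / s + n := by
        have h4 : (∑ j, p.1.2 j ^ 4) * (η / s) + n / (4 * η) / s + n =
            (η * (∑ j, p.1.2 j ^ 4) + n / (4 * η) + n * s) / s := by field_simp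
        rw [h4]
        gcongr
        exact norm_sq_le_sum_pow_four hη _
      have := le_abs_self K
      linarith
    · have h' : c • p.1.1 + p.1.2 - p.2 ∈ L'.openCell := not_not.1 h
      have h1 : L'.infoDensity s a c p = K + ‖p.1.2 - p.2‖ ^ 2 / (2 * (a + s)) := by
        unfold infoDensity
        simp only [Set.indicator, Set.mem_compl_iff, Set.mem_ofPred_eq, h', not_true,
          if_false, if_true, sub_zero, hK]
      rw [h1, Set.indicator_of_notMem h]
      linarith

end QLattice

/-- A form of Stirling's upper bound for the Gamma function. -/
lemma Gamma_add_one_le {x θ : ℝ} (hx : 0 < x) (h0 : 0 < θ) (h1 : θ < 1) :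
    Real.Gamma (x + 1) ≤ (x / (Real.exp 1 * (1 - θ))) ^ x / θ := by
  have h2 : 0 < 1 - θ := by linarith
  rw [Real.Gamma_eq_integral (by linarith), add_sub_cancel_right]
  have hexp : ∫ t in Set.Ioi (0 : ℝ), Real.exp (-θ * t) = 1 / θ := by
    rw [integral_exp_mul_Ioi (by linarith)]
    simp
  rw [div_eq_mul_one_div _ θ, ← hexp, ← integral_const_mul]
  refine setIntegral_mono_on ?_ ?_ measurableSet_Ioi fun t ht => ?_
  · have := Real.GammaIntegral_convergent (s := x + 1) (by linarith)
    simpa using this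
  · exact ((exp_neg_integrableOn_Ioi 0 h0)).const_mul _
  · have ht' : 0 < t := ht
    -- This is y + 1 ≤ exp y at y = (1 - θ)t/x - 1. Its power x trades t^x for exp((1 - θ)t),
    -- leaving the integrable factor exp(-θt).
    have h3 : t ≤ x / (Real.exp 1 * (1 - θ)) * Real.exp ((1 - θ) * t / x) := by
      have h := Real.add_one_le_exp ((1 - θ) * t / x - 1)
      rw [sub_add_cancel, Real.exp_sub, div_le_div_iff₀ hx (by positivity)] at h
      rw [div_mul_eq_mul_div, le_div_iff₀ (by positivity)]
      linarith
    have h4 := Real.rpow_le_rpow ht'.le h3 hx.le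
    rw [Real.mul_rpow (by positivity) (by positivity), ← Real.exp_mul,
      div_mul_cancel₀ _ hx.ne'] at h4
    calc Real.exp (-t) * t ^ x
        ≤ Real.exp (-t) * ((x / (Real.exp 1 * (1 - θ))) ^ x * Real.exp ((1 - θ) * t)) := by gcongr
      _ = (x / (Real.exp 1 * (1 - θ))) ^ x * (Real.exp (-t) * Real.exp ((1 - θ) * t)) := by ring
      _ = _ := by rw [← Real.exp_add]; congr 2; ring

/-! ### Covering radius, effective radius and second moment -/

namespace QLattice

variable {n : ℕ} (L : QLattice n)

lemma volume_real_unitBall_pos :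
    0 < volume.real (Metric.ball (0 : EuclideanSpace ℝ (Fin n)) 1) :=
  ENNReal.toReal_pos (Metric.measure_ball_pos _ _ one_pos).ne' measure_ball_lt_top.ne

lemma effRadius_pos : 0 < L.effRadius :=
  Real.rpow_pos_of_pos (div_pos L.vol_pos volume_real_unitBall_pos) _

lemma effRadius_pow (hn : 0 < n) :
    L.effRadius ^ n * volume.real (Metric.ball (0 : EuclideanSpace ℝ (Fin n)) 1) = L.vol := by
  rw [effRadius, one_div, Real.rpow_inv_natCast_pow
    (div_pos L.vol_pos volume_real_unitBall_pos).le hn.ne',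
    div_mul_cancel₀ _ volume_real_unitBall_pos.ne']

lemma mul_secondMoment_le (hn : 0 < n) : n * L.secondMoment ≤ L.covRadius ^ 2 := by
  rw [L.mul_secondMoment hn]
  calc ∫ z, ‖z‖ ^ 2 ∂L.unif ≤ ∫ _z, L.covRadius ^ 2 ∂L.unif := by
        refine integral_mono_ae L.integrable_norm_sq_unif (integrable_const _) ?_
        filter_upwards [L.ae_unif_mem_openCell] with z hz
        have h := L.voronoi_subset_closedBall (L.openCell_subset_voronoi hz)
        rw [mem_closedBall_zero_iff] at h
        gcongr
    _ = L.covRadius ^ 2 := by simp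

/-- The density is at most 1/vol Λ, and scaling the effective ball by t scales its volume by t^n. -/
lemma unif_real_ball_le (hn : 0 < n) {t : ℝ} (ht : 0 ≤ t) :
    L.unif.real (Metric.ball 0 (t * L.effRadius)) ≤ t ^ n := by
  have hr := L.effRadius_pos
  have hv := L.vol_pos
  have h1 : L.unif (Metric.ball 0 (t * L.effRadius)) ≤ (ENNReal.ofReal L.vol)⁻¹ *
      volume (Metric.ball (0 : EuclideanSpace ℝ (Fin n)) (t * L.effRadius)) := by
    rw [unif_eq, Measure.smul_apply, smul_eq_mul]
    gcongr
    exact Measure.restrict_le_self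
  have : Nonempty (Fin n) := ⟨⟨0, hn⟩⟩
  rw [Measure.addHaar_ball volume _ (by positivity)] at h1
  have h2 := ENNReal.toReal_mono (ENNReal.mul_ne_top (by simpa using hv)
    (ENNReal.mul_ne_top ENNReal.ofReal_ne_top measure_ball_lt_top.ne)) h1
  rw [ENNReal.toReal_mul, ENNReal.toReal_mul, ENNReal.toReal_inv, ENNReal.toReal_ofReal hv.le,
    ENNReal.toReal_ofReal (by positivity), finrank_euclideanSpace_fin, mul_pow] at h2
  refine h2.trans (le_of_eq ?_)
  have h3 := L.effRadius_pow hn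
  rw [Measure.real] at h3
  rw [mul_assoc (t ^ n), h3]
  field_simp

/-- Markov's inequality for ‖z‖²: for t < 1 the mass within t times the effective radius is
negligible in high dimension. -/
lemma le_mul_secondMoment (hn : 0 < n) {t : ℝ} (ht : 0 ≤ t) :
    t ^ 2 * L.effRadius ^ 2 * (1 - t ^ n) ≤ n * L.secondMoment := by
  have hr := L.effRadius_pos
  rw [L.mul_secondMoment hn]
  have h1 := mul_meas_ge_le_integral_of_nonneg (ae_of_all _ fun z => by positivity)
    L.integrable_norm_sq_unif ((t * L.effRadius) ^ 2)
  refine le_trans ?_ h1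
  rw [← mul_pow]
  refine mul_le_mul_of_nonneg_left ?_ (by positivity)
  have h2 : (Metric.ball (0 : EuclideanSpace ℝ (Fin n)) (t * L.effRadius))ᶜ ⊆
      {z | (t * L.effRadius) ^ 2 ≤ ‖z‖ ^ 2} := by
    intro z hz
    rw [Set.mem_compl_iff, mem_ball_zero_iff, not_lt] at hz
    have : 0 ≤ t * L.effRadius := by positivity
    exact pow_le_pow_left₀ this hz 2
  refine le_trans ?_ (measureReal_mono h2)
  rw [probReal_compl_eq_one_sub Metric.isOpen_ball.measurableSet]
  linarith [L.unif_real_ball_le hn ht]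

/-- The constant in the Gaussian domination of the uniform distribution. -/
lemma gaussian_constant_le (hn : 0 < n) {θ : ℝ} (h0 : 0 < θ) (h1 : θ < 1) :
    (2 * Real.pi * Real.exp 1 * (L.covRadius ^ 2 / n)) ^ ((n : ℝ) / 2) / L.vol ≤
      (L.covRadius / L.effRadius) ^ n * ((1 - θ)⁻¹ ^ ((n : ℝ) / 2) / θ) := by
  have hn' : (0 : ℝ) < n := by exact_mod_cast hn
  have h2 : 0 < 1 - θ := by linarith
  have hr := L.effRadius_pos
  have hR := L.covRadius_nonneg
  have : Nonempty (Fin n) := ⟨⟨0, hn⟩⟩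
  have hω : volume.real (Metric.ball (0 : EuclideanSpace ℝ (Fin n)) 1) =
      Real.pi ^ ((n : ℝ) / 2) / Real.Gamma (n / 2 + 1) := by
    rw [Measure.real, EuclideanSpace.volume_ball]
    have hG : 0 < Real.Gamma ((n : ℝ) / 2 + 1) := Real.Gamma_pos_of_pos (by positivity)
    simp only [ENNReal.ofReal_one, one_pow, one_mul, Fintype.card_fin]
    rw [ENNReal.toReal_ofReal (by positivity), Real.sqrt_eq_rpow, ← Real.rpow_natCast,
      ← Real.rpow_mul Real.pi_pos.le]
    congr 2
    ring
  have hG : 0 < Real.Gamma ((n : ℝ) / 2 + 1) := Real.Gamma_pos_of_pos (by positivity)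
  rw [← L.effRadius_pow hn, hω]
  have e1 : (2 * Real.pi * Real.exp 1 * (L.covRadius ^ 2 / n)) ^ ((n : ℝ) / 2) =
      Real.pi ^ ((n : ℝ) / 2) * (Real.exp 1 / (n / 2)) ^ ((n : ℝ) / 2) * L.covRadius ^ n := by
    rw [← Real.mul_rpow (by positivity) (by positivity)]
    have : L.covRadius ^ n = (L.covRadius ^ 2) ^ ((n : ℝ) / 2) := by
      rw [← Real.rpow_natCast, ← Real.rpow_natCast, ← Real.rpow_mul hR]
      congr 1
      push_cast
      ring
    rw [this, ← Real.mul_rpow (by positivity) (by positivity)]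
    congr 1
    field_simp
  have e2 : ((n : ℝ) / 2 / (Real.exp 1 * (1 - θ))) ^ ((n : ℝ) / 2) =
      ((Real.exp 1 / (n / 2)) ^ ((n : ℝ) / 2))⁻¹ * (1 - θ)⁻¹ ^ ((n : ℝ) / 2) := by
    rw [← Real.inv_rpow (by positivity), ← Real.mul_rpow (by positivity) (by positivity)]
    congr 1
    field_simp
  -- The volume of the unit ball contains 1/Γ(n/2 + 1); Stirling cancels the powers of e and n,
  -- leaving only the ratio of the radii to be controlled.
  have hΓ := Gamma_add_one_le (x := (n : ℝ) / 2) (by positivity) h0 h1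
  rw [e2] at hΓ
  rw [e1]
  have hp1 : 0 < Real.pi ^ ((n : ℝ) / 2) := by positivity
  have hp2 : 0 < (Real.exp 1 / ((n : ℝ) / 2)) ^ ((n : ℝ) / 2) := by positivity
  calc _ = (L.covRadius / L.effRadius) ^ n * ((Real.exp 1 / ((n : ℝ) / 2)) ^ ((n : ℝ) / 2) *
        Real.Gamma ((n : ℝ) / 2 + 1)) := by
        rw [div_pow]
        field_simp
    _ ≤ (L.covRadius / L.effRadius) ^ n * ((Real.exp 1 / ((n : ℝ) / 2)) ^ ((n : ℝ) / 2) *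
        (((Real.exp 1 / (n / 2)) ^ ((n : ℝ) / 2))⁻¹ * (1 - θ)⁻¹ ^ ((n : ℝ) / 2) / θ)) := by
        gcongr
    _ = _ := by field_simp

end QLattice

/-- The argument is below 4πe, so the last branch applies and equals (t - log(1 + t))/2. -/
lemma poltyrevExponent_pos {t : ℝ} (h0 : 0 < t) (h1 : t < 1) :
    0 < poltyrevExponent (2 * Real.pi * Real.exp 1 * (1 + t)) := by
  have hp : 0 < Real.pi * Real.exp 1 := by positivity
  rw [poltyrevExponent, if_neg (by nlinarith), if_neg (by nlinarith)]
  have e1 : 2 * Real.pi * Real.exp 1 * (1 + t) / (4 * Real.pi * Real.exp 1) = (1 + t) / 2 := by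
    field_simp
    ring
  have e2 : 2 * Real.pi * Real.exp 1 * (1 + t) / (2 * Real.pi) = Real.exp 1 * (1 + t) := by
    field_simp
  rw [e1, e2, Real.log_mul (by positivity) (by positivity), Real.log_exp]
  have := Real.log_lt_sub_one_of_pos (x := 1 + t) (by positivity) (by linarith)
  linarith

/-! ### Asymptotics of good lattices -/

section Asymptotics

variable {L L' : ∀ n, QLattice n}

lemma eventually_covRadius_pos (hL : GoodForCovering L) :
    ∀ᶠ n : ℕ in atTop, 0 < (L n).covRadius := by
  filter_upwards [hL.eventually (lt_mem_nhds one_pos)] with n hn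
  exact (div_pos_iff_of_pos_right (L n).effRadius_pos).1 hn

/-- For lattices good for covering, the second moment is asymptotically that of a ball. -/
lemma eventually_secondMoment_ge (hL : GoodForCovering L) {ε : ℝ} (hε : 0 < ε) (hε1 : ε ≤ 1) :
    ∀ᶠ n : ℕ in atTop, (1 - ε) * ((L n).covRadius ^ 2 / n) ≤ (L n).secondMoment := by
  -- Chosen so that t² = 1 - ε + ε²/4 exceeds 1 - ε.
  set t : ℝ := 1 - ε / 2 with ht
  have ht0 : 0 ≤ t := by linarith
  have ht1 : t < 1 := by linarith
  have hlim : Tendsto (fun n : ℕ => t ^ 2 * (1 - t ^ n) *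
      (((L n).covRadius / (L n).effRadius)⁻¹) ^ 2) atTop (𝓝 (t ^ 2 * (1 - 0) * (1⁻¹) ^ 2)) :=
    ((tendsto_const_nhds.mul (tendsto_const_nhds.sub
      (tendsto_pow_atTop_nhds_zero_of_lt_one ht0 ht1))).mul
      ((hL.inv₀ one_ne_zero).pow 2))
  have hlt : 1 - ε < t ^ 2 * (1 - 0) * (1⁻¹) ^ 2 := by
    rw [ht]; nlinarith
  filter_upwards [hlim.eventually (lt_mem_nhds hlt), eventually_covRadius_pos hL,
    eventually_gt_atTop 0] with n h1 h2 hn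
  have hn' : (0 : ℝ) < n := by exact_mod_cast hn
  have h3 := (L n).le_mul_secondMoment hn ht0
  have hr := (L n).effRadius_pos
  rw [mul_div_assoc', div_le_iff₀ hn', mul_comm (L n).secondMoment]
  refine le_trans ?_ h3
  calc (1 - ε) * (L n).covRadius ^ 2
      ≤ t ^ 2 * (1 - t ^ n) * (((L n).covRadius / (L n).effRadius)⁻¹) ^ 2 *
        (L n).covRadius ^ 2 := by gcongr
    _ = _ := by field_simp

lemma eventually_gaussian_constant_le (hL : GoodForCovering L) {ε : ℝ} (hε : 0 < ε) :
    ∀ᶠ n : ℕ in atTop, (2 * Real.pi * Real.exp 1 * ((L n).covRadius ^ 2 / n)) ^ ((n : ℝ) / 2) /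
      (L n).vol ≤ Real.exp (n * ε) := by
  -- With this θ the factor (1 - θ)^(-n/2) equals exp(nε/4). The power of the radius ratio and 1/θ
  -- are eventually bounded by the same quantity, so the total is exp(3nε/4).
  set θ : ℝ := 1 - Real.exp (-ε / 2) with hθ
  have h1 : θ < 1 := by have := Real.exp_pos (-ε / 2); linarith
  have h0 : 0 < θ := by
    have : Real.exp (-ε / 2) < 1 := Real.exp_zero ▸ Real.exp_lt_exp.2 (by linarith)
    linarith
  have hlog : Tendsto (fun n : ℕ => Real.log ((L n).covRadius / (L n).effRadius)) atTop (𝓝 0) := by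
    have := ((Real.continuousAt_log one_ne_zero).tendsto).comp hL
    rwa [Real.log_one] at this
  have hdiv : Tendsto (fun n : ℕ => -Real.log θ / n) atTop (𝓝 0) :=
    tendsto_const_div_atTop_nhds_zero_nat _
  filter_upwards [hlog.eventually (gt_mem_nhds (show (0 : ℝ) < ε / 4 by positivity)),
    hdiv.eventually (gt_mem_nhds (show (0 : ℝ) < ε / 4 by positivity)),
    eventually_covRadius_pos hL, eventually_gt_atTop 0] with n h2 h3 h4 hn
  have hn' : (0 : ℝ) < n := by exact_mod_cast hn
  refine ((L n).gaussian_constant_le hn h0 h1).trans ?_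
  have hκ : 0 < (L n).covRadius / (L n).effRadius := div_pos h4 (L n).effRadius_pos
  have e1 : (1 - θ)⁻¹ ^ ((n : ℝ) / 2) = Real.exp (n * (ε / 4)) := by
    rw [hθ, sub_sub_cancel, ← Real.exp_neg, ← Real.exp_mul]
    congr 1
    ring
  have e2 : ((L n).covRadius / (L n).effRadius) ^ n ≤ Real.exp (n * (ε / 4)) := by
    rw [← Real.exp_log hκ, ← Real.exp_nat_mul]
    exact Real.exp_le_exp.2 (by gcongr)
  have e3 : θ⁻¹ ≤ Real.exp (n * (ε / 4)) := by
    rw [← Real.exp_log (inv_pos.2 h0), Real.log_inv]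
    rw [div_lt_iff₀ hn'] at h3
    exact Real.exp_le_exp.2 (by linarith)
  rw [e1, div_eq_mul_inv _ θ]
  calc _ ≤ Real.exp (n * (ε / 4)) * (Real.exp (n * (ε / 4)) * Real.exp (n * (ε / 4))) := by gcongr
    _ = Real.exp (n * (ε / 4) + (n * (ε / 4) + n * (ε / 4))) := by rw [Real.exp_add, Real.exp_add]
    _ ≤ _ := Real.exp_le_exp.2 (by nlinarith)

/-- The rate constraint keeps the normalized covering radius away from zero. -/
lemma exists_eventually_covRadius_ge (hL : GoodForCovering L) {δ₀ R : ℝ} (hδ₀ : 0 < δ₀)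
    (hrate : Tendsto (fun n : ℕ => 1 / (n : ℝ) * Real.logb 2 ((L' n).vol / (L n).vol)) atTop (𝓝 R))
    (hvol : ∀ n : ℕ, 0 < n → (L' n).vol ^ (2 / (n : ℝ)) / (2 * Real.pi * Real.exp 1) =
      (1 + (L n).secondMoment) * (1 + δ₀)) :
    ∃ q : ℝ, 0 < q ∧ ∀ᶠ n : ℕ in atTop, q ≤ (L n).covRadius ^ 2 / n := by
  -- From 2πe ≤ vol(Λ')^(2/n) ≤ vol(Λ)^(2/n) 2^(2(R+1)) ≤ 2πe s 2^(2(R+1)): the volume constraint,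
  -- the rate eventually below R + 1, and the mass comparison.
  refine ⟨((2 : ℝ) ^ (2 * (R + 1)))⁻¹, by positivity, ?_⟩
  filter_upwards [hrate.eventually (gt_mem_nhds (lt_add_one R)), eventually_covRadius_pos hL,
    eventually_gt_atTop 0] with n h1 h2 hn
  have hn' : (0 : ℝ) < n := by exact_mod_cast hn
  have hv := (L n).vol_pos
  have hv' := (L' n).vol_pos
  have hs : 0 < (L n).covRadius ^ 2 / n := by positivity
  have hσ : 0 ≤ (L n).secondMoment := by
    have := (L n).mul_secondMoment hn
    have h3 : 0 ≤ ∫ z, ‖z‖ ^ 2 ∂(L n).unif := integral_nonneg fun z => by positivity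
    rw [← this] at h3
    exact nonneg_of_mul_nonneg_right h3 hn'
  have hcov : (L n).closedCell ⊆ Metric.closedBall 0 √(n * (NNReal.mk _ hs.le : NNReal)) := by
    refine (L n).closedCell_subset_closedBall.trans (Metric.closedBall_subset_closedBall ?_)
    rw [NNReal.coe_mk, mul_div_cancel₀ _ hn'.ne', Real.sqrt_sq h2.le]
  have hC := (L n).one_le_gaussian_constant (s := NNReal.mk _ hs.le) hs hcov
  rw [NNReal.coe_mk, one_le_div hv] at hC
  have hvs : (L n).vol ^ (2 / (n : ℝ)) ≤ 2 * Real.pi * Real.exp 1 * ((L n).covRadius ^ 2 / n) := by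
    have h := Real.rpow_le_rpow hv.le hC (show (0 : ℝ) ≤ 2 / n by positivity)
    rwa [← Real.rpow_mul (by positivity), show (n : ℝ) / 2 * (2 / n) = 1 by field_simp,
      Real.rpow_one] at h
  have hr : (L' n).vol ≤ (L n).vol * 2 ^ (n * (R + 1)) := by
    have h3 : Real.logb 2 ((L' n).vol / (L n).vol) ≤ n * (R + 1) := by
      rw [one_div, inv_mul_lt_iff₀ hn'] at h1
      exact h1.le
    rw [Real.logb_le_iff_le_rpow one_lt_two (by positivity), div_le_iff₀ hv] at h3
    linarith
  have hr' : (L' n).vol ^ (2 / (n : ℝ)) ≤ (L n).vol ^ (2 / (n : ℝ)) * 2 ^ (2 * (R + 1)) := by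
    have h := Real.rpow_le_rpow hv'.le hr (show (0 : ℝ) ≤ 2 / n by positivity)
    rwa [Real.mul_rpow hv.le (by positivity), ← Real.rpow_mul (by positivity),
      show (n : ℝ) * (R + 1) * (2 / n) = 2 * (R + 1) by field_simp] at h
  have hge : 2 * Real.pi * Real.exp 1 ≤ (L' n).vol ^ (2 / (n : ℝ)) := by
    have h := hvol n hn
    rw [div_eq_iff (by positivity)] at h
    rw [h]
    have : 1 ≤ (1 + (L n).secondMoment) * (1 + δ₀) := by nlinarith
    exact le_mul_of_one_le_left (by positivity) this
  have hfin : 2 * Real.pi * Real.exp 1 * 1 ≤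
      2 * Real.pi * Real.exp 1 * (((L n).covRadius ^ 2 / n) * 2 ^ (2 * (R + 1))) := by
    calc _ ≤ (L n).vol ^ (2 / (n : ℝ)) * 2 ^ (2 * (R + 1)) := by linarith
      _ ≤ 2 * Real.pi * Real.exp 1 * ((L n).covRadius ^ 2 / n) * 2 ^ (2 * (R + 1)) := by gcongr
      _ = _ := by ring
  have := le_of_mul_le_mul_left hfin (by positivity)
  rwa [inv_le_iff_one_le_mul₀ (by positivity)]

/-- For lattices good for channel coding, the probability that white noise, of slightly smaller
variance than the critical one, leaves the open Voronoi cell decays exponentially. -/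
lemma GoodForAWGN.exists_eventually_le (hL' : GoodForAWGN L') {t : ℝ} (h0 : 0 < t) (h1 : t < 1) :
    ∃ E, 0 < E ∧ ∀ᶠ n : ℕ in atTop, ∀ v : NNReal,
      (v : ℝ) * (2 * Real.pi * Real.exp 1 * (1 + t)) < (L' n).vol ^ (2 / (n : ℝ)) →
        (whiteGaussian n v).real (L' n).openCellᶜ ≤ Real.exp (-(n * E)) := by
  set m : ℝ := 2 * Real.pi * Real.exp 1 * (1 + t) with hm
  have hm0 : 0 < m := by positivity
  have hE := poltyrevExponent_pos h0 h1
  obtain ⟨o, ho, hbound⟩ := hL' m (by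
    rw [hm]; exact le_mul_of_one_le_right (by positivity) (by linarith))
  refine ⟨poltyrevExponent m / 2, by positivity, ?_⟩
  filter_upwards [ho.eventually (gt_mem_nhds (half_pos hE)), eventually_gt_atTop 0] with n hon hn v hv
  have hn' : (0 : ℝ) < n := by exact_mod_cast hn
  have hvol : 0 < (L' n).vol ^ (2 / (n : ℝ)) := Real.rpow_pos_of_pos (L' n).vol_pos _
  -- The variance at which the volume-to-noise ratio is exactly m. A single exponent then serves
  -- every v < s, since the factor √v/√s < 1 carries the Voronoi region into the open cell.
  set s : ℝ := (L' n).vol ^ (2 / (n : ℝ)) / m with hs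
  have hs0 : 0 < s := by positivity
  have hvs : (v : ℝ) < s := by rwa [hs, lt_div_iff₀ hm0]
  have hb := hbound n hn s hs0 (by rw [hs]; field_simp)
  have hlaw : whiteGaussian n v = (stdGaussian (EuclideanSpace ℝ (Fin n))).map
      (fun x => √(v : ℝ) • x) := by
    rw [stdGaussian_eq_whiteGaussian, whiteGaussian_map_smul 1 v _ (by simp)]
  rw [hlaw, map_measureReal_apply (by fun_prop) (L' n).measurableSet_openCell.compl]
  refine (measureReal_mono fun z hz => ?_).trans (hb.trans (Real.exp_le_exp.2 ?_))
  · intro hz'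
    refine hz ?_
    have h := (L' n).smul_mem_openCell ((L' n).voronoi_subset_closedCell hz')
      (t := √(v : ℝ) / √s) (by positivity)
      ((div_lt_one (by positivity)).2 (Real.sqrt_lt_sqrt v.2 hvs))
    rwa [smul_smul, div_mul_cancel₀ _ (by positivity)] at h
  · have : poltyrevExponent m / 2 ≤ poltyrevExponent m - o n := by linarith
    nlinarith

/-- The elementary estimate behind the asymptotic entropy bound. -/
lemma log_bound_of_close {n a s σ p q η M ε δ : ℝ} (hn : 0 < n) (ha0 : 0 ≤ a) (ha1 : a ≤ 1)
    (hq : 0 < q) (hqs : q ≤ s) (hσ : 0 < σ) (hσs : σ ≤ s) (hε0 : 0 ≤ ε) (hε : ε ≤ 1 / 2)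
    (hε' : ε ≤ δ / 6) (hσε : (1 - ε) * s ≤ σ) (hη : 0 < η) (hηM : η * M ≤ δ / 4 * q)
    (hp0 : 0 ≤ p) (hn1 : 1 ≤ n)
    (hp : p * (1 / q + 3 + 1 / (4 * η) / q) ≤ δ / 4) :
    n * (1 / 2 * Real.log (1 + a / σ) - δ) ≤
      n / 2 * (Real.log (1 + a / s) - 1) + n * (a + σ) / (2 * (a + s)) -
        p * (|n / 2 * (Real.log (1 + a / s) - 1)| + 1 + n + n / (4 * η) / s) - n * η * M / s := by
  have hs : 0 < s := hq.trans_le hqs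
  have hlogs : 0 ≤ Real.log (1 + a / s) := Real.log_nonneg (by linarith [div_nonneg ha0 hs.le])
  have hlogs' : Real.log (1 + a / s) ≤ 1 / q := by
    have h1 : a / s ≤ 1 / q := div_le_div₀ zero_le_one ha1 hq hqs
    have := Real.log_le_sub_one_of_pos (x := 1 + a / s) (by positivity)
    linarith
  -- Replacing s by σ in the logarithm costs at most log(s/σ) ≤ 2ε. Per dimension this loses ε, the
  -- quadratic term loses ε/2, and ε ≤ δ/6; overload and fourth moments lose δ/4 each.
  have h1 : Real.log (1 + a / σ) ≤ Real.log (1 + a / s) + 2 * ε := by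
    have h2 : 1 + a / σ ≤ (1 + a / s) * (s / σ) := by
      have : (1 + a / s) * (s / σ) = s / σ + a / σ := by field_simp
      rw [this]
      have : 1 ≤ s / σ := (one_le_div hσ).2 hσs
      linarith
    have h3 := Real.log_le_log (by positivity) h2
    rw [Real.log_mul (by positivity) (by positivity)] at h3
    have h4 := Real.log_le_sub_one_of_pos (x := s / σ) (by positivity)
    have h5 : s / σ ≤ 1 + 2 * ε := by
      rw [div_le_iff₀ hσ]
      nlinarith [mul_nonneg hε0 hs.le]
    linarith
  have h2 : 1 - ε ≤ (a + σ) / (a + s) := by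
    rw [le_div_iff₀ (by positivity)]
    nlinarith [mul_nonneg hε0 ha0]
  have h3 : |n / 2 * (Real.log (1 + a / s) - 1)| ≤ n * (1 / q + 1) := by
    rw [abs_mul, abs_of_pos (by positivity : 0 < n / 2)]
    have : |Real.log (1 + a / s) - 1| ≤ 1 / q + 1 :=
      abs_le.2 ⟨by linarith [one_div_pos.2 hq], by linarith⟩
    nlinarith [abs_nonneg (Real.log (1 + a / s) - 1)]
  have h4 : n / (4 * η) / s ≤ n * (1 / (4 * η) / q) := by
    rw [show n * (1 / (4 * η) / q) = n / (4 * η) / q by ring]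
    gcongr
  have h5 : p * (|n / 2 * (Real.log (1 + a / s) - 1)| + 1 + n + n / (4 * η) / s) ≤ n * (δ / 4) := by
    calc _ ≤ p * (n * (1 / q + 1) + n + n + n * (1 / (4 * η) / q)) := by gcongr
      _ = n * (p * (1 / q + 3 + 1 / (4 * η) / q)) := by ring
      _ ≤ _ := by gcongr
  have h6 : n * η * M / s ≤ n * (δ / 4) := by
    rw [div_le_iff₀ hs]
    have : η * M ≤ δ / 4 * s := by nlinarith
    nlinarith
  have h7 : n * (a + σ) / (2 * (a + s)) = n / 2 * ((a + σ) / (a + s)) := by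
    field_simp
  rw [h7]
  nlinarith

/-- The overload noise has variance 1 + s, while the volume constraint speaks of 1 + σ; part of the
slack δ₀ pays for the difference. -/
lemma noise_variance_lt {s σ t δ₀ ε : ℝ} (ht : 0 < t) (htδ : t < δ₀) (hs : 0 ≤ s) (hε0 : 0 ≤ ε)
    (hε : ε ≤ (δ₀ - t) / (2 * (1 + δ₀))) (hσ : (1 - ε) * s ≤ σ) :
    (1 + s) * (1 + t) < (1 + σ) * (1 + δ₀) := by
  have hδ : 0 < 1 + δ₀ := by linarith
  rw [le_div_iff₀ (by positivity)] at hε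
  have h1 : (1 + s) * (1 - ε) ≤ 1 + σ := by linarith
  have h2 : 1 + t < (1 - ε) * (1 + δ₀) := by linarith
  calc (1 + s) * (1 + t) < (1 + s) * ((1 - ε) * (1 + δ₀)) := by gcongr
    _ = (1 + s) * (1 - ε) * (1 + δ₀) := by ring
    _ ≤ _ := by gcongr

/-- The conditional entropy of one quantized source given its mean and the dither. -/
theorem eventually_le_lintegral_natEntropy (hL : GoodForCovering L) (hL' : GoodForAWGN L')
    {δ₀ R : ℝ} (hδ₀ : 0 < δ₀)
    (hrate : Tendsto (fun n : ℕ => 1 / (n : ℝ) * Real.logb 2 ((L' n).vol / (L n).vol)) atTop (𝓝 R))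
    (hvol : ∀ n : ℕ, 0 < n → (L' n).vol ^ (2 / (n : ℝ)) / (2 * Real.pi * Real.exp 1) =
      (1 + (L n).secondMoment) * (1 + δ₀))
    {c : ℝ} {a : NNReal} (hc : c ^ 2 + a = 1) {δ : ℝ} (hδ : 0 < δ) :
    ∀ᶠ n : ℕ in atTop, ∀ M M' : QLattice n, M.Λ = (L n).Λ → M'.Λ = (L' n).Λ → Measurable M.Q →
      Measurable M'.Q →
      ENNReal.ofReal (n * (1 / 2 * Real.log (1 + a / (L n).secondMoment) - δ)) ≤
        ∫⁻ d, ∫⁻ ξ, natEntropy ((whiteGaussian n a).map fun w => quantize M M' (c • ξ + w) d)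
          ∂(whiteGaussian n 1) ∂(L n).unif := by
  have ha1 : (a : ℝ) ≤ 1 := by nlinarith [sq_nonneg c]
  obtain ⟨q, hq, hqs⟩ := exists_eventually_covRadius_ge hL hδ₀ hrate hvol
  -- Having t < δ₀ leaves room below the critical variance, and t < 1 keeps the exponent in its
  -- lowest branch.
  set t : ℝ := min δ₀ 1 / 2 with ht
  have hmin : 0 < min δ₀ 1 := lt_min hδ₀ one_pos
  have ht0 : 0 < t := by positivity
  have ht1 : t < 1 := by have := min_le_right δ₀ 1; linarith
  have htδ : t < δ₀ := by have := min_le_left δ₀ 1; linarith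
  obtain ⟨E, hE, hawgn⟩ := hL'.exists_eventually_le ht0 ht1
  -- tolerance for the ratio of the second moment to the squared covering radius
  set ε : ℝ := min (min (1 / 2) (δ / 6)) ((δ₀ - t) / (2 * (1 + δ₀))) with hε
  have hε0 : 0 < ε := lt_min (lt_min (by norm_num) (by positivity))
    (div_pos (by linarith) (by positivity))
  have hε1 : ε ≤ 1 / 2 := (min_le_left _ _).trans (min_le_left _ _)
  have hε2 : ε ≤ δ / 6 := (min_le_left _ _).trans (min_le_right _ _)
  have hε3 : ε ≤ (δ₀ - t) / (2 * (1 + δ₀)) := min_le_right _ _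
  -- Small enough for the fourth-moment loss; the 1 avoids proving that the fourth moment is
  -- nonzero.
  set η : ℝ := δ / 4 * q / (fourthMoment + 1) with hη
  have hM0 := fourthMoment_nonneg
  have hη0 : 0 < η := by positivity
  have hηM : η * fourthMoment ≤ δ / 4 * q := by
    rw [hη, div_mul_eq_mul_div, div_le_iff₀ (by positivity)]
    have : 0 ≤ δ / 4 * q := by positivity
    nlinarith
  have hdecay : Tendsto (fun n : ℕ => Real.exp (-(n * (E / 2))) *
      (1 / q + 3 + 1 / (4 * η) / q)) atTop (𝓝 (0 * (1 / q + 3 + 1 / (4 * η) / q))) := by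
    refine Tendsto.mul_const _ ?_
    refine Real.tendsto_exp_atBot.comp (tendsto_neg_atTop_atBot.comp ?_)
    exact tendsto_natCast_atTop_atTop.atTop_mul_const (half_pos hE)
  rw [zero_mul] at hdecay
  filter_upwards [hqs, hawgn, eventually_secondMoment_ge hL hε0 (hε1.trans (by norm_num)),
    eventually_gaussian_constant_le hL (half_pos hE), eventually_covRadius_pos hL,
    eventually_gt_atTop 0, hdecay.eventually (ge_mem_nhds (show (0 : ℝ) < δ / 4 by positivity))]
    with n hqn hawgnn hσge hCn hRpos hn hdec M M' hM hM' hMQ hMQ'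
  have hn' : (0 : ℝ) < n := by exact_mod_cast hn
  have hs0 : 0 < (L n).covRadius ^ 2 / n := by positivity
  set s : NNReal := NNReal.mk _ hs0.le with hs
  have hsc : (s : ℝ) = (L n).covRadius ^ 2 / n := rfl
  have hspos : 0 < s := hs0
  rw [← hsc] at hqn hσge hCn hs0
  have hσ0 : 0 < (L n).secondMoment := lt_of_lt_of_le (by nlinarith) hσge
  have hσs : (L n).secondMoment ≤ s := by
    rw [hsc, le_div_iff₀ hn', mul_comm]
    exact (L n).mul_secondMoment_le hn
  -- Cells, volume, second moment and uniform law depend on the lattice only, so they transfer to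
  -- the measurable quantizers.
  have hMc : M.closedCell = (L n).closedCell := by unfold QLattice.closedCell; rw [hM]
  have hMo : M.openCell = (L n).openCell := by unfold QLattice.openCell; rw [hM]
  have hMo' : M'.openCell = (L' n).openCell := by unfold QLattice.openCell; rw [hM']
  have hae : M.voronoi =ᵐ[volume] (L n).voronoi :=
    M.voronoi_ae_eq_openCell.trans (hMo ▸ (L n).voronoi_ae_eq_openCell.symm)
  have hMv : M.vol = (L n).vol := measureReal_congr hae
  have hMσ : M.secondMoment = (L n).secondMoment := by
    unfold QLattice.secondMoment
    rw [hMv, setIntegral_congr_set hae]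
  have hMu : M.unif = (L n).unif := by rw [M.unif_eq, (L n).unif_eq, hMv, hMo]
  have hcov : M.closedCell ⊆ Metric.closedBall 0 √(n * s) := by
    rw [hMc, hsc, mul_div_cancel₀ _ hn'.ne', Real.sqrt_sq hRpos.le]
    exact (L n).closedCell_subset_closedBall
  have hov : (QLattice.noiseLaw M a).real (M'.overload c) ≤ Real.exp (-(n * (E / 2))) := by
    refine (QLattice.measureReal_overload_le hspos hcov hc).trans ?_
    rw [hMv, hMo']
    have hsmall : ((1 + s : NNReal) : ℝ) * (2 * Real.pi * Real.exp 1 * (1 + t)) <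
        (L' n).vol ^ (2 / (n : ℝ)) := by
      have hv := hvol n hn
      rw [div_eq_iff (by positivity)] at hv
      rw [hv, NNReal.coe_add, NNReal.coe_one]
      have key := noise_variance_lt ht0 htδ s.2 hε0.le hε3 hσge
      calc (1 + (s : ℝ)) * (2 * Real.pi * Real.exp 1 * (1 + t))
          = (1 + (s : ℝ)) * (1 + t) * (2 * Real.pi * Real.exp 1) := by ring
        _ < _ := mul_lt_mul_of_pos_right key (by positivity)
    -- Gaussian domination spends half of the exponent E.
    calc _ ≤ Real.exp (n * (E / 2)) * Real.exp (-(n * E)) := by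
          gcongr
          exact hawgnn _ hsmall
      _ = Real.exp (-(n * (E / 2))) := by rw [← Real.exp_add]; congr 1; ring
  rw [← hMu]
  refine le_trans (ENNReal.ofReal_le_ofReal ?_)
    (QLattice.ofReal_integral_infoDensity_noise_le hMQ hMQ' hspos hcov c)
  refine le_trans ?_ (QLattice.integral_infoDensity_ge hn hspos ha1 hcov c hη0)
  rw [hMσ]
  refine log_bound_of_close hn' a.2 ha1 hq hqn hσ0 hσs hε0.le hε1 hε2 hσge hη0 hηM
    measureReal_nonneg (by exact_mod_cast hn) (le_trans ?_ hdec)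
  gcongr

end Asymptotics

/-! ### Separation in rooted trees -/

section TreeSeparation

variable {V : Type*} {T : SimpleGraph V} {r : V}

lemma dist_add_dist_le_of_mem_support {x y : V} (p : T.Walk r x) (hp : p.length = T.dist r x)
    (hy : y ∈ p.support) : T.dist r y + T.dist y x ≤ T.dist r x := by
  classical
  have h1 := T.dist_le (p.takeUntil y hy)
  have h2 := T.dist_le (p.dropUntil y hy)
  have h3 := congrArg SimpleGraph.Walk.length (p.take_spec hy)
  rw [SimpleGraph.Walk.length_append] at h3
  omega

lemma IsParent.dist_lt {u v : V} (h : IsParent T r u v) : T.dist r u + 1 ≤ T.dist r v := by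
  obtain ⟨⟨p, hp, hu⟩, h1⟩ := h
  have := dist_add_dist_le_of_mem_support p hp hu
  omega

lemma IsParent.adj {u v : V} (h : IsParent T r u v) : T.Adj u v :=
  SimpleGraph.dist_eq_one_iff_adj.1 h.2

lemma exists_isParent (hT : T.Connected) {u : V} (hu : u ≠ r) : ∃ v, IsParent T r v u := by
  obtain ⟨p, hp⟩ := hT.exists_walk_length_eq_dist r u
  have hnil : ¬ p.Nil := SimpleGraph.Walk.not_nil_of_ne (Ne.symm hu)
  exact ⟨p.penultimate, ⟨p, hp, p.getVert_mem_support _⟩,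
    SimpleGraph.dist_eq_one_iff_adj.2 (p.adj_penultimate hnil)⟩

lemma isParent_parent (hT : T.Connected) {u : V} (hu : u ≠ r) : IsParent T r (parent T r u) u := by
  have h := exists_isParent hT hu
  rw [parent, dif_pos h]
  exact h.choose_spec

/-- In a rooted tree, the parent of `u` separates `u` from all vertices at most as deep as `u`. -/
lemma parent_mem_support (hT : T.IsTree) {u v : V} (hu : u ≠ r) (hvu : v ≠ u)
    (hd : T.dist r v ≤ T.dist r u) (q : T.Walk u v) : parent T r u ∈ q.support := by
  by_contra hq
  have hp := isParent_parent hT.connected hu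
  obtain ⟨w1, hw1⟩ := hT.connected.exists_walk_length_eq_dist r v
  obtain ⟨w2, hw2⟩ := hT.connected.exists_walk_length_eq_dist r (parent T r u)
  have hb := SimpleGraph.isAcyclic_iff_forall_adj_isBridge.1 hT.isAcyclic hp.adj.symm
  rw [SimpleGraph.isBridge_iff_forall_walk_mem_edges] at hb
  -- The edge from u to its parent is a bridge, so it lies on every walk joining its ends, in
  -- particular on the one through v and the root. It is not in q; in either geodesic it would place
  -- u on a path too short to reach its depth.
  have he := hb ((q.append w1.reverse).append w2)
  simp only [SimpleGraph.Walk.edges_append, SimpleGraph.Walk.edges_reverse, List.mem_append,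
    List.mem_reverse] at he
  rcases he with (he | he) | he
  · exact hq (q.snd_mem_support_of_mem_edges he)
  · have h1 := dist_add_dist_le_of_mem_support w1 hw1 (w1.fst_mem_support_of_mem_edges he)
    have h2 := hT.connected.pos_dist_of_ne hvu.symm
    omega
  · have h1 := dist_add_dist_le_of_mem_support w2 hw2 (w2.fst_mem_support_of_mem_edges he)
    have := hp.dist_lt
    omega

end TreeSeparation

/-! ### Innovations of a Gaussian Markov tree source -/

section Innovation

variable {V : Type*} [Fintype V] {T : SimpleGraph V} {P : Measure (V → ℝ)} [IsProbabilityMeasure P]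

lemma IsGaussianMarkovTreeSource.hasGaussianLaw (hP : IsGaussianMarkovTreeSource T P)
    {F : Type*} [NormedAddCommGroup F] [NormedSpace ℝ F] [MeasurableSpace F] [BorelSpace F]
    (f : (V → ℝ) →L[ℝ] F) : HasGaussianLaw f P := by
  have := hP.gaussian
  exact IsGaussian.hasGaussianLaw_id.map f

lemma IsGaussianMarkovTreeSource.memLp_eval (hP : IsGaussianMarkovTreeSource T P) (v : V) :
    MemLp (fun x : V → ℝ => x v) 2 P :=
  (hP.hasGaussianLaw (ContinuousLinearMap.proj v)).memLp_two

lemma IsGaussianMarkovTreeSource.integrable_eval (hP : IsGaussianMarkovTreeSource T P) (v : V) :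
    Integrable (fun x : V → ℝ => x v) P :=
  (hP.memLp_eval v).integrable one_le_two

lemma IsGaussianMarkovTreeSource.integrable_mul (hP : IsGaussianMarkovTreeSource T P) (u v : V) :
    Integrable (fun x : V → ℝ => x u * x v) P :=
  (hP.memLp_eval u).integrable_mul (hP.memLp_eval v)

lemma IsGaussianMarkovTreeSource.memLp_sub (hP : IsGaussianMarkovTreeSource T P) (c : ℝ)
    (u v : V) : MemLp (fun x : V → ℝ => x u - c * x v) 2 P :=
  (hP.memLp_eval u).sub ((hP.memLp_eval v).const_mul c)

lemma IsGaussianMarkovTreeSource.integral_sub (hP : IsGaussianMarkovTreeSource T P) (c : ℝ)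
    (u v : V) : ∫ x, (x u - c * x v) ∂P = 0 := by
  rw [MeasureTheory.integral_sub (hP.integrable_eval u) ((hP.integrable_eval v).const_mul c),
    integral_const_mul, hP.mean_zero, hP.mean_zero]
  simp

lemma IsGaussianMarkovTreeSource.covariance_sub (hP : IsGaussianMarkovTreeSource T P) (c : ℝ)
    (u p v : V) :
    cov[fun x : V → ℝ => x u - c * x p, fun x => x v; P] = corr P u v - c * corr P p v := by
  rw [covariance_eq_sub (hP.memLp_sub c u p) (hP.memLp_eval v), hP.mean_zero v, mul_zero, sub_zero]
  have : ((fun x : V → ℝ => x u - c * x p) * fun x => x v) =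
      fun x => x u * x v - c * (x p * x v) := by
    ext x; simp only [Pi.mul_apply]; ring
  rw [this, MeasureTheory.integral_sub (hP.integrable_mul u v) ((hP.integrable_mul p v).const_mul c),
    integral_const_mul]
  rfl

lemma IsGaussianMarkovTreeSource.corr_self (hP : IsGaussianMarkovTreeSource T P) (v : V) :
    corr P v v = 1 := by
  rw [corr, ← hP.unit_variance v]
  congr 1
  ext x
  ring

lemma IsGaussianMarkovTreeSource.indepFun_sub_eval (hP : IsGaussianMarkovTreeSource T P)
    (u p : V) : IndepFun (fun x : V → ℝ => x u - corr P u p * x p) (fun x => x p) P := by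
  refine HasGaussianLaw.indepFun_of_covariance_eq_zero ?_ ?_
  · exact hP.hasGaussianLaw (((ContinuousLinearMap.proj u : (V → ℝ) →L[ℝ] ℝ) -
      corr P u p • (ContinuousLinearMap.proj p : (V → ℝ) →L[ℝ] ℝ)).prod
        (ContinuousLinearMap.proj p : (V → ℝ) →L[ℝ] ℝ))
  · rw [hP.covariance_sub, hP.corr_self]
    ring

lemma IsGaussianMarkovTreeSource.condExp_eval (hP : IsGaussianMarkovTreeSource T P)
    (u p : V) : P[fun x => x u | MeasurableSpace.comap (fun x : V → ℝ => x p) inferInstance]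
      =ᵐ[P] fun x => corr P u p * x p := by
  have hm := (measurable_pi_apply (X := fun _ : V => ℝ) p).comap_le
  have hpm : StronglyMeasurable[MeasurableSpace.comap (fun x : V → ℝ => x p) inferInstance]
      fun x : V → ℝ => corr P u p * x p :=
    ((comap_measurable (fun x : V → ℝ => x p)).const_mul _).stronglyMeasurable
  have hpi : Integrable (fun x : V → ℝ => corr P u p * x p) P :=
    (hP.integrable_eval p).const_mul _
  have hwi : Integrable (fun x : V → ℝ => x u - corr P u p * x p) P :=
    (hP.integrable_eval u).sub hpi
  have h1 : (fun x : V → ℝ => x u) =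
      (fun x : V → ℝ => x u - corr P u p * x p) + fun x => corr P u p * x p := by
    ext x; simp
  have hw : Measurable fun x : V → ℝ => x u - corr P u p * x p := by fun_prop
  have h2 : P[fun x : V → ℝ => x u - corr P u p * x p |
      MeasurableSpace.comap (fun x : V → ℝ => x p) inferInstance] =ᵐ[P] fun _ => 0 := by
    have := condExp_indep_eq (μ := P) hw.comap_le hm
      (comap_measurable (fun x : V → ℝ => x u - corr P u p * x p)).stronglyMeasurable
      (hP.indepFun_sub_eval u p)
    rwa [hP.integral_sub] at this
  rw [h1]
  refine (condExp_add hwi hpi _).trans ?_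
  rw [condExp_of_stronglyMeasurable hm hpm hpi]
  filter_upwards [h2] with x hx
  simp [hx]

/-- Conditional independence gives E[X_u | X_p, X_v] = E[X_u | X_p], which is ρ_{up} X_p by
Gaussianity. Multiply by X_v and take expectations. -/
lemma IsGaussianMarkovTreeSource.corr_eq_mul_of_condIndepFun
    (hP : IsGaussianMarkovTreeSource T P) {u v p : V}
    (h : CondIndepFun (MeasurableSpace.comap (fun x : V → ℝ => x p) inferInstance)
      (measurable_pi_apply p).comap_le (fun x : V → ℝ => x u) (fun x => x v) P) :
    corr P u v = corr P u p * corr P p v := by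
  have hk : Measurable fun x : V → ℝ => x p := measurable_pi_apply p
  have hkv : Measurable fun x : V → ℝ => (x p, x v) := by fun_prop
  have hui := hP.integrable_eval u
  have h1 := (condIndepFun_iff_condDistrib_prod_ae_eq_prodMkRight (μ := P)
    (measurable_pi_apply u) (measurable_pi_apply v) hk).1 h.symm
  have h2 := condExp_ae_eq_integral_condDistrib (μ := P) hkv (measurable_pi_apply u).aemeasurable
    (f := id) stronglyMeasurable_id hui
  have h3 := condExp_ae_eq_integral_condDistrib (μ := P) hk (measurable_pi_apply u).aemeasurable
    (f := id) stronglyMeasurable_id hui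
  have h4 : P[fun x => x u | MeasurableSpace.comap (fun x : V → ℝ => (x p, x v)) inferInstance]
      =ᵐ[P] fun x => corr P u p * x p := by
    filter_upwards [h2, h3, hP.condExp_eval u p, ae_of_ae_map hkv.aemeasurable h1]
      with x hx2 hx3 hx4 hx1
    simp only [id] at hx2 hx3
    rw [hx2, hx1, Kernel.prodMkRight_apply, ← hx3, hx4]
  have hm := hkv.comap_le
  have hvm : StronglyMeasurable[MeasurableSpace.comap (fun x : V → ℝ => (x p, x v)) inferInstance]
      fun x : V → ℝ => x v :=
    (measurable_snd.comp (comap_measurable (fun x : V → ℝ => (x p, x v)))).stronglyMeasurable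
  have h5 := condExp_mul_of_stronglyMeasurable_right (μ := P) (f := fun x : V → ℝ => x u) hvm
    (hP.integrable_mul u v) hui
  calc corr P u v = ∫ x, ((fun x : V → ℝ => x u) * fun x : V → ℝ => x v) x ∂P := rfl
    _ = ∫ x, (P[(fun x : V → ℝ => x u) * fun x : V → ℝ => x v |
          MeasurableSpace.comap (fun x : V → ℝ => (x p, x v)) inferInstance]) x ∂P :=
        (integral_condExp hm).symm
    _ = ∫ x, corr P u p * (x p * x v) ∂P := by
        refine integral_congr_ae ?_
        filter_upwards [h5, h4] with x hx5 hx4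
        rw [hx5, Pi.mul_apply, hx4, mul_assoc]
    _ = _ := by rw [integral_const_mul]; rfl

/-- The innovation of `X_u` relative to its parent is uncorrelated with all vertices that are at
most as deep as `u`. -/
lemma IsGaussianMarkovTreeSource.corr_eq_mul_parent (hP : IsGaussianMarkovTreeSource T P)
    {r u v : V} (hu : u ≠ r) (hvu : v ≠ u) (hd : T.dist r v ≤ T.dist r u) :
    corr P u v = corr P u (parent T r u) * corr P (parent T r u) v := by
  refine hP.corr_eq_mul_of_condIndepFun ?_
  have h := hP.markov {u} {v} (parent T r u) (by simpa using hvu.symm) (by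
    rintro i rfl j rfl q -
    exact parent_mem_support hP.isTree hu hvu hd q)
  exact h.comp (φ := fun f : (({u} : Set V) → ℝ) => f ⟨u, rfl⟩)
    (ψ := fun f : (({v} : Set V) → ℝ) => f ⟨v, rfl⟩) (by fun_prop) (by fun_prop)

/-- The vertices other than `u` that are at most as deep as `u`. -/
def shallow (T : SimpleGraph V) (r u : V) : Set V := {v | v ≠ u ∧ T.dist r v ≤ T.dist r u}

/-- Jointly Gaussian and uncorrelated. Independence of the whole family at once, not merely of each
vertex, is what the chain rule uses. -/
lemma IsGaussianMarkovTreeSource.indepFun_innovation (hP : IsGaussianMarkovTreeSource T P)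
    {r u : V} (hu : u ≠ r) :
    IndepFun (fun (x : V → ℝ) (v : shallow T r u) => x v)
      (fun x => x u - corr P u (parent T r u) * x (parent T r u)) P := by
  have h : IndepFun (fun (x : V → ℝ) (_ : Unit) =>
      x u - corr P u (parent T r u) * x (parent T r u))
      (fun x (v : shallow T r u) => x v) P := by
    have : Fintype (shallow T r u) := Fintype.ofFinite _
    refine HasGaussianLaw.indepFun_of_covariance_eval ?_ ?_
    · exact hP.hasGaussianLaw ((ContinuousLinearMap.pi fun _ : Unit =>
        (ContinuousLinearMap.proj u : (V → ℝ) →L[ℝ] ℝ) - corr P u (parent T r u) •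
          (ContinuousLinearMap.proj (parent T r u) : (V → ℝ) →L[ℝ] ℝ)).prod
        (ContinuousLinearMap.pi fun v : shallow T r u =>
          (ContinuousLinearMap.proj (v : V) : (V → ℝ) →L[ℝ] ℝ)))
    · rintro - ⟨v, hv⟩
      rw [hP.covariance_sub, hP.corr_eq_mul_parent hu hv.1 hv.2, sub_self]
  exact (h.comp (φ := fun f : Unit → ℝ => f ()) (measurable_pi_apply _) measurable_id).symm

lemma IsGaussianMarkovTreeSource.integral_sq_sub (hP : IsGaussianMarkovTreeSource T P) (u p : V)
    (c : ℝ) : ∫ x, (x u - c * x p) ^ 2 ∂P = 1 - 2 * c * corr P u p + c ^ 2 := by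
  have hsq : ∀ v, Integrable (fun x : V → ℝ => x v ^ 2) P :=
    fun v => (hP.memLp_eval v).integrable_sq
  have hm := (hP.integrable_mul u p).const_mul (2 * c)
  have hd : Integrable (fun x : V → ℝ => x u ^ 2 - 2 * c * (x u * x p)) P := (hsq u).sub hm
  have : ∀ x : V → ℝ, (x u - c * x p) ^ 2 =
      x u ^ 2 - 2 * c * (x u * x p) + c ^ 2 * x p ^ 2 := fun x => by ring
  simp_rw [this]
  rw [integral_add hd ((hsq p).const_mul _), MeasureTheory.integral_sub (hsq u) hm,
    integral_const_mul, integral_const_mul, hP.unit_variance, hP.unit_variance, mul_one]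
  rfl

lemma IsGaussianMarkovTreeSource.map_sub (hP : IsGaussianMarkovTreeSource T P) {u p : V} {c : ℝ}
    {a : NNReal} (ha : 1 - 2 * c * corr P u p + c ^ 2 = a) :
    P.map (fun x => x u - c * x p) = gaussianReal 0 a := by
  have hw := hP.hasGaussianLaw ((ContinuousLinearMap.proj u : (V → ℝ) →L[ℝ] ℝ) -
      c • (ContinuousLinearMap.proj p : (V → ℝ) →L[ℝ] ℝ))
  have h := hw.map_eq_gaussianReal
  change P.map (fun x => x u - c * x p) =
    gaussianReal (∫ x, (x u - c * x p) ∂P) (Var[fun x => x u - c * x p; P]).toNNReal at h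
  rw [h, hP.integral_sub]
  congr 1
  apply NNReal.eq
  rw [Real.coe_toNNReal _ (variance_nonneg _ _), ← ha,
    variance_of_integral_eq_zero (by fun_prop) (hP.integral_sub c u p)]
  exact hP.integral_sq_sub u p c

lemma IsGaussianMarkovTreeSource.map_eval (hP : IsGaussianMarkovTreeSource T P) (v : V) :
    P.map (fun x => x v) = gaussianReal 0 1 := by
  simpa using hP.map_sub (u := v) (p := v) (c := 0) (a := 1) (by simp)

lemma IsGaussianMarkovTreeSource.sq_corr_le_one (hP : IsGaussianMarkovTreeSource T P) (u p : V) :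
    corr P u p ^ 2 ≤ 1 := by
  have h : 0 ≤ ∫ x, (x u - corr P u p * x p) ^ 2 ∂P := integral_nonneg fun x => sq_nonneg _
  rw [hP.integral_sq_sub] at h
  nlinarith

end Innovation

/-! ### Entropy of the outputs for fixed dithers -/

section Chain

lemma map_pi_prodMk_of_indepFun {ι α β γ : Type*} [Fintype ι] [MeasurableSpace α]
    [MeasurableSpace β] [MeasurableSpace γ] {P : Measure α} [IsProbabilityMeasure P]
    {f : α → β} {g : α → γ} (hf : Measurable f) (hg : Measurable g) (h : IndepFun f g P) :
    (Measure.pi fun _ : ι => P).map (fun x => (fun j => f (x j), fun j => g (x j))) =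
      (Measure.pi fun _ : ι => P.map f).prod (Measure.pi fun _ : ι => P.map g) := by
  have := Measure.isProbabilityMeasure_map (μ := P) hf.aemeasurable
  have := Measure.isProbabilityMeasure_map (μ := P) hg.aemeasurable
  have h1 := (measurePreserving_arrowProdEquivProdArrow β γ ι (fun _ => P.map f)
    (fun _ => P.map g)).map_eq
  have h2 := Measure.pi_map_pi (μ := fun _ : ι => P) (f := fun _ x => (f x, g x))
    (fun _ => (hf.prodMk hg).aemeasurable)
  rw [h.map_prod_eq_prod_map_map hf.aemeasurable hg.aemeasurable] at h2
  rw [← h1, ← h2, Measure.map_map (MeasurableEquiv.measurable _) (by fun_prop)]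
  rfl

lemma map_pi_toLp {α : Type*} [MeasurableSpace α] {P : Measure α} [IsProbabilityMeasure P] {n : ℕ}
    {f : α → ℝ} (hf : Measurable f) {a : NNReal} (h : P.map f = gaussianReal 0 a) :
    (Measure.pi fun _ : Fin n => P).map (fun x => WithLp.toLp 2 fun j => f (x j)) =
      whiteGaussian n a := by
  have := Measure.isProbabilityMeasure_map (μ := P) hf.aemeasurable
  rw [whiteGaussian, ← h, ← Measure.pi_map_pi (fun _ => hf.aemeasurable),
    Measure.map_map (by fun_prop) (by fun_prop)]
  rfl

variable {V : Type*} [Fintype V] [DecidableEq V] {T : SimpleGraph V} {P : Measure (V → ℝ)}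
  [IsProbabilityMeasure P] {n : ℕ}

/-- The weight of the parent in the decomposition of a vertex into prediction and innovation. -/
def parentWeight (T : SimpleGraph V) (P : Measure (V → ℝ)) (r u : V) : ℝ :=
  if u = r then 0 else corr P u (parent T r u)

/-- The variance of the innovation of a vertex. -/
def innovationVar (T : SimpleGraph V) (P : Measure (V → ℝ)) (r u : V) : NNReal :=
  (1 - parentWeight T P r u ^ 2).toNNReal

lemma IsGaussianMarkovTreeSource.coe_innovationVar (hP : IsGaussianMarkovTreeSource T P)
    (r u : V) : (innovationVar T P r u : ℝ) = 1 - parentWeight T P r u ^ 2 := by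
  rw [innovationVar, Real.coe_toNNReal]
  unfold parentWeight
  split_ifs
  · norm_num
  · linarith [hP.sq_corr_le_one u (parent T r u)]

/-- The average entropy of a quantized vertex given the block of its parent. -/
def predEntropy (T : SimpleGraph V) (P : Measure (V → ℝ)) (r u : V)
    (q : EuclideanSpace ℝ (Fin n) → EuclideanSpace ℝ (Fin n)) : ℝ≥0∞ :=
  ∫⁻ ξ, natEntropy ((whiteGaussian n (innovationVar T P r u)).map
    fun w => q (parentWeight T P r u • ξ + w)) ∂(whiteGaussian n 1)

lemma IsGaussianMarkovTreeSource.natEntropy_root_le (hP : IsGaussianMarkovTreeSource T P) (r : V)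
    {q : V → EuclideanSpace ℝ (Fin n) → EuclideanSpace ℝ (Fin n)} (hq : ∀ v, Measurable (q v)) :
    predEntropy T P r r (q r) ≤ natEntropy ((Measure.pi fun _ : Fin n => P).map
      fun x (v : ({r} : Finset V)) => q v (WithLp.toLp 2 fun j => x j v)) := by
  have ha : innovationVar T P r r = 1 := by simp [innovationVar, parentWeight]
  have hc : parentWeight T P r r = 0 := by simp [parentWeight]
  rw [predEntropy, ha, hc]
  simp only [zero_smul, zero_add, lintegral_const, measure_univ, mul_one]
  let e : (({r} : Finset V) → EuclideanSpace ℝ (Fin n)) → EuclideanSpace ℝ (Fin n) :=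
    fun y => y ⟨r, Finset.mem_singleton_self r⟩
  have he : Function.Injective e := by
    rintro y z hyz
    ext1 ⟨v, hv⟩
    obtain rfl := Finset.mem_singleton.1 hv
    exact hyz
  rw [← natEntropy_map_injective _ (e := e) (measurable_pi_apply _) he,
    Measure.map_map (measurable_pi_apply _) (by fun_prop), ← map_pi_toLp
    (measurable_pi_apply r) (hP.map_eval r), Measure.map_map (hq r) (by fun_prop)]
  rfl

/-- The erased outputs are functions of the shallow block, and the output of u is a function of that
block and the independent innovation. Conditioning on the full shallow block reveals the parent's
block even if the parent is not in S. -/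
lemma IsGaussianMarkovTreeSource.natEntropy_erase_add_le (hP : IsGaussianMarkovTreeSource T P)
    {r u : V} (hur : u ≠ r) {S : Finset V} (hu : u ∈ S) (hS : ↑(S.erase u) ⊆ shallow T r u)
    {q : V → EuclideanSpace ℝ (Fin n) → EuclideanSpace ℝ (Fin n)} (hq : ∀ v, Measurable (q v))
    (hqc : ∀ v, ∃ A : Set (EuclideanSpace ℝ (Fin n)), A.Countable ∧ ∀ x, q v x ∈ A) :
    natEntropy ((Measure.pi fun _ : Fin n => P).map
        fun x (v : S.erase u) => q v (WithLp.toLp 2 fun j => x j v)) +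
      predEntropy T P r u (q u) ≤ natEntropy ((Measure.pi fun _ : Fin n => P).map
        fun x (v : S) => q v (WithLp.toLp 2 fun j => x j v)) := by
  classical
  choose A hA hqA using hqc
  have hc : parentWeight T P r u = corr P u (parent T r u) := if_neg hur
  have hp : parent T r u ∈ shallow T r u := by
    have := (isParent_parent hP.isTree.connected hur).dist_lt
    exact ⟨fun h => by rw [h] at this; omega, by omega⟩
  set c := parentWeight T P r u
  set p := parent T r u
  let f : (V → ℝ) → (shallow T r u → ℝ) := fun x v => x v
  let g : (V → ℝ) → ℝ := fun x => x u - c * x p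
  have hf : Measurable f := by fun_prop
  have hg : Measurable g := by fun_prop
  have hgl : P.map g = gaussianReal 0 (innovationVar T P r u) := by
    refine hP.map_sub ?_
    rw [hP.coe_innovationVar]
    change _ = 1 - c ^ 2
    rw [hc]
    ring
  have hfg : IndepFun f g P := by
    have := hP.indepFun_innovation hur
    rw [← hc] at this
    exact this
  have := Measure.isProbabilityMeasure_map (μ := P) hf.aemeasurable
  set B := Measure.pi fun _ : Fin n => P
  set B' := Measure.pi fun _ : Fin n => P.map f
  have hpair : B.map (fun x => (fun j => f (x j), WithLp.toLp 2 fun j => g (x j))) =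
      B'.prod (whiteGaussian n (innovationVar T P r u)) := by
    have h := map_pi_prodMk_of_indepFun (ι := Fin n) hf hg hfg
    rw [hgl] at h
    have h2 : B'.prod (whiteGaussian n (innovationVar T P r u)) =
        (B'.prod (Measure.pi fun _ : Fin n => gaussianReal 0 (innovationVar T P r u))).map
          (Prod.map id (WithLp.toLp 2)) := by
      rw [← Measure.map_prod_map _ _ measurable_id (by fun_prop), Measure.map_id]
      rfl
    rw [h2, ← h, Measure.map_map (by fun_prop) (by fun_prop)]
    rfl
  let F : (Fin n → shallow T r u → ℝ) → (S.erase u → EuclideanSpace ℝ (Fin n)) :=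
    fun x v => q v (WithLp.toLp 2 fun j => x j ⟨v, hS v.2⟩)
  let ξ : (Fin n → shallow T r u → ℝ) → EuclideanSpace ℝ (Fin n) :=
    fun x => WithLp.toLp 2 fun j => x j ⟨p, hp⟩
  have hξ : Measurable ξ := by fun_prop
  have hF : Measurable F := by fun_prop
  let G : (Fin n → shallow T r u → ℝ) × EuclideanSpace ℝ (Fin n) → EuclideanSpace ℝ (Fin n) :=
    fun z => q u (c • ξ z.1 + z.2)
  have hG : Measurable G := by fun_prop
  have key := natEntropy_add_lintegral_le B' (whiteGaussian n (innovationVar T P r u)) hF hG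
    (TA := Set.univ.pi fun v : S.erase u => A v) (Set.countable_univ_pi fun v => hA v)
    (fun x v _ => hqA v _) (hA u) (fun z => hqA u _)
  have hB' : B' = B.map (fun x j => f (x j)) := (Measure.pi_map_pi (fun _ => hf.aemeasurable)).symm
  have hξl : B'.map ξ = whiteGaussian n 1 := by
    rw [hB', Measure.map_map hξ (by fun_prop)]
    exact map_pi_toLp (measurable_pi_apply p) (hP.map_eval p)
  let e : (S → EuclideanSpace ℝ (Fin n)) →
      (S.erase u → EuclideanSpace ℝ (Fin n)) × EuclideanSpace ℝ (Fin n) :=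
    fun y => (fun v => y ⟨v, Finset.mem_of_mem_erase v.2⟩, y ⟨u, hu⟩)
  have hem : Measurable e := by fun_prop
  have he : Function.Injective e := by
    intro y z hyz
    ext1 ⟨v, hv⟩
    by_cases hvu : v = u
    · subst hvu
      exact congrArg Prod.snd hyz
    · exact congrFun (congrArg Prod.fst hyz) ⟨v, Finset.mem_erase.2 ⟨hvu, hv⟩⟩
  have hleft : B'.map F = B.map fun x (v : S.erase u) => q v (WithLp.toLp 2 fun j => x j v) := by
    rw [hB', Measure.map_map hF (by fun_prop)]
    rfl
  have hright : (B'.prod (whiteGaussian n (innovationVar T P r u))).map (fun z => (F z.1, G z)) =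
      (B.map fun x (v : S) => q v (WithLp.toLp 2 fun j => x j v)).map e := by
    rw [← hpair, Measure.map_map (by fun_prop) (by fun_prop), Measure.map_map hem (by fun_prop)]
    congr 1
    ext1 x
    refine Prod.ext rfl ?_
    change q u _ = q u _
    congr 1
    ext j
    simp [ξ, f, g]
  rw [hleft, hright, natEntropy_map_injective _ hem he] at key
  refine le_trans (add_le_add_right ?_ _) key
  rw [predEntropy, ← hξl]
  exact lintegral_map_le _ _

/-- The chain rule along the tree: the joint entropy of the quantized vertices is at least the sum
of the entropies given the parents. -/
lemma IsGaussianMarkovTreeSource.sum_predEntropy_le (hP : IsGaussianMarkovTreeSource T P)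
    (r : V) {q : V → EuclideanSpace ℝ (Fin n) → EuclideanSpace ℝ (Fin n)}
    (hq : ∀ v, Measurable (q v))
    (hqc : ∀ v, ∃ A : Set (EuclideanSpace ℝ (Fin n)), A.Countable ∧ ∀ x, q v x ∈ A)
    (S : Finset V) :
    ∑ u ∈ S, predEntropy T P r u (q u) ≤ natEntropy ((Measure.pi fun _ : Fin n => P).map
        fun x (v : S) => q v (WithLp.toLp 2 fun j => x j v)) := by
  induction S using Finset.strongInduction with
  | H S ih =>
    rcases S.eq_empty_or_nonempty with rfl | hne
    · simp
    -- Remove a deepest vertex: all the others are then shallow relative to it. If it is the root,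
    -- nothing else is left.
    obtain ⟨u, hu, hmax⟩ := S.exists_max_image (fun v => T.dist r v) hne
    by_cases hur : u = r
    · subst hur
      have hS : S = {u} := by
        refine Finset.eq_singleton_iff_unique_mem.2 ⟨hu, fun v hv => ?_⟩
        have := hmax v hv
        simp only [SimpleGraph.dist_self, Nat.le_zero] at this
        exact ((hP.isTree.connected.dist_eq_zero_iff).1 this).symm
      subst hS
      simpa using hP.natEntropy_root_le u hq
    · rw [← Finset.sum_erase_add _ _ hu]
      refine le_trans (add_le_add_left (ih _ (Finset.erase_ssubset hu)) _)
        (hP.natEntropy_erase_add_le hur hu (fun v hv => ?_) hq hqc)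
      have hv' := Finset.mem_erase.1 hv
      exact ⟨hv'.1, hmax v hv'.2⟩

end Chain

/-! ### Conditional entropy given independent dithers -/

/-- Independence lets the dither be frozen: d ↦ law of G(d, Z) is a version of the conditional
distribution. -/
lemma condEntropyBits_of_indepFun {Ω S U W : Type*} [MeasurableSpace Ω] [MeasurableSpace S]
    [StandardBorelSpace S] [Nonempty S] [MeasurableSpace U] [MeasurableSpace W]
    {μ : Measure Ω} [IsProbabilityMeasure μ] {D : Ω → U} {Z : Ω → W} {B : Measure W}
    [IsProbabilityMeasure B] (hD : AEMeasurable D μ) (hZ : HasLaw Z B μ) (h : IndepFun D Z μ)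
    {G : U × W → S} (hG : Measurable G) :
    condEntropyBits μ (fun ω => G (D ω, Z ω)) D =
      ∫⁻ d, entropyBits (B.map fun x => G (d, x)) ∂(μ.map D) := by
  have := Measure.isProbabilityMeasure_map hD
  let κ : Kernel U S := (Kernel.id ×ₖ Kernel.const U B).map G
  have hκ : ∀ d, κ d = B.map fun x => G (d, x) := by
    intro d
    rw [Kernel.map_apply _ hG, Kernel.prod_apply, Kernel.id_apply, Kernel.const_apply,
      Measure.dirac_prod, Measure.map_map hG (by fun_prop)]
    rfl
  have hDZ : AEMeasurable (fun ω => (D ω, Z ω)) μ := hD.prodMk hZ.aemeasurable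
  have hlaw := h.map_prod_eq_prod_map_map hD hZ.aemeasurable
  rw [hZ.map_eq] at hlaw
  have hcd : condDistrib (fun ω => G (D ω, Z ω)) D μ =ᵐ[μ.map D] κ := by
    have : IsFiniteKernel κ := by unfold κ; infer_instance
    refine condDistrib_ae_eq_of_measure_eq_compProd D (Y := fun ω => G (D ω, Z ω))
      (hG.comp_aemeasurable hDZ) ?_
    have h1 : μ.map (fun ω => (D ω, G (D ω, Z ω))) =
        ((μ.map D).prod B).map (fun p => (p.1, G p)) := by
      rw [← hlaw, AEMeasurable.map_map_of_aemeasurable (by fun_prop) hDZ]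
      rfl
    rw [h1]
    ext s hs
    rw [Measure.map_apply (by fun_prop) hs, Measure.compProd_apply hs,
      Measure.prod_apply ((by fun_prop : Measurable fun p : U × W => (p.1, G p)) hs)]
    refine lintegral_congr fun d => ?_
    rw [hκ, Measure.map_apply (by fun_prop) (measurable_prodMk_left hs)]
    rfl
  rw [condEntropyBits]
  refine lintegral_congr_ae ?_
  filter_upwards [hcd] with d hd
  rw [hd, hκ]

/-! ### Quantizers with measurable ties -/

section Ties

variable {n : ℕ} {L M L' M' : QLattice n}

lemma QLattice.openCell_congr (h : M.Λ = L.Λ) : M.openCell = L.openCell := by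
  rw [QLattice.openCell, QLattice.openCell, h]

lemma QLattice.Q_eq_of_modL_mem (h : M.Λ = L.Λ) {x : EuclideanSpace ℝ (Fin n)}
    (hx : M.modL x ∈ M.openCell) : L.Q x = M.Q x :=
  L.Q_eq_of_sub_mem_openCell (h ▸ M.Q_mem x) (QLattice.openCell_congr h ▸ hx)

/-- Given x, the point x + d has an absolutely continuous law, so the fine quantizer meets no tie.
For the coarse one, y - d has no tie almost surely, simultaneously for the countably many y in Λ. -/
lemma ae_quantize_eq (h : M.Λ = L.Λ) (hQ : Measurable M.Q) (h' : M'.Λ = L'.Λ)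
    {Ω : Type*} [MeasurableSpace Ω] {μ : Measure Ω} [IsProbabilityMeasure μ]
    {x d : Ω → EuclideanSpace ℝ (Fin n)} (hx : AEMeasurable x μ)
    (hd : HasLaw d L.unif μ) (hxd : IndepFun x d μ) :
    ∀ᵐ ω ∂μ, quantize L L' (x ω) (d ω) = quantize M M' (x ω) (d ω) := by
  have := Measure.isProbabilityMeasure_map hx
  have hlaw := hxd.map_prod_eq_prod_map_map hx hd.aemeasurable
  have h1 : ∀ᵐ p ∂((μ.map x).prod L.unif), M.modL (p.1 + p.2) ∈ M.openCell := by
    have hm : MeasurableSet {p : EuclideanSpace ℝ (Fin n) × EuclideanSpace ℝ (Fin n) |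
        M.modL (p.1 + p.2) ∈ M.openCell} := by
      have : Measurable fun p : EuclideanSpace ℝ (Fin n) × EuclideanSpace ℝ (Fin n) =>
          M.modL (p.1 + p.2) := by
        unfold QLattice.modL
        fun_prop
      exact this M.measurableSet_openCell
    rw [Measure.ae_prod_iff_ae_ae hm]
    refine Eventually.of_forall fun z => ?_
    exact L.unif_absolutelyContinuous.ae_le
      ((measurePreserving_add_left volume z).quasiMeasurePreserving.ae M.ae_modL_mem_openCell)
  have h2 : ∀ᵐ z ∂L.unif, ∀ y : L.Λ, M'.modL (y - z) ∈ M'.openCell := by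
    refine L.unif_absolutelyContinuous.ae_le (ae_all_iff.2 fun y => ?_)
    exact (quasiMeasurePreserving_sub_left volume (y : EuclideanSpace ℝ (Fin n))).ae
      M'.ae_modL_mem_openCell
  rw [← hd.map_eq] at h1 h2
  rw [← hlaw] at h1
  filter_upwards [ae_of_ae_map (hx.prodMk hd.aemeasurable) h1, ae_of_ae_map hd.aemeasurable h2]
    with ω hω1 hω2
  have e1 := QLattice.Q_eq_of_modL_mem h hω1
  have e2 := QLattice.Q_eq_of_modL_mem h' (hω2 ⟨L.Q (x ω + d ω), L.Q_mem _⟩)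
  simp only at e1 e2
  rw [quantize, quantize, QLattice.modL, QLattice.modL, e2, e1]

end Ties

lemma condEntropyBits_congr {Ω S U : Type*} [MeasurableSpace Ω] [MeasurableSpace S]
    [StandardBorelSpace S] [Nonempty S] [MeasurableSpace U] {μ : Measure Ω} [IsFiniteMeasure μ]
    {Y Y' : Ω → S} {D : Ω → U} (h : Y =ᵐ[μ] Y') :
    condEntropyBits μ Y D = condEntropyBits μ Y' D := by
  rw [condEntropyBits, condEntropyBits, condDistrib_congr_left h]

/-- In this direction no measurability is needed, so the entropies need not be measurable in the
dithers. -/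
lemma sum_lintegral_le_lintegral_sum {ι α : Type*} [MeasurableSpace α] {μ : Measure α}
    (s : Finset ι) (f : ι → α → ℝ≥0∞) :
    ∑ i ∈ s, ∫⁻ x, f i x ∂μ ≤ ∫⁻ x, ∑ i ∈ s, f i x ∂μ := by
  classical
  induction s using Finset.induction_on with
  | empty => simp
  | insert i s hi ih =>
    simp_rw [Finset.sum_insert hi]
    exact (add_le_add_right ih _).trans (le_lintegral_add _ _)

lemma ofReal_sum_le {ι : Type*} (s : Finset ι) (f : ι → ℝ) :
    ENNReal.ofReal (∑ i ∈ s, f i) ≤ ∑ i ∈ s, ENNReal.ofReal (f i) := by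
  classical
  induction s using Finset.induction_on with
  | empty => simp
  | insert i s hi ih =>
    rw [Finset.sum_insert hi, Finset.sum_insert hi]
    exact ENNReal.ofReal_add_le.trans (add_le_add_right ih _)

/-! ### The scheme -/

section Scheme

variable {V Ω : Type*} {n Nout : ℕ} [MeasurableSpace Ω] {μ : Measure Ω} {P : Measure (V → ℝ)}
  {L : V → QLattice n}
  {X : V → Fin (Nout * n) → Ω → ℝ} {d : V → Fin Nout → Ω → EuclideanSpace ℝ (Fin n)}

lemma IsSourceWithDithers.hasLaw_block (h : IsSourceWithDithers μ P L X d) (i : Fin Nout) :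
    HasLaw (fun ω (j : Fin n) v => X v (finProdFinEquiv (i, j)) ω)
      (Measure.pi fun _ : Fin n => P) μ :=
  iIndepFun.hasLaw_pi (X := fun (j : Fin n) ω v => X v (finProdFinEquiv (i, j)) ω)
    (fun j => h.source_law _)
    (h.source_indep.precomp (g := fun j : Fin n => finProdFinEquiv (i, j))
      fun j k hjk => by simpa using hjk)

lemma IsSourceWithDithers.indepFun_block (h : IsSourceWithDithers μ P L X d) (i : Fin Nout)
    (S : Finset V) :
    IndepFun (fun ω (v : S) => d v i ω)
      (fun ω (j : Fin n) v => X v (finProdFinEquiv (i, j)) ω) μ :=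
  h.dither_indep_source.comp
    (φ := fun (y : V → Fin Nout → EuclideanSpace ℝ (Fin n)) (v : S) => y v i)
    (ψ := fun (x : V → Fin (Nout * n) → ℝ) (j : Fin n) v => x v (finProdFinEquiv (i, j)))
    (by fun_prop) (by fun_prop)

variable [Fintype V] [IsProbabilityMeasure μ] [IsProbabilityMeasure P] {L' M M' : V → QLattice n}

/-- The conditional entropy of the scheme as an average over the dithers of entropies of quantized
blocks of the source. -/
lemma IsSourceWithDithers.condEntropyBits_eq (h : IsSourceWithDithers μ P L X d)
    (hM : ∀ v, (M v).Λ = (L v).Λ) (hMm : ∀ v, Measurable (M v).Q)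
    (hM' : ∀ v, (M' v).Λ = (L' v).Λ) (hMm' : ∀ v, Measurable (M' v).Q) (i : Fin Nout)
    (S : Finset V) :
    condEntropyBits μ (fun ω (v : S) => quantize (L v) (L' v) (block (X v) i ω) (d v i ω))
        (fun ω (v : S) => d v i ω) =
      ∫⁻ z, entropyBits ((Measure.pi fun _ : Fin n => P).map fun x (v : S) =>
        quantize (M v) (M' v) (WithLp.toLp 2 fun j => x j v) (z v))
          ∂(μ.map fun ω (v : S) => d v i ω) := by
  have hB := h.hasLaw_block i
  have hI := h.indepFun_block i S
  have hdv : ∀ v, AEMeasurable (d v i) μ := fun v => (h.dither_law v i).aemeasurable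
  have hY : (fun ω (v : S) => quantize (L v) (L' v) (block (X v) i ω) (d v i ω)) =ᵐ[μ]
      fun ω (v : S) => quantize (M v) (M' v) (block (X v) i ω) (d v i ω) := by
    have : ∀ v : S, ∀ᵐ ω ∂μ, quantize (L v) (L' v) (block (X v) i ω) (d v i ω) =
        quantize (M v) (M' v) (block (X v) i ω) (d v i ω) := by
      intro v
      have hm : Measurable fun x : Fin n → V → ℝ =>
          (WithLp.toLp 2 fun j => x j v : EuclideanSpace ℝ (Fin n)) := by fun_prop
      exact ae_quantize_eq (hM v) (hMm v) (hM' v) (hm.comp_aemeasurable hB.aemeasurable)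
        (h.dither_law v i) (hI.comp (measurable_pi_apply v) hm).symm
    filter_upwards [ae_all_iff.2 this] with ω hω
    exact funext hω
  have hG : Measurable fun p : (S → EuclideanSpace ℝ (Fin n)) × (Fin n → V → ℝ) =>
      fun v : S => quantize (M v) (M' v) (WithLp.toLp 2 fun j => p.2 j v) (p.1 v) :=
    measurable_pi_lambda _ fun v => (QLattice.measurable_quantize (hMm v) (hMm' v)).comp
      (f := fun p : (S → EuclideanSpace ℝ (Fin n)) × (Fin n → V → ℝ) =>
        ((WithLp.toLp 2 fun j => p.2 j v : EuclideanSpace ℝ (Fin n)), p.1 v)) (by fun_prop)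
  rw [condEntropyBits_congr hY]
  exact condEntropyBits_of_indepFun (aemeasurable_pi_lambda _ fun v : S => hdv v) hB hI hG

variable [DecidableEq V] {T : SimpleGraph V}

/-- Apply the chain rule for fixed dithers and average. Each summand involves only its own dither,
so marginals of the dither vector suffice; the factor 1/log 2 converts nats to bits. -/
lemma IsSourceWithDithers.le_condEntropyBits (h : IsSourceWithDithers μ P L X d)
    (hP : IsGaussianMarkovTreeSource T P) (r : V)
    (hM : ∀ v, (M v).Λ = (L v).Λ) (hMm : ∀ v, Measurable (M v).Q)
    (hM' : ∀ v, (M' v).Λ = (L' v).Λ) (hMm' : ∀ v, Measurable (M' v).Q) (i : Fin Nout)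
    (S : Finset V) {b : V → ℝ}
    (hb : ∀ v, ENNReal.ofReal (b v) ≤
      ∫⁻ z, predEntropy T P r v (fun x => quantize (M v) (M' v) x z) ∂(L v).unif) :
    ENNReal.ofReal (∑ v ∈ S, b v) * ENNReal.ofReal (Real.log 2)⁻¹ ≤
      condEntropyBits μ (fun ω (v : S) => quantize (L v) (L' v) (block (X v) i ω) (d v i ω))
        (fun ω (v : S) => d v i ω) := by
  rw [h.condEntropyBits_eq hM hMm hM' hMm' i S]
  simp_rw [entropyBits_eq]
  rw [lintegral_mul_const' _ _ ENNReal.ofReal_ne_top]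
  refine mul_le_mul_left ?_ _
  have hdv : ∀ v, AEMeasurable (d v i) μ := fun v => (h.dither_law v i).aemeasurable
  have hmarg : ∀ v : S, (μ.map fun ω (v : S) => d v i ω).map (fun z => z v) = (L v).unif := by
    intro v
    rw [AEMeasurable.map_map_of_aemeasurable (measurable_pi_apply v).aemeasurable
      (aemeasurable_pi_lambda _ fun v : S => hdv v)]
    exact (h.dither_law v i).map_eq
  let f : S → (S → EuclideanSpace ℝ (Fin n)) → ℝ≥0∞ := fun v z =>
    predEntropy T P r v (fun x => quantize (M v) (M' v) x (z v))
  calc ENNReal.ofReal (∑ v ∈ S, b v) ≤ ∑ v ∈ S, ENNReal.ofReal (b v) := ofReal_sum_le _ _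
    _ = ∑ v : S, ENNReal.ofReal (b v) := (Finset.sum_coe_sort S _).symm
    _ ≤ ∑ v : S, ∫⁻ z, f v z ∂(μ.map fun ω (v : S) => d v i ω) := by
      refine Finset.sum_le_sum fun v _ => (hb v).trans ?_
      rw [← hmarg v]
      exact lintegral_map_le _ _
    _ ≤ ∫⁻ z, ∑ v : S, f v z ∂(μ.map fun ω (v : S) => d v i ω) :=
      sum_lintegral_le_lintegral_sum _ _
    _ ≤ _ := by
      refine lintegral_mono fun z => ?_
      classical
      -- The chain rule takes a quantizer at every vertex; the values outside S are irrelevant.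
      let z' : V → EuclideanSpace ℝ (Fin n) := fun v => if hv : v ∈ S then z ⟨v, hv⟩ else 0
      have hz : ∀ v : S, z' v = z v := fun v => dif_pos v.2
      have key := hP.sum_predEntropy_le r (q := fun v x => quantize (M v) (M' v) x (z' v))
        (fun v => (QLattice.measurable_quantize (hMm v) (hMm' v)).comp (f := fun x => (x, z' v))
          (by fun_prop)) (fun v => QLattice.countable_range_quantize _) S
      rw [← Finset.sum_coe_sort S] at key
      simpa only [hz] using key

end Scheme

end TreeKey

end

/-! ### Assembly of the lemma -/

theorem lemma2 {V : Type*} [Fintype V] [DecidableEq V] (T : SimpleGraph V)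
    (P : Measure (V → ℝ)) [IsProbabilityMeasure P]
    (hP : TreeKey.IsGaussianMarkovTreeSource T P) (r : V)
    (δ₀ : ℝ) (hδ₀ : 0 < δ₀) (R : V → ℝ) (L L' : V → ∀ n, TreeKey.QLattice n)
    (hL : TreeKey.IsGoodNestedFamily δ₀ R L L')
    (δ : ℝ) (hδ : 0 < δ) :
    ∀ᶠ n : ℕ in atTop, ∀ (Nout : ℕ) (Ω : Type*) [MeasurableSpace Ω] (μ : Measure Ω)
      [IsProbabilityMeasure μ] (X : V → Fin (Nout * n) → Ω → ℝ)
      (d : V → Fin Nout → Ω → EuclideanSpace ℝ (Fin n)),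
      TreeKey.IsSourceWithDithers μ P (fun v => L v n) X d → ∀ i : Fin Nout,
      ENNReal.ofReal
          (1 / 2 * Real.logb 2 (1 + 1 / (L r n).secondMoment)
            + ∑ u ∈ (TreeKey.coreVertices T r).erase r,
                1 / 2 * Real.logb 2
                  (1 + (1 - TreeKey.corr P u (TreeKey.parent T r u) ^ 2) / (L u n).secondMoment)
            - δ)
        ≤ TreeKey.condEntropyBits μ
            (fun ω (v : TreeKey.coreVertices T r) =>
              TreeKey.quantize (L v n) (L' v n) (TreeKey.block (X v) i ω) (d v i ω))
            (fun ω (v : TreeKey.coreVertices T r) => d v i ω) / n := by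
  classical
  set C := TreeKey.coreVertices T r
  have hlog : 0 < Real.log 2 := Real.log_pos one_lt_two
  have hr : r ∈ C := by simp [C, TreeKey.coreVertices]
  have hcard : 0 < (Fintype.card V : ℝ) := by
    exact_mod_cast Fintype.card_pos_iff.2 ⟨r⟩
  -- Each vertex may lose nε nats. At most |V| vertices contribute, for a total of at most nδ bits.
  set ε : ℝ := δ * Real.log 2 / Fintype.card V
  have hε : 0 < ε := by positivity
  have hv := eventually_all.2 fun v => TreeKey.eventually_le_lintegral_natEntropy
    (hL.covering v) (hL.awgn v) hδ₀ (hL.rate v) (hL.volume_coarse v)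
    (c := TreeKey.parentWeight T P r v) (a := TreeKey.innovationVar T P r v)
    (by rw [hP.coe_innovationVar]; ring) hε
  filter_upwards [hv, eventually_gt_atTop 0] with n hn hn0 Nout Ω _ μ _ X d h i
  choose M hM hMm using fun v => (L v n).exists_measurable_Q
  choose M' hM' hMm' using fun v => (L' v n).exists_measurable_Q
  have key := h.le_condEntropyBits hP r hM hMm hM' hMm' i C
    (fun v => hn v (M v) (M' v) (hM v) (hM' v) (hMm v) (hMm' v))
  have hn0' : (0 : ℝ) < n := Nat.cast_pos.2 hn0
  rw [ENNReal.le_div_iff_mul_le (Or.inl (Nat.cast_ne_zero.2 hn0.ne'))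
    (Or.inl (ENNReal.natCast_ne_top n)), ← ENNReal.ofReal_natCast,
    ← ENNReal.ofReal_mul' hn0'.le]
  refine le_trans ?_ key
  rw [← ENNReal.ofReal_mul' (inv_nonneg.2 hlog.le)]
  refine ENNReal.ofReal_le_ofReal ?_
  have hCε : C.card * ε ≤ δ * Real.log 2 := by
    calc (C.card : ℝ) * ε ≤ Fintype.card V * ε :=
          mul_le_mul_of_nonneg_right (by exact_mod_cast Finset.card_le_univ C) hε.le
      _ = δ * Real.log 2 := mul_div_cancel₀ _ hcard.ne'
  have hterm : ∀ u ∈ C.erase r, 1 / 2 * Real.log (1 +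
      (TreeKey.innovationVar T P r u : ℝ) / (L u n).secondMoment) = Real.log 2 *
        (1 / 2 * Real.logb 2 (1 + (1 - TreeKey.corr P u (TreeKey.parent T r u) ^ 2) /
          (L u n).secondMoment)) := by
    intro u hu
    rw [hP.coe_innovationVar, TreeKey.parentWeight, if_neg (Finset.ne_of_mem_erase hu),
      Real.logb]
    field_simp
  have hroot : 1 / 2 * Real.log (1 +
      (TreeKey.innovationVar T P r r : ℝ) / (L r n).secondMoment) = Real.log 2 *
        (1 / 2 * Real.logb 2 (1 + 1 / (L r n).secondMoment)) := by
    rw [hP.coe_innovationVar, TreeKey.parentWeight, if_pos rfl, Real.logb,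
      zero_pow two_ne_zero, sub_zero]
    field_simp
  have hsum : ∑ v ∈ C, (n : ℝ) * (1 / 2 * Real.log (1 +
      (TreeKey.innovationVar T P r v : ℝ) / (L v n).secondMoment) - ε) =
      n * (Real.log 2 * (1 / 2 * Real.logb 2 (1 + 1 / (L r n).secondMoment) +
        ∑ u ∈ C.erase r, 1 / 2 * Real.logb 2
          (1 + (1 - TreeKey.corr P u (TreeKey.parent T r u) ^ 2) / (L u n).secondMoment)) -
        C.card * ε) := by
    rw [← Finset.mul_sum, Finset.sum_sub_distrib, Finset.sum_const, nsmul_eq_mul,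
      ← Finset.add_sum_erase _ _ hr, hroot, Finset.sum_congr rfl hterm, ← Finset.mul_sum, mul_add]
  rw [hsum, ← div_eq_mul_inv, le_div_iff₀ hlog]
  nlinarith [mul_le_mul_of_nonneg_left hCε hn0'.le]
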